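/- **Shapes and tableaux.** For a strict partition $\lambda=(\lambda_1>\dots>\lambda_\ell>0)$ let $S(\lambda)=\{(i,j): 1\le i\le \ell,\ i\le j\le \lambda_i+i-1\}$ (matrix coordinates; the main diagonal consists of the boxes $(i,i)$), and for $\mu\subseteq\lambda$ (i.e. $\mu_i\le\lambda_i$ for all $i$) let the skew shifted shape $\lambda/\mu$ be $S(\lambda)\setminus S(\mu)$. A *shifted Young tableau* (SYT) of shape $\lambda/\mu$ is a filling of $\lambda/\mu$ with letters $1'<1<2'<2<\cdots$ that is weakly increasing along rows and down columns, with at most one $k$ in each column and at most one $k'$ in each row, for every $k\ge1$. It is *semistandard* if no entry on the main diagonal is primed. We say that $T$ *extends* $S$ if $S$ and $T$ have shapes $\mu/\nu$ and $\lambda/\mu$ for some strict partitions $\nu\subseteq\mu\subseteq\lambda$. Bold letters $\mathbf a,\mathbf b$ stand for a letter with or without prime. **Shifted tableau switching.** Draw $S$ and $T$ in one plane. Let an $\mathbf a$-box be a box with entry $a$ or $a'$ of $S$, and a $\mathbf b$-box one with entry $b$ or $b'$ of $T$. As long as some $\mathbf a$-box has a $\mathbf b$-box as its neighbor to the east or to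 the south, choose among such $\mathbf a$-boxes the easternmost with unprimed entry $a$ if there is one, otherwise the southernmost with entry $a'$, and apply the adequate *switch* to the chosen box $\square$ (rows are separated by $/$, and $\cdot$ is another box). If only one of the two neighbors is a $\mathbf b$-box: - (S1) $\mathbf a\,\mathbf b\mapsto\mathbf b\,\mathbf a$; - (S2) $\mathbf a/\mathbf b\mapsto\mathbf b/\mathbf a$; - (S3) $\mathbf a\,b'\,/\,\cdot\,\mathbf b\mapsto\mathbf b\,b\,/\,\cdot\,\mathbf a$, where $\square$ is the first box and is on the main diagonal; - (S4) $\mathbf a\,a\,/\,\cdot\,\mathbf b\mapsto\mathbf b\,a'\,/\,\cdot\,\mathbf a$, where the first box is on the main diagonal and $\square$ is the second box. If both neighbors are $\mathbf b$-boxes: - (S5) $\mathbf a\,b'\,/\,\mathbf b\,\cdot\mapsto b'\,\mathbf a\,/\,\mathbf b\,\cdot$; - (S6) $\mathbf a\,b\,/\,\mathbf b\,\cdot\mapsto\mathbf b\,b\,/\,\mathbf a\,\cdot$; - (S7) $\mathbf a\,a\,b\,/\,\cdot\,\mathbf b\,\cdot\mapsto\mathbf b\,a'\,b\,/\,\cdot\,\mathbf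 a\,\cdot$, where the first box is on the main diagonal and $\square$ is the second box. The diagonal switches (S3), (S4), (S7) take precedence over (S1), (S2), (S6), respectively. Let $m$ and $n$ be the largest letters (without primes) of $S$ and $T$. Carry out this process to its end successively for $(a,b)=(m,1),\dots,(m,n),(m-1,1),\dots,(m-1,n),\dots,(1,1),\dots,(1,n)$. The fillings that $S$ and $T$ finally become are denoted by $S_T$ and ${}^ST$, and $\Sigma(S,T)=({}^ST,S_T)$. **LRS tableaux.** The word $w(T)$ of $T$ is read row by row, from the top row down, each row from right to left. For a word $w$ of length $n$ let $\hat w$ be obtained by reading $w$ from right to left and replacing each $k$ by $(k+1)'$ and each $k'$ by $k$; write $w\hat w=a_1\cdots a_{2n}$ and let $m_i(j)$ be the number of unprimed letters $i$ among $a_1,\dots,a_j$. The word $w$ has the *lattice property* if, for all $i\ge2$ and $0\le j<2n$, $m_i(j)=m_{i-1}(j)$ implies $a_{j+1}\notin\{i,i'\}$. A *Littlewood–Richardson–Stembridge (LRS) tableau* is a semistandard SYT $T$ such that its weight (the sequence whose $k$-th term is the number of entries $k$ and $k'$) is a strict partition, $w(T)$ has the lattice property, and for every $k$ occurring, primed or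 not, in $w(T)$ the rightmost letter among the $k$ and $k'$ in $w(T)$ is unprimed. **Theorem.** Let $S$ and $T$ be SYTs of shapes $\mu/\nu$ and $\lambda/\mu$, respectively, so that $T$ extends $S$. Then there is a strict partition $\kappa$ with $\nu\subseteq\kappa\subseteq\lambda$ such that ${}^ST$ is an SYT of shape $\kappa/\nu$ and $S_T$ is an SYT of shape $\lambda/\kappa$ (so $S_T$ extends ${}^ST$), and: (a) $\Sigma({}^ST,S_T)=(S,T)$; that is, $\Sigma$ is an involution. (b) If $T$ is an LRS tableau, then so is ${}^ST$. (c) If $S$ is an LRS tableau, then so is $S_T$. -/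

import Mathlib

namespace ShiftedSwitching

/-! ## Strict partitions and shifted shapes

Boxes are pairs `(i, j)` in matrix-style coordinates, with rows and columns numbered from `0`;
the main diagonal consists of the boxes `(i, i)`. -/

/-- A strict partition `part 0 > part 1 > ⋯ > part (ℓ - 1) > 0 = part ℓ = part (ℓ + 1) = ⋯`. -/
@[ext]
structure StrictPartition where
  part : ℕ → ℕ
  strict : ∀ i, part (i + 1) < part i ∨ part (i + 1) = 0

/-- The shifted shape: row `i` occupies the columns `i, i + 1, …, i + part i - 1`. All boxes lie
in the first `part 0` rows and columns, so that the bound below excludes nothing. -/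
def StrictPartition.diagram (lam : StrictPartition) : Finset (ℕ × ℕ) :=
  (Finset.range (lam.part 0) ×ˢ Finset.range (lam.part 0)).filter
    (fun p => p.1 ≤ p.2 ∧ p.2 < lam.part p.1 + p.1)

theorem StrictPartition.part_add_le (lam : StrictPartition) (i : ℕ) (h : 0 < lam.part i) :
    lam.part i + i ≤ lam.part 0 := by
  induction i with
  | zero => simp
  | succ i ih =>
    rcases lam.strict i with h1 | h1
    · have := ih (by omega)
      omega
    · omega

theorem StrictPartition.mem_diagram (lam : StrictPartition) (p : ℕ × ℕ) :
    p ∈ lam.diagram ↔ p.1 ≤ p.2 ∧ p.2 < lam.part p.1 + p.1 := by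
  simp only [StrictPartition.diagram, Finset.mem_filter, Finset.mem_product, Finset.mem_range,
    and_iff_right_iff_imp]
  rintro ⟨h1, h2⟩
  have := lam.part_add_le p.1 (by omega)
  omega

/-- Containment `mu ⊆ lam` of strict partitions. -/
def StrictPartition.Contains (lam mu : StrictPartition) : Prop :=
  ∀ i, mu.part i ≤ lam.part i

/-! ## Letters and fillings -/

/-- The letters of the alphabet `1' < 1 < 2' < 2 < ⋯`; `val` is the letter without its prime. -/
@[ext]
structure Letter where
  val : ℕ
  pos : 0 < val
  primed : Bool
  deriving DecidableEq

/-- The order `1' < 1 < 2' < 2 < ⋯`. -/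
def Letter.le (x y : Letter) : Prop :=
  x.val < y.val ∨ (x.val = y.val ∧ (x.primed = true ∨ y.primed = false))

/-- Put a prime on a letter. -/
def Letter.addPrime (x : Letter) : Letter := ⟨x.val, x.pos, true⟩

/-- Erase the prime of a letter. -/
def Letter.erasePrime (x : Letter) : Letter := ⟨x.val, x.pos, false⟩

/-- A filling of a finite set of boxes, its `shape`, with entries in `α`; a box is empty when its
entry is `none`. -/
structure Filling (α : Type) where
  entry : ℕ × ℕ → Option α
  shape : Finset (ℕ × ℕ)
  mem_shape : ∀ p, p ∈ shape ↔ (entry p).isSome = true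

namespace Filling

variable {α β : Type}

@[ext]
theorem ext {F G : Filling α} (h : ∀ p, F.entry p = G.entry p) : F = G := by
  obtain ⟨f, s, hs⟩ := F
  obtain ⟨g, t, ht⟩ := G
  have hfg : f = g := funext h
  subst hfg
  have hst : s = t := by
    ext p
    rw [hs, ht]
  subst hst
  rfl

/-- Interchange the contents of the boxes `p` and `q`. -/
def swap (F : Filling α) (p q : ℕ × ℕ) : Filling α where
  entry r := F.entry (Equiv.swap p q r)
  shape := F.shape.map (Equiv.swap p q).toEmbedding
  mem_shape r := by
    rw [Finset.mem_map_equiv, F.mem_shape, Equiv.symm_swap]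

/-- Replace the letter `x` in the box `p`, if there is one, by `f x`. -/
def modify (F : Filling α) (p : ℕ × ℕ) (f : α → α) : Filling α where
  entry r := if r = p then (F.entry r).map f else F.entry r
  shape := F.shape
  mem_shape r := by
    rw [F.mem_shape]
    split <;> simp

/-- Apply the partial function `f` to all entries, dropping those on which it is `none`. -/
def filterMap (F : Filling α) (f : α → Option β) : Filling β where
  entry p := (F.entry p).bind f
  shape := F.shape.filter (fun p => ((F.entry p).bind f).isSome = true)
  mem_shape p := by
    rw [Finset.mem_filter, F.mem_shape]
    cases F.entry p <;> simp

end Filling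

/-! ## Shifted Young tableaux -/

/-- `T` is a shifted Young tableau of shape `lam/mu`. -/
structure IsSYT (lam mu : StrictPartition) (T : Filling Letter) : Prop where
  contains : lam.Contains mu
  shape_eq : T.shape = lam.diagram \ mu.diagram
  row_weak : ∀ i j k x y, j < k → T.entry (i, j) = some x → T.entry (i, k) = some y → x.le y
  col_weak : ∀ i k j x y, i < k → T.entry (i, j) = some x → T.entry (k, j) = some y → x.le y
  /-- each column contains at most one unprimed `k` -/
  col_unprimed : ∀ i k j x, x.primed = false →
    T.entry (i, j) = some x → T.entry (k, j) = some x → i = k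
  /-- each row contains at most one `k'` -/
  row_primed : ∀ i j k x, x.primed = true →
    T.entry (i, j) = some x → T.entry (i, k) = some x → j = k

/-- `T` is a semistandard shifted Young tableau of shape `lam/mu`. -/
structure IsSSYT (lam mu : StrictPartition) (T : Filling Letter) : Prop extends
    IsSYT lam mu T where
  diag_unprimed : ∀ i x, T.entry (i, i) = some x → x.primed = false

/-- The number of occurrences of `k` and `k'` in `T`. -/
def weight (T : Filling Letter) (k : ℕ) : ℕ :=
  (T.shape.filter (fun p => (T.entry p).any (fun x => x.val = k) = true)).card

/-- The largest `k` such that `k` or `k'` occurs in `T` (and `0` if `T` is empty). -/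
def maxLetter (T : Filling Letter) : ℕ :=
  T.shape.sup (fun p => (T.entry p).elim 0 Letter.val)

/-! ## The word of a filling and Littlewood–Richardson–Stembridge tableaux -/

/-- The word of a filling: its entries are read row by row, starting with the top row, and from
right to left in each row. -/
def word (T : Filling Letter) : List Letter :=
  (List.range (T.shape.sup (fun p => p.1 + 1))).flatMap (fun i =>
    (List.range (T.shape.sup (fun p => p.2 + 1))).reverse.filterMap (fun j => T.entry (i, j)))

/-- The word `ŵ`: read `w` from right to left and replace each `k` by `(k + 1)'` and each `k'`
by `k`. -/
def hatWord (w : List Letter) : List Letter :=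
  w.reverse.map (fun x =>
    if x.primed = true then x.erasePrime else ⟨x.val + 1, Nat.succ_pos _, true⟩)

/-- The multiplicity of the unprimed letter `i` among the first `j` letters of `w ŵ`. -/
def mult (w : List Letter) (i j : ℕ) : ℕ :=
  ((w ++ hatWord w).take j).countP (fun x => x.val = i ∧ x.primed = false)

/-- The lattice property: whenever `m_i(j) = m_{i-1}(j)` (with `i ≥ 2`, written `i + 1` below),
the letter following the first `j` letters of `w ŵ` is neither `i` nor `i'`. -/
def IsLatticeWord (w : List Letter) : Prop :=
  ∀ i j x, 1 ≤ i → (w ++ hatWord w)[j]? = some x →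
    mult w (i + 1) j = mult w i j → x.val ≠ i + 1

/-- A word is an LRS word if it satisfies the lattice property and, for every `i` occurring in
`|w|`, the rightmost `i` of `|w|` is unprimed in `w`. -/
def IsLRSWord (w : List Letter) : Prop :=
  IsLatticeWord w ∧
    ∀ i x, (w.filter (fun y => y.val = i)).getLast? = some x → x.primed = false

/-- `T` is a Littlewood–Richardson–Stembridge tableau of shape `lam/mu`: a semistandard shifted
Young tableau of this shape whose weight is a strict partition and whose word is an LRS word. -/
structure IsLRS (lam mu : StrictPartition) (T : Filling Letter) : Prop extends
    IsSSYT lam mu T where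
  weight_strict : ∃ rho : StrictPartition, ∀ k, weight T (k + 1) = rho.part k
  lrs_word : IsLRSWord (word T)

/-! ## Switches

The union `S ∪ T` is kept as one filling with entries in `Letter ⊕ Letter`: the entries of `S`
are marked by `Sum.inl`, those of `T` by `Sum.inr`. -/

/-- A filling in which the letters of two tableaux are drawn simultaneously. -/
abbrev BiFilling := Filling (Letter ⊕ Letter)

/-- The union of two fillings (used when their shapes are disjoint). -/
def union (S T : Filling Letter) : BiFilling where
  entry p := ((S.entry p).map Sum.inl).or ((T.entry p).map Sum.inr)
  shape := S.shape ∪ T.shape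
  mem_shape p := by
    rw [Finset.mem_union, S.mem_shape, T.mem_shape]
    simp

/-- The letters of the first tableau. -/
def fstPart (F : BiFilling) : Filling Letter := F.filterMap Sum.getLeft?

/-- The letters of the second tableau. -/
def sndPart (F : BiFilling) : Filling Letter := F.filterMap Sum.getRight?

/-- The box `p` contains `a` or `a'`, as a letter of the first tableau. -/
def IsABox (a : ℕ) (F : BiFilling) (p : ℕ × ℕ) : Prop :=
  (F.entry p).any (Sum.elim (fun x => x.val = a) (fun _ => false)) = true

/-- The box `p` contains `b` or `b'`, as a letter of the second tableau. -/
def IsBBox (b : ℕ) (F : BiFilling) (p : ℕ × ℕ) : Prop :=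
  (F.entry p).any (Sum.elim (fun _ => false) (fun x => x.val = b)) = true

/-- The letter in the box `p` is primed. -/
def IsPrimed (F : BiFilling) (p : ℕ × ℕ) : Prop :=
  (F.entry p).any (Sum.elim Letter.primed Letter.primed) = true

instance (a : ℕ) (F : BiFilling) (p : ℕ × ℕ) : Decidable (IsABox a F p) := by
  unfold IsABox; infer_instance

instance (b : ℕ) (F : BiFilling) (p : ℕ × ℕ) : Decidable (IsBBox b F p) := by
  unfold IsBBox; infer_instance

instance (F : BiFilling) (p : ℕ × ℕ) : Decidable (IsPrimed F p) := by
  unfold IsPrimed; infer_instance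

/-- The neighbor to the east. -/
def east (p : ℕ × ℕ) : ℕ × ℕ := (p.1, p.2 + 1)

/-- The neighbor to the south. -/
def south (p : ℕ × ℕ) : ℕ × ℕ := (p.1 + 1, p.2)

/-- The neighbor to the west (only used for boxes not in column `0`). -/
def west (p : ℕ × ℕ) : ℕ × ℕ := (p.1, p.2 - 1)

/-- The neighbor to the southeast. -/
def southeast (p : ℕ × ℕ) : ℕ × ℕ := (p.1 + 1, p.2 + 1)

/-- The `a`-boxes (primed or not) that are neighbors to the north or west of a `b`-box. -/
def switchable (a b : ℕ) (F : BiFilling) : Finset (ℕ × ℕ) :=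
  F.shape.filter (fun p => IsABox a F p ∧ (IsBBox b F (east p) ∨ IsBBox b F (south p)))

/-- No `a`-box can be switched with a `b`-box. -/
def FullySwitched (a b : ℕ) (F : BiFilling) : Prop := switchable a b F = ∅

instance (a b : ℕ) (F : BiFilling) : Decidable (FullySwitched a b F) := by
  unfold FullySwitched; infer_instance

/-- The easternmost box of a set of boxes (the southernmost one of these in case of a tie). -/
def easternmost (s : Finset (ℕ × ℕ)) (h : s.Nonempty) : ℕ × ℕ :=
  (ofLex ((s.image (fun p => toLex (p.2, p.1))).max' (h.image _))).swap

/-- The southernmost box of a set of boxes (the easternmost one of these in case of a tie). -/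
def southernmost (s : Finset (ℕ × ℕ)) (h : s.Nonempty) : ℕ × ℕ :=
  ofLex ((s.image (fun p => toLex p)).max' (h.image _))

theorem easternmost_mem (s : Finset (ℕ × ℕ)) (h : s.Nonempty) : easternmost s h ∈ s := by
  have h1 := Finset.max'_mem (s.image (fun p : ℕ × ℕ => toLex (p.2, p.1))) (h.image _)
  obtain ⟨q, hq, hq'⟩ := Finset.mem_image.mp h1
  have : easternmost s h = q := by
    unfold easternmost
    rw [← hq']
    rfl
  rwa [this]

theorem southernmost_mem (s : Finset (ℕ × ℕ)) (h : s.Nonempty) : southernmost s h ∈ s := by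
  have h1 := Finset.max'_mem (s.image (fun p : ℕ × ℕ => toLex p)) (h.image _)
  obtain ⟨q, hq, hq'⟩ := Finset.mem_image.mp h1
  have : southernmost s h = q := by
    unfold southernmost
    rw [← hq']
    rfl
  rwa [this]

/-- The box to which the next switch is applied: the easternmost unprimed `a`-box that is the
neighbor to the north or west of a `b`-box if there is one, and otherwise the southernmost such
`a'`-box; `none` if the filling is fully switched. -/
def switchBox (a b : ℕ) (F : BiFilling) : Option (ℕ × ℕ) :=
  if h : ((switchable a b F).filter (fun p => ¬ IsPrimed F p)).Nonempty then
    some (easternmost _ h)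
  else if h' : (switchable a b F).Nonempty then some (southernmost _ h')
  else none

/-- Put a prime on the letter in the box `p`. -/
def primeAt (F : BiFilling) (p : ℕ × ℕ) : BiFilling :=
  F.modify p (Sum.map Letter.addPrime Letter.addPrime)

/-- Erase the prime of the letter in the box `p`. -/
def unprimeAt (F : BiFilling) (p : ℕ × ℕ) : BiFilling :=
  F.modify p (Sum.map Letter.erasePrime Letter.erasePrime)

/-- `p = (i, i + 1)` is an unprimed `a`-box whose neighbor `(i, i)` to the west, on the main
diagonal, is an `a`-box too, and whose neighbor to the south, on the main diagonal, is a
`b`-box: the configuration in which the diagonal switches (S4) and (S7) below are applied to `p`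
(unless the neighbor of `p` to the east is a `b'`-box). -/
def DiagPair (a b : ℕ) (F : BiFilling) (p : ℕ × ℕ) : Prop :=
  p.2 = p.1 + 1 ∧ ¬ IsPrimed F p ∧ IsABox a F (west p) ∧ IsBBox b F (south p)

/-- `p = (i, i)` is on the main diagonal, `(i, i + 1)` is a `b'`-box and `(i + 1, i + 1)` is a
`b`-box (primed or not): the configuration in which the diagonal switch (S3) below
is applied to `p`. -/
def DiagSingle (b : ℕ) (F : BiFilling) (p : ℕ × ℕ) : Prop :=
  p.2 = p.1 ∧ IsBBox b F (east p) ∧ IsPrimed F (east p) ∧ IsBBox b F (southeast p)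

instance (a b : ℕ) (F : BiFilling) (p : ℕ × ℕ) : Decidable (DiagPair a b F p) := by
  unfold DiagPair; infer_instance

instance (b : ℕ) (F : BiFilling) (p : ℕ × ℕ) : Decidable (DiagSingle b F p) := by
  unfold DiagSingle; infer_instance

/-- The adequate switch, applied to the `a`-box `p` with a `b`-box to the east or to the south.
Letters whose prime is not specified are written in capitals (`A`, `B`), `.` is any other box, and
rows are separated by `/`. When only one of the two neighbors of `p` is a `b`-box, the switches are
(S1) `A B ↦ B A`,
(S2) `A / B ↦ B / A`,
(S3) `A b' / . B ↦ B b / . A` with the first box `p` on the main diagonal,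
(S4) `A a / . B ↦ B a' / . A` with the first box on the main diagonal and `p` the second box.
When both neighbors of `p` are `b`-boxes, they are
(S5) `A b' / B . ↦ b' A / B .`,
(S6) `A b / B . ↦ B b / A .`,
(S7) `A a b / . B . ↦ B a' b / . A .` with the first box on the main diagonal and `p` the second
box.
The diagonal switches (S3), (S4), (S7) have precedence over (S1), (S2), (S6), respectively. -/
def switchAt (a b : ℕ) (F : BiFilling) (p : ℕ × ℕ) : BiFilling :=
  if IsBBox b F (east p) ∧ IsBBox b F (south p) then
    if IsPrimed F (east p) then F.swap p (east p) -- (S5)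
    else if DiagPair a b F p then primeAt (F.swap (west p) (south p)) p -- (S7)
    else F.swap p (south p) -- (S6)
  else if IsBBox b F (east p) then
    if DiagSingle b F p then unprimeAt (F.swap p (southeast p)) (east p) -- (S3)
    else F.swap p (east p) -- (S1)
  else if IsBBox b F (south p) then
    if DiagPair a b F p then primeAt (F.swap (west p) (south p)) p -- (S4)
    else F.swap p (south p) -- (S2)
  else F

/-- The map `σ`: one step of the switching process of the `a`-boxes of the first tableau with the
`b`-boxes of the second one; nothing happens if the filling is fully switched. -/
def sigma (a b : ℕ) (F : BiFilling) : BiFilling :=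
  match switchBox a b F with
  | none => F
  | some p => switchAt a b F p

/-! ### Termination -/

/-- The sum of `i + j` over all `a`-boxes `(i, j)`; every switch increases it. -/
def potential (a : ℕ) (F : BiFilling) : ℕ :=
  ∑ p ∈ F.shape, if IsABox a F p then p.1 + p.2 else 0

theorem IsABox.mem_shape {a : ℕ} {F : BiFilling} {p : ℕ × ℕ} (h : IsABox a F p) :
    p ∈ F.shape := by
  rw [F.mem_shape]
  unfold IsABox at h
  cases hp : F.entry p <;> simp_all

theorem IsBBox.mem_shape {b : ℕ} {F : BiFilling} {p : ℕ × ℕ} (h : IsBBox b F p) :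
    p ∈ F.shape := by
  rw [F.mem_shape]
  unfold IsBBox at h
  cases hp : F.entry p <;> simp_all

theorem IsBBox.not_isABox {a b : ℕ} {F : BiFilling} {p : ℕ × ℕ} (h : IsBBox b F p) :
    ¬ IsABox a F p := by
  unfold IsBBox at h
  unfold IsABox
  cases hp : F.entry p with
  | none => simp
  | some x => cases x <;> simp_all

theorem Filling.swap_shape {α : Type} (F : Filling α) {p q : ℕ × ℕ} (hp : p ∈ F.shape)
    (hq : q ∈ F.shape) : (F.swap p q).shape = F.shape := by
  ext r
  show r ∈ F.shape.map (Equiv.swap p q).toEmbedding ↔ r ∈ F.shape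
  rw [Finset.mem_map_equiv, Equiv.symm_swap]
  by_cases h1 : r = p
  · subst h1; simp [hp, hq]
  · by_cases h2 : r = q
    · subst h2; simp [hp, hq]
    · rw [Equiv.swap_apply_of_ne_of_ne h1 h2]

theorem potential_swap_lt {a b : ℕ} {F : BiFilling} {p q : ℕ × ℕ} (hp : IsABox a F p)
    (hq : IsBBox b F q) (hpq : p.1 + p.2 < q.1 + q.2) :
    potential a F < potential a (F.swap p q) := by
  have key : potential a (F.swap p q) = ∑ r ∈ F.shape,
      if IsABox a F r then (Equiv.swap p q r).1 + (Equiv.swap p q r).2 else 0 := by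
    show (∑ r ∈ F.shape.map (Equiv.swap p q).toEmbedding,
      if IsABox a (F.swap p q) r then r.1 + r.2 else 0) = _
    rw [Finset.sum_map]
    refine Finset.sum_congr rfl fun r _ => ?_
    have : IsABox a (F.swap p q) ((Equiv.swap p q).toEmbedding r) ↔ IsABox a F r := by
      unfold IsABox Filling.swap
      simp
    simp only [this]
    rfl
  rw [key]
  refine Finset.sum_lt_sum (fun r _ => ?_) ⟨p, hp.mem_shape, ?_⟩
  · by_cases h1 : r = p
    · subst h1
      rw [Equiv.swap_apply_left]
      split <;> omega
    · by_cases h2 : r = q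
      · subst h2
        simp [hq.not_isABox]
      · rw [Equiv.swap_apply_of_ne_of_ne h1 h2]
  · simp [hp, hpq]

theorem potential_modify (a : ℕ) (F : BiFilling) (p : ℕ × ℕ) (f : Letter → Letter)
    (hf : ∀ x, (f x).val = x.val) :
    potential a (F.modify p (Sum.map f f)) = potential a F := by
  show (∑ r ∈ F.shape, if IsABox a (F.modify p (Sum.map f f)) r then r.1 + r.2 else 0) = _
  refine Finset.sum_congr rfl fun r _ => ?_
  have : IsABox a (F.modify p (Sum.map f f)) r ↔ IsABox a F r := by
    unfold IsABox Filling.modify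
    by_cases h : r = p
    · simp only [h, if_true]
      cases F.entry p with
      | none => simp
      | some x => cases x <;> simp [hf]
    · simp [h]
  simp only [this]

theorem switchAt_spec {a b : ℕ} {F : BiFilling} {p : ℕ × ℕ} (hp : p ∈ switchable a b F) :
    (switchAt a b F p).shape = F.shape ∧ potential a F < potential a (switchAt a b F p) := by
  obtain ⟨-, hA, hB⟩ := Finset.mem_filter.mp hp
  have hE : IsBBox b F (east p) → (F.swap p (east p)).shape = F.shape ∧
      potential a F < potential a (F.swap p (east p)) := fun h =>
    ⟨F.swap_shape hA.mem_shape h.mem_shape, potential_swap_lt hA h (by simp only [east]; omega)⟩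
  have hS : IsBBox b F (south p) → (F.swap p (south p)).shape = F.shape ∧
      potential a F < potential a (F.swap p (south p)) := fun h =>
    ⟨F.swap_shape hA.mem_shape h.mem_shape, potential_swap_lt hA h (by simp only [south]; omega)⟩
  have hD : DiagPair a b F p → (primeAt (F.swap (west p) (south p)) p).shape = F.shape ∧
      potential a F < potential a (primeAt (F.swap (west p) (south p)) p) := by
    rintro ⟨-, -, h1, h2⟩
    refine ⟨F.swap_shape h1.mem_shape h2.mem_shape, ?_⟩
    unfold primeAt
    rw [potential_modify _ _ _ Letter.addPrime (fun _ => rfl)]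
    exact potential_swap_lt h1 h2 (by simp [west, south]; omega)
  have hT : DiagSingle b F p →
      (unprimeAt (F.swap p (southeast p)) (east p)).shape = F.shape ∧
      potential a F < potential a (unprimeAt (F.swap p (southeast p)) (east p)) := by
    rintro ⟨-, -, -, h2⟩
    refine ⟨F.swap_shape hA.mem_shape h2.mem_shape, ?_⟩
    unfold unprimeAt
    rw [potential_modify _ _ _ Letter.erasePrime (fun _ => rfl)]
    exact potential_swap_lt hA h2 (by simp [southeast]; omega)
  unfold switchAt
  split_ifs with h1 h2 h3 h4 h5 h6 h7
  · exact hE h1.1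
  · exact hD h3
  · exact hS h1.2
  · exact hT h5
  · exact hE h4
  · exact hD h7
  · exact hS h6
  · tauto

theorem sigma_spec {a b : ℕ} {F : BiFilling} (h : ¬ FullySwitched a b F) :
    (sigma a b F).shape = F.shape ∧ potential a F < potential a (sigma a b F) := by
  have hne : (switchable a b F).Nonempty := Finset.nonempty_iff_ne_empty.mpr h
  unfold sigma switchBox
  by_cases h1 : ((switchable a b F).filter (fun p => ¬ IsPrimed F p)).Nonempty
  · simp only [h1, dif_pos]
    exact switchAt_spec (Finset.mem_of_mem_filter _ (easternmost_mem _ h1))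
  · simp only [h1, hne, dif_pos, dif_neg, not_false_eq_true]
    exact switchAt_spec (southernmost_mem _ hne)

/-- The switching process terminates. -/
theorem exists_fullySwitched (a b : ℕ) (F : BiFilling) :
    ∃ n, FullySwitched a b ((sigma a b)^[n] F) := by
  by_contra! hcon
  have h : ∀ n, ((sigma a b)^[n] F).shape = F.shape ∧ n ≤ potential a ((sigma a b)^[n] F) := by
    intro n
    induction n with
    | zero => exact ⟨rfl, Nat.zero_le _⟩
    | succ n ih =>
      rw [Function.iterate_succ_apply']
      have := sigma_spec (hcon n)
      exact ⟨this.1.trans ih.1, by omega⟩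
  have h1 := h (∑ p ∈ F.shape, (p.1 + p.2) + 1)
  have h2 : potential a ((sigma a b)^[∑ p ∈ F.shape, (p.1 + p.2) + 1] F) ≤
      ∑ p ∈ F.shape, (p.1 + p.2) := by
    unfold potential
    rw [h1.1]
    exact Finset.sum_le_sum fun p _ => by split <;> omega
  omega

/-! ## The shifted tableau switching -/

/-- The switching process of the `a`-boxes of the first tableau with the `b`-boxes of the second
one: `σ` is applied until the filling is fully switched. -/
def switchProcess (a b : ℕ) (F : BiFilling) : BiFilling :=
  (sigma a b)^[Nat.find (exists_fullySwitched a b F)] F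

/-- The switching process is carried out for the letter `a` of the first tableau and successively
for the letters `1, 2, …, n` of the second one. -/
def switchRow (a n : ℕ) (F : BiFilling) : BiFilling :=
  (List.range n).foldl (fun G j => switchProcess a (j + 1) G) F

/-- The whole process: the letters `m, m - 1, …, 1` of the first tableau are successively moved
through the letters `1, 2, …, n` of the second one. -/
def switchAll (m n : ℕ) (F : BiFilling) : BiFilling :=
  (List.range m).reverse.foldl (fun G i => switchRow (i + 1) n G) F

/-- The filling to which `S ∪ T` is transformed. -/
def switched (S T : Filling Letter) : BiFilling :=
  switchAll (maxLetter S) (maxLetter T) (union S T)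

/-- `(S, T) ↦ (ˢT, S_T)`: the first component is what `T` becomes, the second one is what `S`
becomes. -/
def tableauSwitching (P : Filling Letter × Filling Letter) : Filling Letter × Filling Letter :=
  (sndPart (switched P.1 P.2), fstPart (switched P.1 P.2))

end ShiftedSwitching

open ShiftedSwitching

namespace ShiftedSwitching

/-! ## Growth grids of boxes -/

/-! List the boxes of a tableau letter by letter, for each letter the primed entries from north to
south and then the unprimed ones from west to east. This gives a chain of shifted shapes, and within
one letter the row numbers first increase strictly and then decrease weakly. Conversely, the rows
determine every prime except the one at the turning point, which is the last entry of that letter in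
reading order. A tableau is thus a chain of boxes cut into unimodal windows, with one free prime per
letter (`IsListing`, `IsSYT.exists_listing`, `IsListing.isSYT`).

The chains of `S` and `T`, put end to end, span a growth diagram (`Grid`, `exists_grid`) under the
jeu de taquin rule: two consecutive boxes are added in the other order if they are not adjacent, and
otherwise the two chains exchange them. The rule is symmetric, so the transposed grid leads back
from the final sides to the initial ones. Once switching is known to follow the grid
(`isListing_tableauSwitching`), this is the involution.

The invariant behind everything is the set of lengths of hook subwords, strictly increasing and then
weakly decreasing, of the row word of an interval of the chain: it is the same at all levels of the
grid (`Grid.hook_rows`). A window is unimodal exactly if it is itself a hook, so windows stay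
unimodal and the results are tableaux. The lattice property for `i` and `i + 1` says that no hook in
the rows of these letters is longer than the number of letters `i` (`rowLattice_iff_hook`,
`isLatticeWord_iff_rowLattice`), and the condition on rightmost letters says that the free primes
are absent. Weights and free primes do not change either, so the LRS property is preserved
(`isLRS_iff`, `IsLRS.of_listing`).

That switching follows the grid is shown for one letter `a` and one letter `b` at a time. The
intermediate fillings correspond to monotone paths in a rectangle of the grid. An ordinary switch
flips one cell at a corner of the path. Primes depend on the ascents of the rows, and an ascent can
only appear at the main diagonal (`Grid.rowC_lt_succ`, `Grid.diagA_of_rowC`); there two cells are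
flipped at once, which are the diagonal switches. The prescribed choice of the box is always the
last letter `a` that has not passed all `b` (`Strips.Active.switchBox_eq`), which yields
`Strips.St.switchProcess`. -/

/-- `K` is a lower set of the poset of the boxes `(i, j)` with `i ≤ j`. -/
def IsLower (K : Set (ℕ × ℕ)) : Prop :=
  ∀ p ∈ K, p.1 ≤ p.2 ∧ ∀ q : ℕ × ℕ, q.1 ≤ q.2 → q.1 ≤ p.1 → q.2 ≤ p.2 → q ∈ K

/-- The box `p` can be added to the lower set `K`. -/
def Addable (K : Set (ℕ × ℕ)) (p : ℕ × ℕ) : Prop :=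
  p ∉ K ∧ p.1 ≤ p.2 ∧ ∀ q : ℕ × ℕ, q.1 ≤ q.2 → q.1 ≤ p.1 → q.2 ≤ p.2 → q ≠ p → q ∈ K

/-- `q` is the neighbor of `p` to the east or to the south. -/
def Adj (p q : ℕ × ℕ) : Prop := q = east p ∨ q = south p

theorem Adj.le {p q : ℕ × ℕ} (h : Adj p q) : p.1 ≤ q.1 ∧ p.2 ≤ q.2 := by
  rcases h with rfl | rfl <;> simp [east, south]

theorem Adj.add {p q : ℕ × ℕ} (h : Adj p q) : q.1 + q.2 = p.1 + p.2 + 1 := by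
  rcases h with rfl | rfl <;> simp [east, south] <;> omega

theorem IsLower.insert {K : Set (ℕ × ℕ)} {p : ℕ × ℕ} (hK : IsLower K) (hp : Addable K p) :
    IsLower (insert p K) := by
  rintro q (rfl | hq)
  · refine ⟨hp.2.1, fun r h1 h2 h3 => ?_⟩
    by_cases hr : r = q
    · exact Or.inl hr
    · exact Or.inr (hp.2.2 r h1 h2 h3 hr)
  · exact ⟨(hK q hq).1, fun r h1 h2 h3 => Or.inr ((hK q hq).2 r h1 h2 h3)⟩

/-- A box outside a lower set is not weakly northwest of a box inside. -/
theorem IsLower.lt {K : Set (ℕ × ℕ)} (hK : IsLower K) {p q : ℕ × ℕ} (hp : p ∈ K) (hq : q ∉ K)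
    (h : q.1 ≤ q.2) : p.1 < q.1 ∨ p.2 < q.2 := by
  by_contra hcon
  exact hq ((hK p hp).2 q h (by omega) (by omega))

/-- The position of two boxes which are added one after the other. -/
theorem Addable.cases {K : Set (ℕ × ℕ)} {p q : ℕ × ℕ} (hK : IsLower K) (hp : Addable K p)
    (hq : Addable (insert p K) q) :
    (q.1 ≤ p.1 ∧ p.2 < q.2) ∨ (p.1 < q.1 ∧ q.2 ≤ p.2) ∧ q.1 ≤ q.2 := by
  have h1 := (hK.insert hp).lt (Set.mem_insert p K) hq.1 hq.2.1
  by_contra hcon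
  have h2 : p.1 < q.1 ∧ p.2 < q.2 := by have := hq.2.1; omega
  -- If `q` were strictly southeast of `p`, the corner `(p.1, q.2)` would be present already, and
  -- then so would `p`.
  have h3 := hq.2.2 (p.1, q.2) (by have := hq.2.1; simp; omega) (by simp; omega) (by simp)
    (by intro h; rw [← h] at h2; simp at h2)
  rcases h3 with h3 | h3
  · have := congrArg Prod.snd h3
    simp only at this
    omega
  · exact hp.1 ((hK _ h3).2 p hp.2.1 (by simp) (by simp; omega))

theorem Addable.same_row {K : Set (ℕ × ℕ)} {p q : ℕ × ℕ} (hp : Addable K p) (hq : Addable K q)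
    (h : p.1 = q.1) : p = q := by
  by_contra hne
  rcases le_total p.2 q.2 with h1 | h1
  · exact hp.1 (hq.2.2 p hp.2.1 h.le h1 hne)
  · exact hq.1 (hp.2.2 q hq.2.1 h.ge h1 (Ne.symm hne))

theorem Addable.next_in_row {K : Set (ℕ × ℕ)} {p q : ℕ × ℕ} (hK : IsLower K) (hp : Addable K p)
    (hq : Addable (Insert.insert p K) q) (h : p.1 = q.1) : q.2 = p.2 + 1 := by
  have h1 : p.2 < q.2 := by have := hp.cases hK hq; omega
  by_contra hne
  have h3 := hq.2.2 (p.1, p.2 + 1) (by have := hp.2.1; simp; omega) (by simp; omega)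
    (by simp; omega) (by intro h'; rw [← h'] at hne; simp at hne)
  rcases h3 with h3 | h3
  · have := congrArg Prod.snd h3
    simp at this
  · exact hp.1 ((hK _ h3).2 p hp.2.1 (by simp) (by simp))

/-- Two boxes that are not adjacent can be added in either order. -/
theorem Addable.comm {K : Set (ℕ × ℕ)} {p q : ℕ × ℕ} (hK : IsLower K) (hp : Addable K p)
    (hq : Addable (Insert.insert p K) q) (hpq : ¬ Adj p q) :
    Addable K q ∧ Addable (Insert.insert q K) p := by
  have hne : q ≠ p := fun h => hq.1 (Or.inl h)
  have hqK : q ∉ K := fun h => hq.1 (Or.inr h)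
  -- A box weakly southeast of `p` that can be added right after `p` is adjacent to `p`.
  have key : ¬ (p.1 ≤ q.1 ∧ p.2 ≤ q.2) := by
    rintro ⟨h1, h2⟩
    rcases hp.cases hK hq with h | ⟨h, h'⟩
    · have := hp.next_in_row hK hq (by omega)
      exact hpq (Or.inl (Prod.ext (by simp [east]; omega) (by simp [east]; omega)))
    · have h4 : q.2 = p.2 := by omega
      by_cases h5 : q.1 = p.1 + 1
      · exact hpq (Or.inr (Prod.ext (by simp [south]; omega) (by simp [south]; omega)))
      · have h3 := hq.2.2 (p.1 + 1, p.2) (by simp; omega) (by simp; omega)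
          (by simp; omega) (by intro h'; rw [← h'] at h5; simp at h5)
        rcases h3 with h3 | h3
        · have := congrArg Prod.fst h3
          simp at this
        · exact hp.1 ((hK _ h3).2 p hp.2.1 (by simp) (by simp))
  refine ⟨⟨hqK, hq.2.1, fun r h1 h2 h3 h4 => ?_⟩, ?_, hp.2.1, fun r h1 h2 h3 h4 =>
    Or.inr (hp.2.2 r h1 h2 h3 h4)⟩
  · rcases hq.2.2 r h1 h2 h3 h4 with rfl | h
    · exact absurd ⟨h2, h3⟩ key
    · exact h
  · rintro (h | h)
    · exact hne h.symm
    · exact hp.1 h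

/-- The growth diagram of two chains of boxes `a₀, a₁, …` and `b₀, b₁, …`: the box `c i j` is the
position of `aᵢ` after it has passed `b₀, …, bⱼ₋₁`, and the box `d i j` is the position of `bⱼ`
after it has passed `aᵢ, aᵢ₊₁, …`. -/
structure Grid (m n : ℕ) where
  K : ℕ → ℕ → Set (ℕ × ℕ)
  c : ℕ → ℕ → ℕ × ℕ
  d : ℕ → ℕ → ℕ × ℕ
  lower : ∀ i j, i ≤ m → j ≤ n → IsLower (K i j)
  addc : ∀ i j, i < m → j ≤ n → Addable (K i j) (c i j)
  stepc : ∀ i j, i < m → j ≤ n → K (i + 1) j = insert (c i j) (K i j)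
  addd : ∀ i j, i ≤ m → j < n → Addable (K i j) (d i j)
  stepd : ∀ i j, i ≤ m → j < n → K i (j + 1) = insert (d i j) (K i j)
  cell : ∀ i j, i < m → j < n →
    (Adj (c i j) (d (i + 1) j) ∧ d i j = c i j ∧ c i (j + 1) = d (i + 1) j) ∨
    (¬ Adj (c i j) (d (i + 1) j) ∧ d i j = d (i + 1) j ∧ c i (j + 1) = c i j)

/-- The set `K` with the boxes `a 0, …, a (i - 1)` added. -/
def grow (K : Set (ℕ × ℕ)) (a : ℕ → ℕ × ℕ) (i : ℕ) : Set (ℕ × ℕ) :=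
  K ∪ {p | ∃ k < i, p = a k}

@[simp] theorem grow_zero (K : Set (ℕ × ℕ)) (a : ℕ → ℕ × ℕ) : grow K a 0 = K := by
  simp [grow]

theorem grow_congr (K : Set (ℕ × ℕ)) {a b : ℕ → ℕ × ℕ} {i : ℕ} (h : ∀ k < i, a k = b k) :
    grow K a i = grow K b i := by
  unfold grow
  congr 1
  ext p
  exact exists_congr fun k => and_congr_right fun hk => by rw [h k hk]

theorem grow_succ (K : Set (ℕ × ℕ)) (a : ℕ → ℕ × ℕ) (i : ℕ) :
    grow K a (i + 1) = insert (a i) (grow K a i) := by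
  ext p
  simp only [grow, Set.mem_union, Set.mem_ofPred_eq, Set.mem_insert_iff, Nat.lt_succ_iff_lt_or_eq]
  constructor
  · rintro (h | ⟨k, h | rfl, rfl⟩)
    · exact Or.inr (Or.inl h)
    · exact Or.inr (Or.inr ⟨k, h, rfl⟩)
    · exact Or.inl rfl
  · rintro (rfl | h | ⟨k, h, rfl⟩)
    · exact Or.inr ⟨i, Or.inr rfl, rfl⟩
    · exact Or.inl h
    · exact Or.inr ⟨k, Or.inl h, rfl⟩

theorem grow_insert (K : Set (ℕ × ℕ)) (a : ℕ → ℕ × ℕ) (i : ℕ) :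
    grow (insert (a 0) K) (fun k => a (k + 1)) i = grow K a (i + 1) := by
  induction i with
  | zero => rw [grow_zero, grow_succ, grow_zero]
  | succ i ih => rw [grow_succ, ih, grow_succ K a (i + 1)]

/-- The boxes `a 0, …, a (m - 1)` can be added successively to `K`. -/
def BoxChain (K : Set (ℕ × ℕ)) (a : ℕ → ℕ × ℕ) (m : ℕ) : Prop :=
  ∀ i < m, Addable (grow K a i) (a i)

theorem BoxChain.lower {K : Set (ℕ × ℕ)} {a : ℕ → ℕ × ℕ} {m : ℕ} (hK : IsLower K)
    (h : BoxChain K a m) : ∀ i ≤ m, IsLower (grow K a i) := by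
  intro i
  induction i with
  | zero => intro _; rwa [grow_zero]
  | succ i ih =>
    intro hi
    rw [grow_succ]
    exact (ih (by omega)).insert (h i (by omega))

/-! ### Sliding a box through a chain, and existence of growth grids -/

open Classical in
/-- The position of a box `x` after it has passed `e 0, …, e (j - 1)`. -/
noncomputable def slidePos (x : ℕ × ℕ) (e : ℕ → ℕ × ℕ) : ℕ → ℕ × ℕ
  | 0 => x
  | j + 1 => if Adj (slidePos x e j) (e j) then e j else slidePos x e j

open Classical in
/-- The position of the box `e j` after it has been passed by `x`. -/
noncomputable def slideImage (x : ℕ × ℕ) (e : ℕ → ℕ × ℕ) (j : ℕ) : ℕ × ℕ :=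
  if Adj (slidePos x e j) (e j) then slidePos x e j else e j

/-- At each stage, the boxes left behind together with the current position of `x` form the same
lower set as `x` followed by the boxes passed. In the adjacent case `x` vacates its position and
takes the new box; otherwise `Addable.comm` lets the new box be added before `x`. -/
theorem slide_spec {K : Set (ℕ × ℕ)} {x : ℕ × ℕ} {e : ℕ → ℕ × ℕ} {n : ℕ} (hK : IsLower K)
    (hx : Addable K x) (he : BoxChain (insert x K) e n) : ∀ j ≤ n,
    IsLower (grow K (slideImage x e) j) ∧ Addable (grow K (slideImage x e) j) (slidePos x e j) ∧
    grow (insert x K) e j = insert (slidePos x e j) (grow K (slideImage x e) j) ∧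
    (j < n → Addable (grow K (slideImage x e) j) (slideImage x e j)) := by
  have main : ∀ j ≤ n, IsLower (grow K (slideImage x e) j) ∧
      Addable (grow K (slideImage x e) j) (slidePos x e j) ∧
      grow (insert x K) e j = insert (slidePos x e j) (grow K (slideImage x e) j) := by
    intro j
    induction j with
    | zero => intro _; refine ⟨?_, ?_, ?_⟩ <;> simp only [grow_zero, slidePos] <;> assumption
    | succ j ih =>
      intro hj
      obtain ⟨h1, h2, h3⟩ := ih (by omega)
      have h4 := he j (by omega)
      rw [h3] at h4
      rw [grow_succ, grow_succ, h3]
      by_cases hadj : Adj (slidePos x e j) (e j)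
      · simp only [slidePos, slideImage, if_pos hadj]
        exact ⟨h1.insert h2, h4, trivial⟩
      · simp only [slidePos, slideImage, if_neg hadj]
        have := h2.comm h1 h4 hadj
        exact ⟨h1.insert this.1, this.2, Set.insert_comm _ _ _⟩
  intro j hj
  obtain ⟨h1, h2, h3⟩ := main j hj
  refine ⟨h1, h2, h3, fun hjn => ?_⟩
  have h4 := he j hjn
  rw [h3] at h4
  by_cases hadj : Adj (slidePos x e j) (e j)
  · simp only [slideImage, if_pos hadj]
    exact h2
  · simp only [slideImage, if_neg hadj]
    exact (h2.comm h1 h4 hadj).1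

/-- Induction on the first chain: the grid of `a 1, a 2, …` over `insert (a 0) K` comes first, and
its side `G.d 0` is the chain through which `a 0` slides to give the additional line `i = 0`. -/
theorem exists_grid (m n : ℕ) : ∀ (K : Set (ℕ × ℕ)) (a b : ℕ → ℕ × ℕ), IsLower K →
    BoxChain K a m → BoxChain (grow K a m) b n →
    ∃ G : Grid m n, G.K 0 0 = K ∧ (∀ i < m, G.c i 0 = a i) ∧ ∀ j < n, G.d m j = b j := by
  induction m with
  | zero =>
    intro K a b hK _ hb
    rw [grow_zero] at hb
    exact ⟨⟨fun _ j => grow K b j, fun _ _ => (0, 0), fun _ j => b j,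
      fun i j _ hj => hb.lower hK j hj, fun i j hi => absurd hi (by omega),
      fun i j hi => absurd hi (by omega), fun i j _ hj => hb j hj,
      fun i j _ _ => grow_succ _ _ _, fun i j hi => absurd hi (by omega)⟩,
      grow_zero _ _, fun i hi => absurd hi (by omega), fun _ _ => rfl⟩
  | succ m ih =>
    intro K a b hK ha hb
    have ha0 : Addable K (a 0) := by simpa using ha 0 (by omega)
    obtain ⟨G, hG1, hG2, hG3⟩ := ih (insert (a 0) K) (fun k => a (k + 1)) b (hK.insert ha0)
      (fun i hi => by rw [grow_insert]; exact ha (i + 1) (by omega))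
      (by rw [grow_insert]; exact hb)
    have hgrow : ∀ j ≤ n, G.K 0 j = grow (insert (a 0) K) (G.d 0) j := by
      intro j
      induction j with
      | zero => intro _; rw [hG1, grow_zero]
      | succ j ihj =>
        intro hj
        rw [G.stepd 0 j (by omega) (by omega), grow_succ, ihj (by omega)]
    have hs := slide_spec hK ha0 (e := G.d 0) (n := n)
      (fun j hj => by rw [← hgrow j hj.le]; exact G.addd 0 j (by omega) hj)
    refine ⟨⟨fun i j => i.casesOn (grow K (slideImage (a 0) (G.d 0)) j) (fun i => G.K i j),
      fun i j => i.casesOn (slidePos (a 0) (G.d 0) j) (fun i => G.c i j),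
      fun i j => i.casesOn (slideImage (a 0) (G.d 0) j) (fun i => G.d i j), ?_, ?_, ?_, ?_, ?_,
      ?_⟩, grow_zero _ _, ?_, fun j hj => hG3 j hj⟩
    · rintro (_ | i) j hi hj
      · exact (hs j hj).1
      · exact G.lower i j (by omega) hj
    · rintro (_ | i) j hi hj
      · exact (hs j hj).2.1
      · exact G.addc i j (by omega) hj
    · rintro (_ | i) j hi hj
      · exact (hgrow j hj).trans (hs j hj).2.2.1
      · exact G.stepc i j (by omega) hj
    · rintro (_ | i) j hi hj
      · exact (hs j hj.le).2.2.2 hj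
      · exact G.addd i j (by omega) hj
    · rintro (_ | i) j hi hj
      · exact grow_succ _ _ _
      · exact G.stepd i j (by omega) hj
    · rintro (_ | i) j hi hj
      · by_cases hadj : Adj (slidePos (a 0) (G.d 0) j) (G.d 0 j)
        · refine Or.inl ⟨hadj, ?_, ?_⟩
          · simp [slideImage, hadj]
          · simp [slidePos, hadj]
        · refine Or.inr ⟨hadj, ?_, ?_⟩
          · simp [slideImage, hadj]
          · simp [slidePos, hadj]
      · exact G.cell i j (by omega) hj
    · rintro (_ | i) hi
      · rfl
      · exact hG2 i (by omega)

/-! ### Monotonicity and symmetry of growth grids -/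

namespace Grid

variable {m n : ℕ} (G : Grid m n)

/-- The subgrid of size `m' × n'` which starts at `(i₀, j₀)`. -/
def sub (i₀ j₀ m' n' : ℕ) (hi : i₀ + m' ≤ m) (hj : j₀ + n' ≤ n) : Grid m' n' where
  K i j := G.K (i₀ + i) (j₀ + j)
  c i j := G.c (i₀ + i) (j₀ + j)
  d i j := G.d (i₀ + i) (j₀ + j)
  lower i j h1 h2 := G.lower _ _ (by omega) (by omega)
  addc i j h1 h2 := G.addc _ _ (by omega) (by omega)
  stepc i j h1 h2 := G.stepc (i₀ + i) _ (by omega) (by omega)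
  addd i j h1 h2 := G.addd _ _ (by omega) (by omega)
  stepd i j h1 h2 := G.stepd _ (j₀ + j) (by omega) (by omega)
  cell i j h1 h2 := G.cell (i₀ + i) (j₀ + j) (by omega) (by omega)

theorem K_mono {i i' j j' : ℕ} (hi : i ≤ i') (hi' : i' ≤ m) (hj : j ≤ j') (hj' : j' ≤ n) :
    G.K i j ⊆ G.K i' j' := by
  have h1 : ∀ k, i + k ≤ m → G.K i j ⊆ G.K (i + k) j := by
    intro k
    induction k with
    | zero => intro _; rfl
    | succ k ih =>
      intro hk
      rw [← Nat.add_assoc, G.stepc (i + k) j (by omega) (by omega)]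
      exact (ih (by omega)).trans (Set.subset_insert _ _)
  have h2 : ∀ k, j + k ≤ n → G.K i' j ⊆ G.K i' (j + k) := by
    intro k
    induction k with
    | zero => intro _; rfl
    | succ k ih =>
      intro hk
      rw [← Nat.add_assoc, G.stepd i' (j + k) (by omega) (by omega)]
      exact (ih (by omega)).trans (Set.subset_insert _ _)
  have h3 := h1 (i' - i) (by omega)
  have h4 := h2 (j' - j) (by omega)
  rw [show i + (i' - i) = i' by omega] at h3
  rw [show j + (j' - j) = j' by omega] at h4
  exact h3.trans h4

theorem c_mem {i i' j j' : ℕ} (hi : i < i') (hi' : i' ≤ m) (hj : j ≤ j') (hj' : j' ≤ n) :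
    G.c i j ∈ G.K i' j' := by
  refine G.K_mono (i := i + 1) hi hi' hj hj' ?_
  rw [G.stepc i j (by omega) (by omega)]
  exact Set.mem_insert _ _

theorem d_mem {i i' j j' : ℕ} (hi : i ≤ i') (hi' : i' ≤ m) (hj : j < j') (hj' : j' ≤ n) :
    G.d i j ∈ G.K i' j' := by
  refine G.K_mono (j := j + 1) hi hi' hj hj' ?_
  rw [G.stepd i j (by omega) (by omega)]
  exact Set.mem_insert _ _

theorem c_notMem {i i' j j' : ℕ} (hi : i < m) (hi' : i' ≤ i) (hj : j ≤ n) (hj' : j' ≤ j) :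
    G.c i j ∉ G.K i' j' := fun h =>
  (G.addc i j hi hj).1 (G.K_mono hi' hi.le hj' hj h)

theorem d_notMem {i i' j j' : ℕ} (hi : i ≤ m) (hi' : i' ≤ i) (hj : j < n) (hj' : j' ≤ j) :
    G.d i j ∉ G.K i' j' := fun h =>
  (G.addd i j hi hj).1 (G.K_mono hi' hi hj' hj.le h)

theorem c_diag {i j : ℕ} (hi : i < m) (hj : j ≤ n) : (G.c i j).1 ≤ (G.c i j).2 :=
  (G.addc i j hi hj).2.1

theorem d_diag {i j : ℕ} (hi : i ≤ m) (hj : j < n) : (G.d i j).1 ≤ (G.d i j).2 :=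
  (G.addd i j hi hj).2.1

/-- Interchange the two chains, with the switched positions as initial positions. -/
def transpose : Grid n m where
  K j i := G.K i j
  c j i := G.d i j
  d j i := G.c i j
  lower i j h1 h2 := G.lower _ _ h2 h1
  addc i j h1 h2 := G.addd _ _ h2 h1
  stepc i j h1 h2 := G.stepd _ _ h2 h1
  addd i j h1 h2 := G.addc _ _ h2 h1
  stepd i j h1 h2 := G.stepc _ _ h2 h1
  cell j i hj hi := by
    rcases G.cell i j hi hj with ⟨h1, h2, h3⟩ | ⟨h1, h2, h3⟩
    · exact Or.inl ⟨by rw [h2, h3]; exact h1, h2.symm, h3.symm⟩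
    · refine Or.inr ⟨?_, h3.symm, h2.symm⟩
      intro hadj
      have h4 := (G.lower (i + 1) j hi hj.le).lt (G.c_mem (Nat.lt_succ_self i) hi le_rfl hj.le)
        (G.d_notMem (i := i + 1) hi le_rfl hj le_rfl) (G.d_diag hi hj)
      have h5 := hadj.le
      rw [h2, h3] at h5
      omega

theorem c_le_succ {i j : ℕ} (hi : i < m) (hj : j < n) :
    (G.c i j).1 ≤ (G.c i (j + 1)).1 ∧ (G.c i j).2 ≤ (G.c i (j + 1)).2 := by
  rcases G.cell i j hi hj with ⟨h1, -, h3⟩ | ⟨-, -, h3⟩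
  · rw [h3]; exact h1.le
  · rw [h3]; exact ⟨le_rfl, le_rfl⟩

theorem c_le {i j j' : ℕ} (hi : i < m) (hj : j ≤ j') (hj' : j' ≤ n) :
    (G.c i j).1 ≤ (G.c i j').1 ∧ (G.c i j).2 ≤ (G.c i j').2 := by
  induction j', hj using Nat.le_induction with
  | base => exact ⟨le_rfl, le_rfl⟩
  | succ k hk ih =>
    have h1 := ih (by omega)
    have h2 := G.c_le_succ hi (j := k) (by omega)
    omega

/-- The first box belongs to a lower set to which the second is still to be added, even if the
second is taken at a later level. -/
theorem c_lt {i i' j j' : ℕ} (hi : i < i') (hi' : i' < m) (hj : j ≤ j') (hj' : j' ≤ n) :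
    (G.c i j).1 < (G.c i' j').1 ∨ (G.c i j).2 < (G.c i' j').2 :=
  (G.lower i' j' hi'.le hj').lt (G.c_mem hi hi'.le hj hj') (G.c_notMem hi' le_rfl hj' le_rfl)
    (G.c_diag hi' hj')

theorem c_cases {i j : ℕ} (hi : i + 1 < m) (hj : j ≤ n) :
    ((G.c (i + 1) j).1 ≤ (G.c i j).1 ∧ (G.c i j).2 < (G.c (i + 1) j).2) ∨
    ((G.c i j).1 < (G.c (i + 1) j).1 ∧ (G.c (i + 1) j).2 ≤ (G.c i j).2) := by
  have h1 := G.addc (i + 1) j hi hj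
  rw [G.stepc i j (by omega) hj] at h1
  have := (G.addc i j (by omega) hj).cases (G.lower i j (by omega) hj) h1
  omega

theorem K_eq_grow_c {i j : ℕ} (hi : i ≤ m) (hj : j ≤ n) :
    G.K i j = grow (G.K 0 j) (fun i => G.c i j) i := by
  induction i with
  | zero => simp
  | succ i ih => rw [G.stepc i j (by omega) hj, ih (by omega), grow_succ]

theorem K_eq_grow_d {i j : ℕ} (hi : i ≤ m) (hj : j ≤ n) :
    G.K i j = grow (G.K i 0) (fun j => G.d i j) j :=
  G.transpose.K_eq_grow_c (i := j) (j := i) hj hi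

end Grid

/-! ## Hook subwords -/

/-- The word `x` has a subword of length at least `N` which is first strictly increasing and then
weakly decreasing. -/
def Hook (x : List ℕ) (N : ℕ) : Prop :=
  ∃ x₁ x₂ u v : List ℕ, x = x₁ ++ x₂ ∧ u.Sublist x₁ ∧ v.Sublist x₂ ∧ u.Pairwise (· < ·) ∧
    v.Pairwise (· ≥ ·) ∧ N ≤ u.length + v.length

theorem exists_replicate_append (t : ℕ) : ∀ v : List ℕ, v.Pairwise (· ≥ ·) → (∀ x ∈ v, x ≤ t) →
    ∃ k w, v = List.replicate k t ++ w ∧ ∀ x ∈ w, x < t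
  | [], _, _ => ⟨0, [], by simp, by simp⟩
  | y :: v, h1, h2 => by
    by_cases hy : y = t
    · subst hy
      obtain ⟨k, w, rfl, hw⟩ := exists_replicate_append y v h1.of_cons
        (fun x hx => h2 x (List.mem_cons_of_mem _ hx))
      exact ⟨k + 1, w, by simp [List.replicate_succ], hw⟩
    · refine ⟨0, y :: v, by simp, fun x hx => ?_⟩
      have h3 := h2 y List.mem_cons_self
      rcases List.mem_cons.mp hx with rfl | hx
      · omega
      · have := List.rel_of_pairwise_cons h1 hx
        omega

theorem exists_append_replicate (t : ℕ) : ∀ v : List ℕ, v.Pairwise (· ≥ ·) → (∀ x ∈ v, t ≤ x) →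
    ∃ k w, v = w ++ List.replicate k t ∧ ∀ x ∈ w, t < x
  | [], _, _ => ⟨0, [], by simp, by simp⟩
  | y :: v, h1, h2 => by
    by_cases hy : y = t
    · refine ⟨v.length + 1, [], ?_, by simp⟩
      rw [List.nil_append, List.eq_replicate_iff]
      refine ⟨by simp, fun x hx => ?_⟩
      have h3 := h2 x hx
      rcases List.mem_cons.mp hx with rfl | hx
      · exact hy
      · have := List.rel_of_pairwise_cons h1 hx
        omega
    · obtain ⟨k, w, rfl, hw⟩ := exists_append_replicate t v h1.of_cons
        (fun x hx => h2 x (List.mem_cons_of_mem _ hx))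
      refine ⟨k, y :: w, by simp, fun x hx => ?_⟩
      rcases List.mem_cons.mp hx with rfl | hx
      · have := h2 x List.mem_cons_self
        omega
      · exact hw x hx

/-- The letters `R + 1` of `v` come first and lie in a prefix of `Q`; this prefix contains at least
as many letters `R`, which replace them. -/
theorem exists_lower_sublist {R : ℕ} {Q v : List ℕ}
    (hQ : ∀ Q₁ Q₂, Q = Q₁ ++ Q₂ → Q₁.count (R + 1) ≤ Q₁.count R)
    (hv : v.Sublist Q) (hdec : v.Pairwise (· ≥ ·)) (hle : ∀ x ∈ v, x ≤ R + 1) :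
    ∃ w : List ℕ, w.Sublist Q ∧ w.Pairwise (· ≥ ·) ∧ (∀ x ∈ w, x ≤ R) ∧ v.length ≤ w.length := by
  obtain ⟨k, w, rfl, hw⟩ := exists_replicate_append (R + 1) v hdec hle
  obtain ⟨r₁, r₂, rfl, h1, h2⟩ := List.append_sublist_iff.mp hv
  have h3 := List.replicate_sublist_iff.mp h1
  have h4 := hQ r₁ r₂ rfl
  refine ⟨List.replicate k R ++ w,
    (List.replicate_sublist_iff.mpr (h3.trans h4)).append h2, ?_, ?_, by simp⟩
  · rw [List.pairwise_append] at hdec ⊢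
    refine ⟨List.pairwise_replicate.mpr (Or.inr le_rfl), hdec.2.1, fun a ha b hb => ?_⟩
    have := hw b hb
    rw [List.eq_of_mem_replicate ha]
    omega
  · intro x hx
    rcases List.mem_append.mp hx with hx | hx
    · exact (List.eq_of_mem_replicate hx).le
    · have := hw x hx
      omega

/-- If the letter to be lowered is in the decreasing part, all that follows it there is at most `R +
1` and can be lowered along with it. -/
theorem hook_lower_of_dec {P₁ P₂ Q u v₁ v₂ : List ℕ} {R N : ℕ}
    (hQ : ∀ Q₁ Q₂, Q = Q₁ ++ Q₂ → Q₁.count (R + 1) ≤ Q₁.count R)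
    (hu : u.Sublist P₁) (hu' : u.Pairwise (· < ·)) (hv₁ : v₁.Sublist P₂) (hv₂ : v₂.Sublist Q)
    (hv : (v₁ ++ (R + 1) :: v₂).Pairwise (· ≥ ·))
    (hN : N ≤ u.length + (v₁ ++ (R + 1) :: v₂).length) :
    Hook (P₁ ++ P₂ ++ R :: Q) N := by
  rw [List.pairwise_append, List.pairwise_cons] at hv
  obtain ⟨h1, ⟨h2, h3⟩, h4⟩ := hv
  obtain ⟨w, hw1, hw2, hw3, hw4⟩ := exists_lower_sublist hQ hv₂ h3 (fun x hx => h2 x hx)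
  refine ⟨P₁, P₂ ++ R :: Q, u, v₁ ++ R :: w, by simp, hu, hv₁.append (hw1.cons_cons R), hu', ?_, ?_⟩
  · rw [List.pairwise_append, List.pairwise_cons]
    refine ⟨h1, ⟨fun x hx => hw3 x hx, hw2⟩, fun a ha b hb => ?_⟩
    have h5 := h4 a ha (R + 1) List.mem_cons_self
    rcases List.mem_cons.mp hb with rfl | hb
    · omega
    · have := hw3 b hb
      omega
  · simp only [List.length_append, List.length_cons] at hN ⊢
    omega

theorem append_cons_eq_append {α : Type*} {P Q x₁ x₂ : List α} {a : α}
    (h : P ++ a :: Q = x₁ ++ x₂) :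
    (∃ P₂, P = x₁ ++ P₂ ∧ x₂ = P₂ ++ a :: Q) ∨ ∃ Q₁, x₁ = P ++ a :: Q₁ ∧ Q = Q₁ ++ x₂ := by
  rcases List.append_eq_append_iff.mp h with ⟨as, h1, h2⟩ | ⟨bs, h1, h2⟩
  · rcases List.cons_eq_append_iff.mp h2 with ⟨h3, h4⟩ | ⟨cs, h3, h4⟩
    · refine Or.inl ⟨[], by rw [h1, h3]; simp, by rw [h4]; simp⟩
    · exact Or.inr ⟨cs, by rw [h1, h3], h4⟩
  · exact Or.inl ⟨bs, h1, h2⟩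

/-- A hook that uses the lowered letter has to be repaired. In its decreasing part this is
`hook_lower_of_dec`. In its increasing part `R` can replace `R + 1` unless `R` is used before; then
`hz` is there to provide another `R + 1`. -/
theorem hook_lower {P Q : List ℕ} {R N : ℕ}
    (hQ : ∀ Q₁ Q₂, Q = Q₁ ++ Q₂ → Q₁.count (R + 1) ≤ Q₁.count R)
    (hz : ∀ P₃ P₄, P = P₃ ++ R :: P₄ → R + 1 ∉ P₄ →
      ∀ Q₁ z Q₂, Q = Q₁ ++ z :: Q₂ → R + 1 < z → R + 1 ∈ Q₁)
    (h : Hook (P ++ (R + 1) :: Q) N) : Hook (P ++ R :: Q) N := by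
  obtain ⟨x₁, x₂, u, v, hx, hu, hv, hu', hv', hN⟩ := h
  rcases append_cons_eq_append hx with ⟨P₂, rfl, rfl⟩ | ⟨Q₁, rfl, rfl⟩
  · obtain ⟨v₁, v', rfl, hv₁, hv0⟩ := List.sublist_append_iff.mp hv
    rcases List.sublist_cons_iff.mp hv0 with hv₂ | ⟨v₂, rfl, hv₂⟩
    · exact ⟨x₁, P₂ ++ R :: Q, u, v₁ ++ v', by simp, hu, hv₁.append (hv₂.cons R), hu', hv', hN⟩
    · exact hook_lower_of_dec hQ hu hu' hv₁ hv₂ hv' hN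
  · obtain ⟨u₁, u', rfl, hu₁, hu0⟩ := List.sublist_append_iff.mp hu
    rcases List.sublist_cons_iff.mp hu0 with hu₂ | ⟨u₂, rfl, hu₂⟩
    · exact ⟨P ++ R :: Q₁, x₂, u₁ ++ u', v, by simp, hu₁.append (hu₂.cons R), hv, hu', hv', hN⟩
    · have hinc := hu'
      rw [List.pairwise_append, List.pairwise_cons] at hinc
      obtain ⟨h1, ⟨h2, h3⟩, h4⟩ := hinc
      by_cases hR : R ∈ u₁
      · obtain ⟨u₀, u₀', rfl⟩ := List.append_of_mem hR
        have h5 : u₀' = [] := by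
          cases u₀' with
          | nil => rfl
          | cons y _ =>
            rw [List.pairwise_append, List.pairwise_cons] at h1
            have h6 := h1.2.1.1 y List.mem_cons_self
            have h7 := h4 y (by simp) (R + 1) List.mem_cons_self
            omega
        subst h5
        obtain ⟨P₃, P₄, rfl, h5, h6⟩ := List.append_sublist_iff.mp hu₁
        obtain ⟨s, t, rfl⟩ := List.append_of_mem (h6.subset List.mem_cons_self)
        -- The substitute `R + 1` is looked for after the used `R` inside `P`; if there is none,
        -- `hz` yields one in `Q` before any larger letter.
        by_cases hmem : R + 1 ∈ t
        · refine ⟨(P₃ ++ (s ++ R :: t)) ++ R :: Q₁, x₂, (u₀ ++ [R]) ++ (R + 1) :: u₂, v, by simp,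
            ?_, hv, hu', hv', hN⟩
          have h8 : (u₀ ++ ([R] ++ ([R + 1] ++ u₂))).Sublist (P₃ ++ (s ++ ([R] ++ (t ++ R :: Q₁)))) :=
            h5.append (((List.Sublist.refl [R]).append ((List.singleton_sublist.mpr hmem).append
              (hu₂.cons R))).trans (List.sublist_append_right _ _))
          simpa using h8
        · have hz' := hz (P₃ ++ s) t (by simp) hmem
          cases u₂ with
          | cons z u₃ =>
            obtain ⟨r₁, r₂, rfl, hz1, hz2⟩ := List.cons_sublist_iff.mp hu₂
            obtain ⟨s', t', rfl⟩ := List.append_of_mem hz1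
            have h7 := hz' s' z (t' ++ r₂ ++ x₂) (by simp) (h2 z List.mem_cons_self)
            refine ⟨(P₃ ++ (s ++ R :: t)) ++ R :: (s' ++ z :: t' ++ r₂), x₂,
              (u₀ ++ [R]) ++ (R + 1) :: z :: u₃, v, by simp, ?_, hv, hu', hv', hN⟩
            refine hu₁.append (List.Sublist.cons _ ?_)
            have h8 : ([R + 1] ++ ([z] ++ u₃)).Sublist (s' ++ (z :: t' ++ r₂)) :=
              (List.singleton_sublist.mpr h7).append
                ((List.singleton_sublist.mpr List.mem_cons_self).append hz2)
            simpa using h8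
          | nil =>
            -- The increasing part ends with the lowered letter. If `v` starts with a larger `z`, a
            -- letter `R + 1` before `z` extends the increasing part; otherwise the letter can be
            -- counted as the first of the decreasing part.
            by_cases hhead : ∃ z v₃, v = z :: v₃ ∧ R + 1 < z
            · obtain ⟨z, v₃, rfl, hzR⟩ := hhead
              obtain ⟨r₁, r₂, rfl, hz1, hz2⟩ := List.cons_sublist_iff.mp hv
              obtain ⟨s', t', rfl⟩ := List.append_of_mem hz1
              have h7 := hz' (Q₁ ++ s') z (t' ++ r₂) (by simp) hzR
              refine ⟨(P₃ ++ (s ++ R :: t)) ++ R :: (Q₁ ++ s'), z :: t' ++ r₂,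
                (u₀ ++ [R]) ++ [R + 1], z :: v₃, by simp, ?_, ?_, hu', hv', hN⟩
              · exact hu₁.append ((List.singleton_sublist.mpr h7).cons R)
              · exact (List.singleton_sublist.mpr (List.mem_cons_self (a := z) (l := t'))).append hz2
            · have h7 : ∀ x ∈ v, x ≤ R + 1 := by
                intro x hx
                cases v with
                | nil => simp at hx
                | cons z v₃ =>
                  have h8 : z ≤ R + 1 := by
                    by_contra hcon
                    exact hhead ⟨z, v₃, rfl, by omega⟩
                  rcases List.mem_cons.mp hx with rfl | hx
                  · exact h8
                  · exact le_trans (List.rel_of_pairwise_cons hv' hx) h8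
              have h9 := hook_lower_of_dec (P₁ := P₃ ++ (s ++ R :: t)) (P₂ := []) (v₁ := [])
                (v₂ := v) (N := N) hQ hu₁ h1 (List.Sublist.refl _)
                (hv.trans (List.sublist_append_right _ _))
                (List.pairwise_cons.mpr ⟨fun x hx => h7 x hx, hv'⟩)
                (by simp at hN ⊢; omega)
              simpa using h9
      · refine ⟨P ++ R :: Q₁, x₂, u₁ ++ R :: u₂, v, by simp, hu₁.append (hu₂.cons_cons R), hv, ?_,
          hv', by simpa using hN⟩
        rw [List.pairwise_append, List.pairwise_cons]
        refine ⟨h1, ⟨fun x hx => by have := h2 x hx; omega, h3⟩, fun a ha b hb => ?_⟩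
        have h5 : a < R := by
          have h6 := h4 a ha (R + 1) List.mem_cons_self
          have h7 : a ≠ R := fun h => hR (h ▸ ha)
          omega
        rcases List.mem_cons.mp hb with rfl | hb
        · exact h5
        · have := h2 b hb
          omega

/-- In the decreasing part of a hook, the letters `R` before the raised one must be raised too, and
`hP` supplies the letters `R + 1` for this. Its second alternative accounts for the box on the main
diagonal, below which there is no box. -/
theorem hook_raise {P Q : List ℕ} {R N : ℕ}
    (hQ : ∀ Q₁ Q₂, Q = Q₁ ++ Q₂ → Q₁.count (R + 1) ≤ Q₁.count R)
    (hP : ∀ P₃ P₄, P = P₃ ++ P₄ → P₄.count R ≤ P₄.count (R + 1) ∨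
      ∃ P₅ P₆, P₄ = P₅ ++ R :: P₆ ∧ (∀ x ∈ P₃ ++ P₅, x < R) ∧ P₆.count R ≤ P₆.count (R + 1))
    (h : Hook (P ++ R :: Q) N) : Hook (P ++ (R + 1) :: Q) N := by
  obtain ⟨x₁, x₂, u, v, hx, hu, hv, hu', hv', hN⟩ := h
  rcases append_cons_eq_append hx with ⟨P₂, rfl, rfl⟩ | ⟨Q₁, rfl, rfl⟩
  · obtain ⟨v₁, v', rfl, hv₁, hv0⟩ := List.sublist_append_iff.mp hv
    rcases List.sublist_cons_iff.mp hv0 with hv₂ | ⟨v₂, rfl, hv₂⟩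
    · exact ⟨x₁, P₂ ++ (R + 1) :: Q, u, v₁ ++ v', by simp, hu, hv₁.append (hv₂.cons _), hu', hv',
        hN⟩
    · rw [List.pairwise_append, List.pairwise_cons] at hv'
      obtain ⟨h1, ⟨h2, h3⟩, h4⟩ := hv'
      obtain ⟨k, v₀, rfl, hv₀⟩ := exists_append_replicate R v₁ h1
        (fun x hx => h4 x hx R List.mem_cons_self)
      obtain ⟨P₃, P₄, rfl, h5, h6⟩ := List.append_sublist_iff.mp hv₁
      have h7 := List.replicate_sublist_iff.mp h6
      have hdec : ∀ k', ((v₀ ++ List.replicate k' (R + 1)) ++ (R + 1) :: v₂).Pairwise (· ≥ ·) := by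
        intro k'
        rw [List.pairwise_append, List.pairwise_cons, List.pairwise_append]
        rw [List.pairwise_append] at h1
        refine ⟨⟨h1.1, List.pairwise_replicate.mpr (Or.inr le_rfl), fun a ha b hb => ?_⟩,
          ⟨fun x hx => ?_, h3⟩, fun a ha b hb => ?_⟩
        · rw [List.eq_of_mem_replicate hb]
          exact hv₀ a ha
        · have := h2 x hx
          omega
        · have h8 : R + 1 ≤ a := by
            rcases List.mem_append.mp ha with ha | ha
            · exact hv₀ a ha
            · exact (List.eq_of_mem_replicate ha).ge
          rcases List.mem_cons.mp hb with rfl | hb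
          · exact h8
          · have := h2 b hb
            omega
      -- In the exceptional case the first `R` exceeds everything before it. It is therefore moved
      -- to the end of the increasing part, and only the other `k - 1` letters have to be raised.
      rcases hP (x₁ ++ P₃) P₄ (by simp) with h8 | ⟨P₅, P₆, rfl, h8, h9⟩
      · refine ⟨x₁, (P₃ ++ P₄) ++ (R + 1) :: Q, u,
          (v₀ ++ List.replicate k (R + 1)) ++ (R + 1) :: v₂, by simp, hu, ?_, hu', hdec k,
          by simpa using hN⟩
        exact (h5.append (List.replicate_sublist_iff.mpr (h7.trans h8))).append (hv₂.cons_cons _)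
      · have hnil : v₀ = [] := by
          cases v₀ with
          | nil => rfl
          | cons y _ =>
            have h10 := hv₀ y List.mem_cons_self
            have h11 := h8 y (by
              have := h5.subset (List.mem_cons_self (a := y))
              simp [this])
            omega
        subst hnil
        rcases Nat.eq_zero_or_pos k with rfl | hk
        · refine ⟨x₁, (P₃ ++ (P₅ ++ R :: P₆)) ++ (R + 1) :: Q, u, (R + 1) :: v₂, by simp, hu, ?_,
            hu', by simpa using hdec 0, by simpa using hN⟩
          exact (hv₂.cons_cons _).trans (List.sublist_append_right _ _)
        · have h10 : P₅.count R = 0 := List.count_eq_zero.mpr fun hmem => by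
            have := h8 R (by simp [hmem])
            omega
          rw [List.count_append, List.count_cons_self, h10] at h7
          refine ⟨x₁ ++ P₃ ++ P₅ ++ [R], P₆ ++ (R + 1) :: Q, u ++ [R],
            List.replicate (k - 1) (R + 1) ++ (R + 1) :: v₂, by simp, ?_, ?_, ?_,
            by simpa using hdec (k - 1), ?_⟩
          · refine List.Sublist.append ?_ (List.Sublist.refl [R])
            rw [List.append_assoc]
            exact hu.trans (List.sublist_append_left _ _)
          · exact (List.replicate_sublist_iff.mpr (by omega)).append (hv₂.cons_cons _)
          · rw [List.pairwise_append]
            refine ⟨hu', List.pairwise_singleton _ _, fun a ha b hb => ?_⟩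
            rw [List.mem_singleton.mp hb]
            exact h8 a (by
              have := hu.subset ha
              simp [this])
          · simp at hN ⊢
            omega
  · obtain ⟨u₁, u', rfl, hu₁, hu0⟩ := List.sublist_append_iff.mp hu
    rcases List.sublist_cons_iff.mp hu0 with hu₂ | ⟨u₂, rfl, hu₂⟩
    · exact ⟨P ++ (R + 1) :: Q₁, x₂, u₁ ++ u', v, by simp, hu₁.append (hu₂.cons _), hv, hu', hv',
        hN⟩
    · have hinc := hu'
      rw [List.pairwise_append, List.pairwise_cons] at hinc
      obtain ⟨h1, ⟨h2, h3⟩, h4⟩ := hinc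
      -- Raising `R` conflicts only with a following `R + 1`; by `hQ` that letter is preceded in `Q`
      -- by an `R`, which takes over.
      by_cases hR : ∃ u₃, u₂ = (R + 1) :: u₃
      · obtain ⟨u₃, rfl⟩ := hR
        obtain ⟨r₁, r₂, rfl, hz1, hz2⟩ := List.cons_sublist_iff.mp hu₂
        obtain ⟨s', t', rfl⟩ := List.append_of_mem hz1
        have h5 := hQ (s' ++ [R + 1]) (t' ++ r₂ ++ x₂) (by simp)
        have h6 : R ∈ s' := by
          rw [← List.count_pos_iff]
          simp only [List.count_append, List.count_singleton] at h5
          simp at h5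
          omega
        refine ⟨P ++ (R + 1) :: ((s' ++ (R + 1) :: t') ++ r₂), x₂, u₁ ++ R :: (R + 1) :: u₃, v,
          by simp, ?_, hv, hu', hv', hN⟩
        refine hu₁.append (List.Sublist.cons _ ?_)
        have h8 : ([R] ++ ([R + 1] ++ u₃)).Sublist (s' ++ ((R + 1) :: t' ++ r₂)) :=
          (List.singleton_sublist.mpr h6).append
            ((List.singleton_sublist.mpr List.mem_cons_self).append hz2)
        simpa using h8
      · refine ⟨P ++ (R + 1) :: Q₁, x₂, u₁ ++ (R + 1) :: u₂, v, by simp,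
          hu₁.append (hu₂.cons_cons _), hv, ?_, hv', by simpa using hN⟩
        rw [List.pairwise_append, List.pairwise_cons]
        have h5 : ∀ x ∈ u₂, R + 1 < x := by
          intro x hx
          cases u₂ with
          | nil => simp at hx
          | cons y u₃ =>
            have h6 := h2 y List.mem_cons_self
            have h7 : y ≠ R + 1 := fun h => hR ⟨u₃, by rw [h]⟩
            rcases List.mem_cons.mp hx with rfl | hx
            · omega
            · have := List.rel_of_pairwise_cons h3 hx
              omega
        refine ⟨h1, ⟨h5, h3⟩, fun a ha b hb => ?_⟩
        have h6 := h4 a ha R List.mem_cons_self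
        rcases List.mem_cons.mp hb with rfl | hb
        · omega
        · have := h5 b hb
          omega

theorem ico_map_eq_append {r : ℕ → ℕ} {a b : ℕ} {l₁ l₂ : List ℕ} (hab : a ≤ b)
    (h : (List.Ico a b).map r = l₁ ++ l₂) :
    ∃ t, a ≤ t ∧ t ≤ b ∧ l₁ = (List.Ico a t).map r ∧ l₂ = (List.Ico t b).map r := by
  have hlen := congrArg List.length h
  simp only [List.length_map, List.Ico.length, List.length_append] at hlen
  refine ⟨a + l₁.length, by omega, by omega, ?_⟩
  rw [← List.Ico.append_consecutive (m := a + l₁.length) (by omega) (by omega), List.map_append] at h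
  obtain ⟨h1, h2⟩ := List.append_inj h (by simp)
  exact ⟨h1.symm, h2.symm⟩

theorem ico_map_eq_append_cons {r : ℕ → ℕ} {a b x : ℕ} {l₁ l₂ : List ℕ} (hab : a ≤ b)
    (h : (List.Ico a b).map r = l₁ ++ x :: l₂) :
    ∃ t, a ≤ t ∧ t < b ∧ l₁ = (List.Ico a t).map r ∧ r t = x ∧
      l₂ = (List.Ico (t + 1) b).map r := by
  obtain ⟨t, h1, h2, h3, h4⟩ := ico_map_eq_append hab h
  have h5 : t < b := by
    by_contra hcon
    rw [List.Ico.eq_nil_of_le (by omega)] at h4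
    simp at h4
  rw [List.Ico.eq_cons h5, List.map_cons, List.cons.injEq] at h4
  exact ⟨t, h1, h5, h3, h4.1.symm, h4.2⟩

theorem count_ico_map (r : ℕ → ℕ) (a b x : ℕ) :
    ((List.Ico a b).map r).count x = ((Finset.Ico a b).filter (fun i => r i = x)).card := by
  rcases le_or_gt a b with h | h
  · induction b, h using Nat.le_induction with
    | base => simp
    | succ b hb ih =>
      rw [List.Ico.succ_top hb, List.map_append, List.count_append, ih,
        ← Finset.insert_Ico_right_eq_Ico_add_one hb, Finset.filter_insert]
      by_cases h : r b = x
      · rw [if_pos h, Finset.card_insert_of_notMem (by simp)]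
        simp [h]
      · rw [if_neg h]
        simp [h]
  · rw [List.Ico.eq_nil_of_le h.le, Finset.Ico_eq_empty_of_le h.le]
    simp

theorem count_ico_map_le {r : ℕ → ℕ} {a b x y : ℕ} (f : ℕ → ℕ → Prop)
    (h : ∀ s, a ≤ s → s < b → r s = x → ∃ t, a ≤ t ∧ t < b ∧ r t = y ∧ f s t)
    (hf : ∀ s s' t, a ≤ s → s < b → a ≤ s' → s' < b → f s t → f s' t → s = s') :
    ((List.Ico a b).map r).count x ≤ ((List.Ico a b).map r).count y := by
  rw [count_ico_map, count_ico_map]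
  choose! g hg using h
  refine Finset.card_le_card_of_injOn g ?_ ?_
  · intro s hs
    simp only [Finset.coe_filter, Finset.mem_Ico, Set.mem_ofPred_eq] at hs ⊢
    have := hg s hs.1.1 hs.1.2 hs.2
    exact ⟨⟨this.1, this.2.1⟩, this.2.2.1⟩
  · intro s hs s' hs' heq
    simp only [Finset.coe_filter, Finset.mem_Ico, Set.mem_ofPred_eq] at hs hs'
    have h1 := (hg s hs.1.1 hs.1.2 hs.2).2.2.2
    have h2 := (hg s' hs'.1.1 hs'.1.2 hs'.2).2.2.2
    rw [heq] at h1
    exact hf s s' _ hs.1.1 hs.1.2 hs'.1.1 hs'.1.2 h1 h2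

/-! ### Invariance of hook subwords in a growth grid -/

namespace Grid

variable {m n : ℕ} (G : Grid m n)

theorem exists_c {i i' j : ℕ} {x : ℕ × ℕ} (hi : i ≤ i') (hi' : i' ≤ m) (hj : j ≤ n)
    (hx : x ∈ G.K i' j) (hx' : x ∉ G.K i j) : ∃ s, i ≤ s ∧ s < i' ∧ x = G.c s j := by
  induction i', hi using Nat.le_induction with
  | base => exact absurd hx hx'
  | succ k hk ih =>
    rw [G.stepc k j (by omega) hj] at hx
    rcases hx with rfl | hx
    · exact ⟨k, hk, by omega, rfl⟩
    · obtain ⟨s, h1, h2, h3⟩ := ih (by omega) hx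
      exact ⟨s, h1, by omega, h3⟩

theorem exists_d {i j j' : ℕ} {x : ℕ × ℕ} (hi : i ≤ m) (hj : j ≤ j') (hj' : j' ≤ n)
    (hx : x ∈ G.K i j') (hx' : x ∉ G.K i j) : ∃ s, j ≤ s ∧ s < j' ∧ x = G.d i s :=
  G.transpose.exists_c hj hj' hi hx hx'

theorem c_injOn {i i' j : ℕ} (hi : i < m) (hi' : i' < m) (hj : j ≤ n)
    (h : G.c i j = G.c i' j) : i = i' := by
  rcases lt_trichotomy i i' with h1 | h1 | h1
  · have := G.c_lt h1 hi' le_rfl hj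
    rw [h] at this
    omega
  · exact h1
  · have := G.c_lt h1 hi le_rfl hj
    rw [h] at this
    omega

/-- The rows of the boxes `aᵢ`, `lo ≤ i < hi`, after they have passed `b₀, …, bⱼ₋₁`. -/
def rows (j lo hi : ℕ) : List ℕ := (List.Ico lo hi).map (fun i => (G.c i j).1)

section vertical

variable {k j : ℕ} (hk : k < m) (hj : j < n) (hd : G.d (k + 1) j = south (G.c k j))
include hk hj hd

/-- Apart from `G.c k j` and the box south of it, the set is `G.K k j`, and such a box in `G.K k j`
would force `G.c k j` into it. -/
theorem notMem_of_vertical {x : ℕ × ℕ} (h1 : (G.c k j).1 ≤ x.1) (h2 : (G.c k j).2 < x.2)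
    : x ∉ G.K (k + 1) (j + 1) := by
  intro hx
  rw [G.stepd (k + 1) j hk hj, G.stepc k j hk hj.le, hd] at hx
  rcases hx with rfl | rfl | hx
  · simp [south] at h2
  · omega
  · exact (G.addc k j hk hj.le).1
      (((G.lower k j hk.le hj.le) x hx).2 _ (G.c_diag hk hj.le) h1 h2.le)

/-- The box south of `G.c k j` is addable, so the next row is filled up to it. A box of this row
which is weakly east of `G.c s j` cannot be older than `G.c s j`, so it is one of the letters
between. -/
theorem exists_row_succ {s : ℕ} (hs : s < k) (hrow : (G.c s j).1 = (G.c k j).1) (y : ℕ)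
    (hy : (G.c k j).1 + 1 ≤ y) (hy' : (G.c s j).2 ≤ y) (hy2 : y < (G.c k j).2) :
    ∃ t, s < t ∧ t < k ∧ G.c t j = ((G.c k j).1 + 1, y) := by
  have h1 := (G.addd (k + 1) j hk hj).2.2 ((G.c k j).1 + 1, y) (by simpa using hy)
    (by rw [hd]; simp [south]) (by rw [hd]; simp [south]; omega)
    (by rw [hd]; intro h; have := congrArg Prod.snd h; simp [south] at this; omega)
  obtain ⟨t, ht1, ht2, ht3⟩ := G.exists_c (i := s) (by omega) hk hj.le h1 (fun h => by
    have h2 := (G.lower s j (by omega) hj.le).lt h (G.addc s j (by omega) hj.le).1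
      (G.c_diag (by omega) hj.le)
    simp at h2
    omega)
  have hts : t ≠ s := by
    rintro rfl
    have := congrArg Prod.fst ht3
    simp at this
    omega
  have htk : t ≠ k := by
    rintro rfl
    have := congrArg Prod.fst ht3
    simp at this
  exact ⟨t, by omega, by omega, ht3.symm⟩

/-- Each letter in the row of `aₖ` is matched with the letter in the box below it, which exists off
the main diagonal. -/
theorem count_rows_le {lo : ℕ} (hdiag : ∀ s, lo ≤ s → s < k → G.c s j ≠ ((G.c k j).1, (G.c k j).1)) :
    (G.rows j lo k).count (G.c k j).1 ≤ (G.rows j lo k).count ((G.c k j).1 + 1) := by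
  refine count_ico_map_le (fun s t => (G.c s j).1 = (G.c k j).1 ∧ (G.c t j).2 = (G.c s j).2) ?_ ?_
  · intro s hs1 hs2 hs3
    have h1 := G.c_diag (i := s) (j := j) (by omega) hj.le
    have h2 : (G.c k j).1 ≠ (G.c s j).2 := fun h => hdiag s hs1 hs2 (Prod.ext hs3 h.symm)
    have h3 := G.c_lt hs2 hk le_rfl hj.le
    obtain ⟨t, ht1, ht2, ht3⟩ := G.exists_row_succ hk hj hd hs2 hs3 (G.c s j).2 (by omega) le_rfl
      (by omega)
    exact ⟨t, by omega, ht2, by rw [ht3], hs3, by rw [ht3]⟩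
  · rintro s s' t hs1 hs2 hs1' hs2' ⟨h1, h2⟩ ⟨h3, h4⟩
    exact G.c_injOn (j := j) (by omega) (by omega) hj.le
      (Prod.ext (h1.trans h3.symm) (h2.symm.trans h4))

/-- The two words differ in the letter `aₖ`, which moves one row down. The hypotheses of
`hook_lower` and `hook_raise` hold by matching boxes of two adjacent rows in the same column: in the
later letters each box with the one above it, in the earlier ones each box with the one below it. -/
theorem hook_vertical {lo hi N : ℕ} (hlo : lo ≤ k) (hhi : k < hi) (hhi' : hi ≤ m) :
    Hook (G.rows j lo k ++ ((G.c k j).1 + 1) :: G.rows (j + 1) (k + 1) hi) N ↔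
      Hook (G.rows j lo k ++ (G.c k j).1 :: G.rows (j + 1) (k + 1) hi) N := by
  have hQ : ∀ Q₁ Q₂, G.rows (j + 1) (k + 1) hi = Q₁ ++ Q₂ →
      Q₁.count ((G.c k j).1 + 1) ≤ Q₁.count (G.c k j).1 := by
    intro Q₁ Q₂ hQ
    obtain ⟨u, hu1, hu2, rfl, -⟩ := ico_map_eq_append (by omega) hQ
    have hck : G.c k (j + 1) = south (G.c k j) := by
      rcases G.cell k j hk hj with h | h
      · rw [h.2.2, hd]
      · exact absurd (Or.inr hd) h.1
    refine count_ico_map_le (fun s t => (G.c s (j + 1)).1 = (G.c k j).1 + 1 ∧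
      (G.c t (j + 1)).2 = (G.c s (j + 1)).2) ?_ ?_
    · intro s hs1 hs2 hs3
      have h1 := G.c_lt (i := k) (i' := s) (j := j + 1) hs1 (by omega) le_rfl hj
      rw [hck] at h1
      simp only [south] at h1
      have h2 := (G.addc s (j + 1) (by omega) hj).2.2 ((G.c k j).1, (G.c s (j + 1)).2)
        (by have := G.c_diag hk hj.le; simp; omega) (by simp; omega) (by simp)
        (by intro h; have := congrArg Prod.fst h; simp at this; omega)
      obtain ⟨t, ht1, ht2, ht3⟩ := G.exists_c (i := k + 1) hs1 (by omega) hj h2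
        (G.notMem_of_vertical hk hj hd (by simp) (by simp; omega))
      exact ⟨t, ht1, by omega, by rw [← ht3], hs3, by rw [← ht3]⟩
    · rintro s s' t hs1 hs2 hs1' hs2' ⟨h1, h2⟩ ⟨h3, h4⟩
      exact G.c_injOn (j := j + 1) (by omega) (by omega) hj
        (Prod.ext (h1.trans h3.symm) (h2.symm.trans h4))
  refine ⟨hook_lower hQ ?_, hook_raise hQ ?_⟩
  · intro P₃ P₄ hP hmem Q₁ z Q₂ hQz hz
    obtain ⟨s, hs1, hs2, rfl, hs3, rfl⟩ := ico_map_eq_append_cons hlo hP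
    obtain ⟨u, hu1, hu2, rfl, hu3, rfl⟩ := ico_map_eq_append_cons (by omega) hQz
    have hno : ∀ t, s < t → t < k → (G.c t j).1 ≠ (G.c k j).1 + 1 := by
      intro t ht1 ht2 ht3
      exact hmem (List.mem_map.mpr ⟨t, List.Ico.mem.mpr ⟨ht1, ht2⟩, ht3⟩)
    have hsk := G.c_lt hs2 hk le_rfl hj.le
    have hsd := G.c_diag (i := s) (j := j) (by omega) hj.le
    have hkd : (G.c k j).1 + 1 ≤ (G.c k j).2 := by
      have := G.d_diag (i := k + 1) hk hj
      rw [hd] at this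
      simpa [south] using this
    -- Otherwise the next row would receive a box between `aₛ` and `aₖ`: the one below `aₛ`, or the
    -- diagonal one if `aₛ` is itself on the diagonal.
    have hC : (G.c k j).2 = (G.c k j).1 + 1 := by
      by_contra hne
      rcases Nat.lt_or_ge (G.c k j).1 (G.c s j).2 with h | h
      · obtain ⟨t, ht1, ht2, ht3⟩ := G.exists_row_succ hk hj hd hs2 hs3 (G.c s j).2 h le_rfl
          (by omega)
        exact hno t ht1 ht2 (by rw [ht3])
      · obtain ⟨t, ht1, ht2, ht3⟩ := G.exists_row_succ hk hj hd hs2 hs3 ((G.c k j).1 + 1) le_rfl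
          (by omega) (by omega)
        exact hno t ht1 ht2 (by rw [ht3])
    have hud := G.c_diag (i := u) (j := j + 1) (by omega) hj
    -- A box in row `R + 2` or below, `R` being the row of `aₖ`, requires the box `(R + 1, R + 2)`,
    -- which by `notMem_of_vertical` is added after `aₖ`.
    have h2 := (G.addc u (j + 1) (by omega) hj).2.2 ((G.c k j).1 + 1, (G.c k j).1 + 2)
      (by simp) (by simp; omega) (by simp; omega)
      (by intro h; have := congrArg Prod.fst h; simp at this; omega)
    obtain ⟨t, ht1, ht2, ht3⟩ := G.exists_c (i := k + 1) hu1 (by omega) hj h2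
      (G.notMem_of_vertical hk hj hd (by simp) (by simp; omega))
    exact List.mem_map.mpr ⟨t, List.Ico.mem.mpr ⟨ht1, ht2⟩, by rw [← ht3]⟩
  · intro P₃ P₄ hP
    obtain ⟨t, ht1, ht2, rfl, rfl⟩ := ico_map_eq_append hlo hP
    -- A letter on the main diagonal has no partner below. All earlier letters are in higher rows,
    -- as the second alternative of `hook_raise` demands.
    by_cases hdiag : ∃ s, t ≤ s ∧ s < k ∧ G.c s j = ((G.c k j).1, (G.c k j).1)
    · obtain ⟨s, hs1, hs2, hs3⟩ := hdiag
      refine Or.inr ⟨G.rows j t s, G.rows j (s + 1) k, ?_, ?_, ?_⟩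
      · rw [← List.Ico.append_consecutive hs1 hs2.le, List.map_append, List.Ico.eq_cons hs2]
        simp [rows, hs3]
      · intro x hx
        rw [rows, ← List.map_append, List.Ico.append_consecutive ht1 hs1] at hx
        obtain ⟨i, hi, rfl⟩ := List.mem_map.mp hx
        rw [List.Ico.mem] at hi
        have h1 := G.c_lt hi.2 (by omega) (j := j) le_rfl hj.le
        have h2 := G.c_diag (i := i) (j := j) (by omega) hj.le
        rw [hs3] at h1
        simp only at h1 ⊢
        omega
      · refine G.count_rows_le hk hj hd fun s' h1 h2 h3 => ?_
        have := G.c_injOn (by omega) (by omega) hj.le (h3.trans hs3.symm)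
        omega
    · exact Or.inl (G.count_rows_le hk hj hd fun s h1 h2 h3 => hdiag ⟨s, h1, h2, h3⟩)

end vertical

/-- The letters are carried from level `j` to level `j + 1` one at a time, starting with the last
one, which `bⱼ` meets first. Only a move to the south changes the row word. -/
theorem hook_rows_succ {j lo hi N : ℕ} (hj : j < n) (hlo : lo ≤ hi) (hhi : hi ≤ m) :
    Hook (G.rows (j + 1) lo hi) N ↔ Hook (G.rows j lo hi) N := by
  have key : ∀ k, lo ≤ k → k ≤ hi →
      (Hook (G.rows j lo k ++ G.rows (j + 1) k hi) N ↔ Hook (G.rows j lo hi) N) := by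
    intro k hk1 hk2
    induction hk2 using Nat.decreasingInduction with
    | self => simp [rows]
    | of_succ k hk ih =>
      rw [← ih (by omega)]
      have h1 : G.rows (j + 1) k hi = (G.c k (j + 1)).1 :: G.rows (j + 1) (k + 1) hi := by
        rw [rows, List.Ico.eq_cons hk]; rfl
      have h2 : G.rows j lo (k + 1) ++ G.rows (j + 1) (k + 1) hi =
          G.rows j lo k ++ (G.c k j).1 :: G.rows (j + 1) (k + 1) hi := by
        rw [rows, List.Ico.succ_top hk1, List.map_append, List.append_assoc]; rfl
      rw [h1, h2]
      rcases G.cell k j (by omega) hj with ⟨hadj | hadj, -, h4⟩ | ⟨-, -, h4⟩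
      · rw [h4, hadj]; rfl
      · rw [h4, hadj]
        exact G.hook_vertical (by omega) hj hadj hk1 hk hhi
      · rw [h4]
  simpa [rows] using key lo le_rfl hlo

theorem hook_rows {j lo hi N : ℕ} (hj : j ≤ n) (hlo : lo ≤ hi) (hhi : hi ≤ m) :
    Hook (G.rows j lo hi) N ↔ Hook (G.rows 0 lo hi) N := by
  induction j with
  | zero => rfl
  | succ j ih => rw [G.hook_rows_succ (by omega) hlo hhi, ih (by omega)]

end Grid

/-! ## Peaks and primes -/

/-- The sequence `r` is strictly increasing on `[lo, q]` and weakly decreasing on `[q, hi)`. -/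
structure IsPeak (r : ℕ → ℕ) (lo hi q : ℕ) : Prop where
  lo_le : lo ≤ q
  lt_hi : q < hi
  inc : ∀ i, lo ≤ i → i < q → r i < r (i + 1)
  dec : ∀ i, q ≤ i → i + 1 < hi → r (i + 1) ≤ r i

theorem IsPeak.lt {r : ℕ → ℕ} {lo hi q i i' : ℕ} (h : IsPeak r lo hi q) (h1 : lo ≤ i)
    (h2 : i < i') (h3 : i' ≤ q) : r i < r i' := by
  induction i', h2 using Nat.le_induction with
  | base => exact h.inc i h1 (by omega)
  | succ k hk ih => exact (ih (by omega)).trans (h.inc k (by omega) (by omega))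

theorem IsPeak.ge {r : ℕ → ℕ} {lo hi q i i' : ℕ} (h : IsPeak r lo hi q) (h1 : q ≤ i)
    (h2 : i ≤ i') (h3 : i' < hi) : r i' ≤ r i := by
  induction i', h2 using Nat.le_induction with
  | base => rfl
  | succ k hk ih => exact (h.dec k (by omega) h3).trans (ih (by omega))

theorem pairwise_ico_map {r : ℕ → ℕ} {a b : ℕ} {R : ℕ → ℕ → Prop}
    (h : ∀ i i', a ≤ i → i < i' → i' < b → R (r i) (r i')) :
    ((List.Ico a b).map r).Pairwise R := by
  rw [List.pairwise_map]
  refine (List.Ico.pairwise_lt a b).imp_of_mem fun {i i'} hi hi' hlt => ?_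
  rw [List.Ico.mem] at hi hi'
  exact h i i' hi.1 hlt hi'.2

theorem rel_of_pairwise_ico_map {r : ℕ → ℕ} {a b i i' : ℕ} {R : ℕ → ℕ → Prop}
    (h : ((List.Ico a b).map r).Pairwise R) (h1 : a ≤ i) (h2 : i < i') (h3 : i' < b) :
    R (r i) (r i') := by
  rw [← List.Ico.append_consecutive (m := i') (by omega) h3.le, List.map_append,
    List.pairwise_append] at h
  exact h.2.2 _ (List.mem_map_of_mem (List.Ico.mem.mpr ⟨h1, h2⟩)) _
    (List.mem_map_of_mem (List.Ico.mem.mpr ⟨le_rfl, h3⟩))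

/-- A hook subword of full length is the whole word. The peak is the last letter of the increasing
part or the first of the decreasing part. In this form unimodality can be transported by
`Grid.hook_rows`. -/
theorem hook_iff_isPeak {r : ℕ → ℕ} {lo hi : ℕ} (h : lo < hi) :
    Hook ((List.Ico lo hi).map r) (hi - lo) ↔ ∃ q, IsPeak r lo hi q := by
  constructor
  · rintro ⟨x₁, x₂, u, v, hx, hu, hv, hu', hv', hN⟩
    obtain ⟨t, ht1, ht2, rfl, rfl⟩ := ico_map_eq_append h.le hx
    have hl1 := hu.length_le
    have hl2 := hv.length_le
    simp only [List.length_map, List.Ico.length] at hl1 hl2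
    have h1 := hu.eq_of_length (by simp only [List.length_map, List.Ico.length]; omega)
    have h2 := hv.eq_of_length (by simp only [List.length_map, List.Ico.length]; omega)
    subst h1 h2
    have hinc : ∀ i, lo ≤ i → i + 1 < t → r i < r (i + 1) := fun i hi1 hi2 =>
      rel_of_pairwise_ico_map hu' hi1 (Nat.lt_succ_self i) hi2
    have hdec : ∀ i, t ≤ i → i + 1 < hi → r (i + 1) ≤ r i := fun i hi1 hi2 =>
      rel_of_pairwise_ico_map (R := (· ≥ ·)) hv' hi1 (Nat.lt_succ_self i) hi2
    by_cases hc : lo < t ∧ ¬ (t < hi ∧ r (t - 1) < r t)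
    · refine ⟨t - 1, by omega, by omega, fun i hi1 hi2 => hinc i hi1 (by omega),
        fun i hi1 hi2 => ?_⟩
      by_cases hit : i = t - 1
      · subst hit
        rw [show t - 1 + 1 = t by omega] at hi2 ⊢
        by_contra hcon
        exact hc.2 ⟨hi2, by omega⟩
      · exact hdec i (by omega) hi2
    · refine ⟨t, ht1, by omega, fun i hi1 hi2 => ?_, hdec⟩
      by_cases hit : i + 1 = t
      · have h3 : t - 1 = i := by omega
        have h4 : t < hi ∧ r (t - 1) < r t := by
          by_contra hcon
          exact hc ⟨by omega, hcon⟩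
        rw [h3] at h4
        rw [hit]
        exact h4.2
      · exact hinc i hi1 (by omega)
  · rintro ⟨q, hq⟩
    refine ⟨(List.Ico lo q).map r, (List.Ico q hi).map r, _, _, ?_, List.Sublist.refl _,
      List.Sublist.refl _, pairwise_ico_map fun i i' h1 h2 h3 => hq.lt h1 h2 h3.le,
      pairwise_ico_map fun i i' h1 h2 h3 => hq.ge h1 h2.le h3, ?_⟩
    · rw [← List.map_append, List.Ico.append_consecutive hq.lo_le hq.lt_hi.le]
    · simp only [List.length_map, List.Ico.length]
      have := hq.lo_le
      have := hq.lt_hi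
      omega

/-- The prime of the `i`-th letter of a window `[lo, hi)` of equal letters in the rows `r`: a letter
is primed when the next one is in a lower row, unprimed when the previous one is in the same or a
lower row; the prime `f` of the remaining letter is arbitrary. -/
def primeBit (r : ℕ → ℕ) (lo hi : ℕ) (f : Bool) (i : ℕ) : Bool :=
  if i + 1 < hi ∧ r i < r (i + 1) then true
  else if lo < i ∧ r i ≤ r (i - 1) then false else f

section bits

variable {r : ℕ → ℕ} {lo hi q i : ℕ} {f : Bool} (h : IsPeak r lo hi q)
include h

theorem IsPeak.bit_lt (h1 : lo ≤ i) (h2 : i < q) : primeBit r lo hi f i = true := by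
  have := h.lt_hi
  rw [primeBit, if_pos ⟨by omega, h.inc i h1 h2⟩]

theorem IsPeak.bit_eq : primeBit r lo hi f q = f := by
  rw [primeBit, if_neg (fun h1 => by have := h.dec q le_rfl h1.1; omega), if_neg]
  intro h1
  have := h.inc (q - 1) (by omega) (by omega)
  rw [show q - 1 + 1 = q by omega] at this
  omega

theorem IsPeak.bit_gt (h1 : q < i) (h2 : i < hi) : primeBit r lo hi f i = false := by
  have h3 := h.lo_le
  rw [primeBit, if_neg (fun h1 => by have := h.dec i (by omega) h1.1; omega), if_pos]
  refine ⟨by omega, ?_⟩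
  have := h.dec (i - 1) (by omega) (by omega)
  rwa [show i - 1 + 1 = i by omega] at this

theorem IsPeak.le_of_bit (h2 : i < hi) (hb : primeBit r lo hi f i = true) : i ≤ q := by
  by_contra hcon
  rw [h.bit_gt (by omega) h2] at hb
  exact Bool.noConfusion hb

theorem IsPeak.ge_of_bit (h1 : lo ≤ i) (hb : primeBit r lo hi f i = false) : q ≤ i := by
  by_contra hcon
  rw [h.bit_lt h1 (by omega)] at hb
  exact Bool.noConfusion hb

end bits

/-! ### Ascents of the rows, and how they change at the main diagonal -/

namespace Grid

variable {m n : ℕ} (G : Grid m n)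

/-- The row of `aᵢ` after it has passed `b₀, …, bⱼ₋₁`. -/
def rowC (j i : ℕ) : ℕ := (G.c i j).1

/-- The row of `bⱼ` after it has passed `aᵢ, aᵢ₊₁, …`. -/
def rowD (i j : ℕ) : ℕ := (G.d i j).1

theorem exists_peak {j lo hi : ℕ} (hj : j ≤ n) (hlo : lo < hi) (hhi : hi ≤ m)
    (h : ∃ q, IsPeak (G.rowC 0) lo hi q) : ∃ q, IsPeak (G.rowC j) lo hi q := by
  rw [← hook_iff_isPeak hlo] at h ⊢
  exact (G.hook_rows hj hlo.le hhi).mpr h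

theorem col_lt {j lo hi q i i' : ℕ} (hj : j ≤ n) (hhi : hi ≤ m) (h : IsPeak (G.rowC j) lo hi q)
    (h1 : q ≤ i) (h2 : i < i') (h3 : i' < hi) : (G.c i j).2 < (G.c i' j).2 := by
  induction i', h2 using Nat.le_induction with
  | base =>
    have h4 := h.dec i h1 h3
    have := G.c_cases (i := i) (j := j) (by omega) hj
    simp only [rowC] at h4
    change _ < (G.c (i + 1) j).2
    omega
  | succ k hk ih =>
    have h4 := h.dec k (by omega) h3
    have := G.c_cases (i := k) (j := j) (by omega) hj
    have := ih (by omega)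
    simp only [rowC] at h4
    omega

/-- The configuration in which a prime moves from one of the boxes `aᵢ` to another one when `bⱼ`
passes. -/
def DiagA (i j : ℕ) : Prop :=
  ∃ e, G.c i j = (e, e) ∧ G.c (i + 1) j = (e, e + 1) ∧ G.d (i + 2) j = (e + 1, e + 1)

/-- The configuration in which a prime moves from one of the boxes `bⱼ` to another one when `aᵢ`
passes. -/
def DiagB (i j : ℕ) : Prop :=
  ∃ e, G.c i j = (e, e) ∧ G.d (i + 1) j = (e, e + 1) ∧ G.d (i + 1) (j + 1) = (e + 1, e + 1)

section compare

variable {i j : ℕ}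

theorem DiagA.spec {G : Grid m n} (hi : i + 1 < m) (hj : j < n) {e : ℕ} (h1 : G.c i j = (e, e))
    (h2 : G.c (i + 1) j = (e, e + 1)) (h3 : G.d (i + 2) j = (e + 1, e + 1)) :
    G.d (i + 1) j = (e, e + 1) ∧ G.c (i + 1) (j + 1) = (e + 1, e + 1) ∧ G.d i j = (e, e) ∧
      G.c i (j + 1) = (e, e + 1) := by
  have h4 : G.d (i + 1) j = (e, e + 1) ∧ G.c (i + 1) (j + 1) = (e + 1, e + 1) := by
    rcases G.cell (i + 1) j hi hj with h | h
    · exact ⟨h.2.1.trans h2, h.2.2.trans h3⟩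
    · exact absurd (Or.inr (by rw [h2, h3]; rfl)) h.1
  refine ⟨h4.1, h4.2, ?_⟩
  rcases G.cell i j (by omega) hj with h | h
  · exact ⟨h.2.1.trans h1, h.2.2.trans h4.1⟩
  · exact absurd (Or.inl (by rw [h1, h4.1]; rfl)) h.1

/-- An ascent could be lost only if `aᵢ` moved south into the row of `aᵢ₊₁`. Then the box it takes
would be that of `aᵢ₊₁`, as only one box of a row is addable, and `aᵢ₊₁` would have to go east,
where the box above is still missing. -/
theorem rowC_lt_succ (hi : i + 1 < m) (hj : j < n) (h : G.rowC j i < G.rowC j (i + 1)) :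
    G.rowC (j + 1) i < G.rowC (j + 1) (i + 1) := by
  by_contra hcon
  simp only [rowC] at h hcon
  have h1 := G.c_le_succ hi hj
  have h2 := G.c_cases hi hj.le
  rcases G.cell i j (by omega) hj with ⟨hadj | hadj, h4, h5⟩ | ⟨-, h4, h5⟩
  · rw [h5, hadj] at hcon
    simp [east] at hcon
    omega
  · have h6 : G.c (i + 1) j = G.d (i + 1) j := by
      refine (G.addc (i + 1) j hi hj.le).same_row (G.addd (i + 1) j hi.le hj) ?_
      rw [h5, hadj] at hcon
      rw [hadj]
      simp only [south] at hcon ⊢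
      omega
    rcases G.cell (i + 1) j hi hj with ⟨h7, -, h8⟩ | ⟨-, h7, -⟩
    · have h9 : G.c (i + 1) (j + 1) = ((G.c i j).1 + 1, (G.c i j).2 + 1) := by
        rw [h8]
        rw [h6, hadj] at h7
        rcases h7 with h7 | h7
        · rw [h7]; simp [east, south]
        · rw [h8, h7, h5, hadj] at hcon
          simp [south] at hcon
      have h10 := (G.addc (i + 1) (j + 1) hi hj).2.2 ((G.c i j).1, (G.c i j).2 + 1)
        (by have := G.c_diag (i := i) (j := j) (by omega) hj.le; simp; omega)
        (by rw [h9]; simp) (by rw [h9])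
        (by rw [h9]; intro h; have := congrArg Prod.fst h; simp at this)
      rw [G.stepd (i + 1) j hi.le hj, G.stepc i j (by omega) hj.le, hadj] at h10
      rcases h10 with h10 | h10 | h10
      · have := congrArg Prod.fst h10
        simp [south] at this
      · have := congrArg Prod.snd h10
        simp at this
      · exact (G.addc i j (by omega) hj.le).1 (((G.lower i j (by omega) hj.le) _ h10).2 _
          (G.c_diag (by omega) hj.le) le_rfl (by simp))
    · have h8 := (G.d_notMem (i := i + 2) (i' := i + 2) (j := j) (j' := j) (by omega) le_rfl hj le_rfl)
      rw [← h7, ← h6] at h8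
      exact h8 (G.c_mem (by omega) (by omega) le_rfl hj.le)
  · rw [h5] at hcon
    omega

/-- An ascent appears only if `aᵢ₊₁` moves south from the box directly east of `aᵢ`. The box below
`aᵢ` would have to be present for this, which is impossible unless it is outside the shifted plane,
that is, unless `aᵢ` is on the diagonal. -/
theorem diagA_of_rowC (hi : i + 1 < m) (hj : j < n) (h : ¬ G.rowC j i < G.rowC j (i + 1))
    (h' : G.rowC (j + 1) i < G.rowC (j + 1) (i + 1)) : G.DiagA i j := by
  simp only [rowC] at h h'
  have h1 := G.c_le_succ (i := i) (by omega) hj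
  have h2 := G.c_cases hi hj.le
  rcases G.cell (i + 1) j hi hj with ⟨hadj | hadj, h4, h5⟩ | ⟨-, h4, h5⟩
  · rw [h5, hadj] at h'
    simp [east] at h'
    omega
  · rw [h5, hadj] at h'
    simp only [south] at h'
    have hrow : (G.c i j).1 = (G.c (i + 1) j).1 := by omega
    have hadd := G.addc (i + 1) j hi hj.le
    rw [G.stepc i j (by omega) hj.le] at hadd
    have hcol := (G.addc i j (by omega) hj.le).next_in_row (G.lower i j (by omega) hj.le) hadd hrow
    have hdg := G.c_diag (i := i) (j := j) (by omega) hj.le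
    by_cases hd : (G.c i j).1 = (G.c i j).2
    · refine ⟨(G.c i j).1, Prod.ext rfl hd.symm, Prod.ext hrow.symm (by simp; omega), ?_⟩
      rw [hadj]
      exact Prod.ext (by simp [south]; omega) (by simp [south]; omega)
    · exfalso
      have h10 := (G.addd (i + 2) j (by omega) hj).2.2 ((G.c i j).1 + 1, (G.c i j).2)
        (by simp; omega) (by rw [hadj]; simp [south]; omega) (by rw [hadj]; simp [south]; omega)
        (by rw [hadj]; intro h; have := congrArg Prod.snd h; simp [south] at this; omega)
      rw [G.stepc (i + 1) j hi hj.le, G.stepc i j (by omega) hj.le] at h10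
      rcases h10 with h10 | h10 | h10
      · have := congrArg Prod.fst h10
        simp at this
        omega
      · have := congrArg Prod.fst h10
        simp at this
      · exact (G.addc i j (by omega) hj.le).1 (((G.lower i j (by omega) hj.le) _ h10).2 _
          (G.c_diag (by omega) hj.le) (by simp) (by simp))
  · rw [h5] at h'
    omega

theorem rowC_lt_mono {j' : ℕ} (hi : i + 1 < m) (hj : j ≤ j') (hj' : j' ≤ n)
    (h : G.rowC j i < G.rowC j (i + 1)) : G.rowC j' i < G.rowC j' (i + 1) := by
  induction j', hj using Nat.le_induction with
  | base => exact h
  | succ k hk ih => exact G.rowC_lt_succ hi hj' (ih (by omega))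

theorem exists_diagA {j' : ℕ} (hi : i + 1 < m) (hj : j ≤ j') (hj' : j' ≤ n)
    (h : ¬ G.rowC j i < G.rowC j (i + 1)) (h' : G.rowC j' i < G.rowC j' (i + 1)) :
    ∃ l, j ≤ l ∧ l < j' ∧ G.DiagA i l := by
  induction j', hj using Nat.le_induction with
  | base => exact absurd h' h
  | succ k hk ih =>
    by_cases hc : G.rowC k i < G.rowC k (i + 1)
    · obtain ⟨l, h1, h2, h3⟩ := ih (by omega) hc
      exact ⟨l, h1, by omega, h3⟩
    · exact ⟨k, hk, by omega, G.diagA_of_rowC hi hj' hc h'⟩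

/-- The prime depends only on the ascents on the two sides of a letter, and an ascent changes only
in the configuration `DiagA`. -/
theorem primeBit_succ {lo hi : ℕ} {f : Bool} (hi' : i < hi) (hhi : hi ≤ m)
    (hj : j < n) (h1 : i + 1 < hi → ¬ G.DiagA i j) (h2 : lo < i → ¬ G.DiagA (i - 1) j) :
    primeBit (G.rowC (j + 1)) lo hi f i = primeBit (G.rowC j) lo hi f i := by
  have h3 : (i + 1 < hi ∧ G.rowC (j + 1) i < G.rowC (j + 1) (i + 1)) ↔
      (i + 1 < hi ∧ G.rowC j i < G.rowC j (i + 1)) := by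
    refine and_congr_right fun h => ⟨fun h4 => ?_, G.rowC_lt_succ (by omega) hj⟩
    by_contra hcon
    exact h1 h (G.diagA_of_rowC (by omega) hj hcon h4)
  have h4 : (lo < i ∧ G.rowC (j + 1) i ≤ G.rowC (j + 1) (i - 1)) ↔
      (lo < i ∧ G.rowC j i ≤ G.rowC j (i - 1)) := by
    refine and_congr_right fun h => ?_
    have h5 : i - 1 + 1 = i := by omega
    have h6 := G.rowC_lt_succ (i := i - 1) (j := j) (by omega) hj
    have h7 := G.diagA_of_rowC (i := i - 1) (j := j) (by omega) hj
    rw [h5] at h6 h7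
    rw [← not_lt, ← not_lt, not_iff_not]
    refine ⟨fun h8 => ?_, h6⟩
    by_contra hcon
    exact h2 h (h7 hcon h8)
  simp only [primeBit, h3, h4]

/-- A letter on the main diagonal is the peak of its window. -/
theorem eq_peak_of_diag {lo hi q : ℕ} (hlo : lo ≤ i) (hi' : i < hi) (hhi : hi ≤ m) (hj : j ≤ n)
    (hq : IsPeak (G.rowC j) lo hi q) (h : (G.c i j).1 = (G.c i j).2) : i = q := by
  rcases lt_trichotomy i q with h1 | h1 | h1
  · have h2 := hq.inc i hlo h1
    have h3 := hq.lt_hi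
    have h4 := G.c_cases (i := i) (j := j) (by omega) hj
    have h5 := G.c_diag (i := i + 1) (j := j) (by omega) hj
    simp only [rowC] at h2
    omega
  · exact h1
  · have h2 := hq.dec (i - 1) (by omega) (by omega)
    have h3 := G.c_lt (i := i - 1) (i' := i) (j := j) (by omega) (by omega) le_rfl hj
    have h5 := G.c_diag (i := i - 1) (j := j) (by omega) hj
    rw [show i - 1 + 1 = i by omega] at h2
    simp only [rowC] at h2
    omega

/-- The letter on the diagonal is the peak, which is `aᵢ` before and `aᵢ₊₁` afterwards. So the free
prime passes from `aᵢ` to `aᵢ₊₁`, and `aᵢ`, now before the peak, becomes primed: the exchange of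
primes in (S4) and (S7). -/
theorem DiagA.bits {G : Grid m n} {lo hi q q' : ℕ} {f : Bool} (hlo : lo ≤ i) (hi' : i + 1 < hi)
    (hhi : hi ≤ m) (hj : j < n) (hq : IsPeak (G.rowC j) lo hi q)
    (hq' : IsPeak (G.rowC (j + 1)) lo hi q') (h : G.DiagA i j) :
    primeBit (G.rowC j) lo hi f i = f ∧ primeBit (G.rowC j) lo hi f (i + 1) = false ∧
    primeBit (G.rowC (j + 1)) lo hi f i = true ∧ primeBit (G.rowC (j + 1)) lo hi f (i + 1) = f := by
  obtain ⟨e, h1, h2, h3⟩ := h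
  obtain ⟨h4, h5, h6, h7⟩ := DiagA.spec (G := G) (by omega) hj h1 h2 h3
  have h8 := G.eq_peak_of_diag hlo (by omega) hhi hj.le hq (by rw [h1])
  have h9 := G.eq_peak_of_diag (i := i + 1) (by omega) (by omega) hhi hj hq' (by rw [h5])
  subst h8 h9
  exact ⟨hq.bit_eq, hq.bit_gt (by omega) (by omega), hq'.bit_lt hlo (by omega), hq'.bit_eq⟩

/-- `DiagA` in the transposed grid describes the boxes after the two flips, `DiagB` those before.
Hence every statement on the primes of `a` yields one for `b`, read backwards. -/
theorem diagA_transpose_iff (hi : i < m) (hj : j + 1 < n) :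
    G.transpose.DiagA j i ↔ G.DiagB i j := by
  constructor
  · rintro ⟨e, h1, h2, h3⟩
    obtain ⟨h4, h5, h6, h7⟩ := DiagA.spec (G := G.transpose) hj hi h1 h2 h3
    exact ⟨e, h6, h7, h5⟩
  · rintro ⟨e, h1, h2, h3⟩
    have h4 : G.d i j = (e, e) ∧ G.c i (j + 1) = (e, e + 1) := by
      rcases G.cell i j hi (by omega) with h | h
      · exact ⟨h.2.1.trans h1, h.2.2.trans h2⟩
      · exact absurd (Or.inl (by rw [h1, h2]; rfl)) h.1
    have h5 : G.d i (j + 1) = (e, e + 1) ∧ G.c i (j + 2) = (e + 1, e + 1) := by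
      rcases G.cell i (j + 1) hi hj with h | h
      · exact ⟨h.2.1.trans h4.2, h.2.2.trans h3⟩
      · exact absurd (Or.inr (by rw [h4.2, h3]; rfl)) h.1
    exact ⟨e, h4.1, h5.1, h5.2⟩

end compare

end Grid

/-! ## The switching process of two strips of equal letters -/

/-- When each `aᵢ` has passed the first `J i` of the letters `b`, the letter `bⱼ` has been passed by
`aᵢ, aᵢ₊₁, …`. -/
structure OnB (m n : ℕ) (J : ℕ → ℕ) (i j : ℕ) : Prop where
  le : i ≤ m
  lt : j < n
  before : ∀ i' < i, J i' ≤ j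
  after : ∀ i', i ≤ i' → i' < m → j < J i'

/-- Each box of the grid belongs to one of the two chains along the path `J`. -/
theorem Grid.cover {m n : ℕ} (D : Grid m n) {J : ℕ → ℕ}
    (hmono : ∀ i i', i ≤ i' → i' < m → J i ≤ J i') (hle : ∀ i < m, J i ≤ n) {p : ℕ × ℕ}
    (hp : p ∈ D.K m n) (hp' : p ∉ D.K 0 0) :
    (∃ i < m, p = D.c i (J i)) ∨ ∃ i j, OnB m n J i j ∧ p = D.d i j := by
  classical
  have key : ∀ i ≤ m, ∀ t ≤ n, (∀ i' < i, J i' ≤ t) → (∀ i', i ≤ i' → i' < m → t ≤ J i') →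
      p ∈ D.K i t →
      (∃ i < m, p = D.c i (J i)) ∨ ∃ i j, OnB m n J i j ∧ p = D.d i j := by
    intro i
    induction i with
    | zero =>
      intro hi t ht h1 h2 hpt
      obtain ⟨j, hj1, hj2, hj3⟩ := D.exists_d hi (Nat.zero_le _) ht hpt hp'
      exact Or.inr ⟨0, j, ⟨hi, by omega, fun _ h => by omega,
        fun i' h3 h4 => hj2.trans_le (h2 i' h3 h4)⟩, hj3⟩
    | succ i ih =>
      intro hi t ht h1 h2 hpt
      by_cases hpi : p ∈ D.K (i + 1) (J i)
      · rw [D.stepc i (J i) (by omega) (hle i (by omega))] at hpi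
        rcases hpi with rfl | hpi
        · exact Or.inl ⟨i, by omega, rfl⟩
        · exact ih (by omega) (J i) (hle i (by omega)) (fun i' h3 => hmono _ _ h3.le (by omega))
            (fun i' h3 h4 => hmono _ _ h3 h4) hpi
      · obtain ⟨j, hj1, hj2, hj3⟩ := D.exists_d hi (h1 i (by omega)) ht hpt hpi
        exact Or.inr ⟨i + 1, j, ⟨hi, by omega,
          fun i' h3 => (hmono i' i (by omega) (by omega)).trans hj1,
          fun i' h3 h4 => hj2.trans_le (h2 i' h3 h4)⟩, hj3⟩
  exact key m le_rfl n le_rfl (fun i hi => hle i hi) (fun i' h1 h2 => by omega) hp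

/-- A growth grid for a strip of letters `a` of the first and a strip of letters `b` of the second
tableau, together with the filling `E₀` outside. -/
structure Strips (m n : ℕ) extends Grid m n where
  a : ℕ
  b : ℕ
  ha : 0 < a
  hb : 0 < b
  fa : Bool
  fb : Bool
  peakA : 0 < m → ∀ j ≤ n, ∃ q, IsPeak (toGrid.rowC j) 0 m q
  peakB : 0 < n → ∀ i ≤ m, ∃ q, IsPeak (toGrid.rowD i) 0 n q
  E₀ : ℕ × ℕ → Option (Letter ⊕ Letter)
  outA : ∀ p x, (p ∈ toGrid.K 0 0 ∨ p ∉ toGrid.K m n) → E₀ p = some (Sum.inl x) → x.val ≠ a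
  outB : ∀ p x, (p ∈ toGrid.K 0 0 ∨ p ∉ toGrid.K m n) → E₀ p = some (Sum.inr x) → x.val ≠ b

/-! ### Paths in the grid and the fillings shown by them -/

namespace Strips

variable {m n : ℕ} (D : Strips m n)

/-- The letter `aᵢ` after it has passed `b₀, …, bⱼ₋₁`. -/
def letA (i j : ℕ) : Letter := ⟨D.a, D.ha, primeBit (D.rowC j) 0 m D.fa i⟩

/-- The letter `bⱼ` after it has passed `aᵢ, aᵢ₊₁, …`. -/
def letB (i j : ℕ) : Letter := ⟨D.b, D.hb, primeBit (D.rowD i) 0 n D.fb j⟩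

/-- The filling `E` shows the letters after each `aᵢ` has passed the first `J i` of the letters
`b`. -/
structure St (J : ℕ → ℕ) (E : ℕ × ℕ → Option (Letter ⊕ Letter)) : Prop where
  mono : ∀ i i', i ≤ i' → i' < m → J i ≤ J i'
  le : ∀ i < m, J i ≤ n
  A : ∀ i < m, E (D.c i (J i)) = some (Sum.inl (D.letA i (J i)))
  B : ∀ i j, OnB m n J i j → E (D.d i j) = some (Sum.inr (D.letB i j))
  frame : ∀ p, (p ∈ D.K 0 0 ∨ p ∉ D.K m n) → E p = D.E₀ p

variable {D} {J : ℕ → ℕ} {E : ℕ × ℕ → Option (Letter ⊕ Letter)}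

theorem St.cover (h : D.St J E) {p : ℕ × ℕ} (hp : p ∈ D.K m n) (hp' : p ∉ D.K 0 0) :
    (∃ i < m, p = D.c i (J i)) ∨ ∃ i j, OnB m n J i j ∧ p = D.d i j :=
  D.toGrid.cover h.mono h.le hp hp'

/-- The corner `(k, J k)` of the path `J` can be flipped. -/
structure Corner (D : Strips m n) (J : ℕ → ℕ) (k j : ℕ) : Prop where
  lt : k < m
  eq : J k = j
  lt' : j < n
  after : ∀ i, k < i → i < m → j < J i

/-- All other letters `a` and `b` sit in `D.K k j` or in boxes that are added after both boxes of
the cell, and the frame avoids these too; so a change in the two boxes does not affect them. -/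
theorem St.flip (h : D.St J E) {k j : ℕ} (hc : Corner D J k j)
    {E' : ℕ × ℕ → Option (Letter ⊕ Letter)}
    (h1 : ∀ p, p ≠ D.c k j → p ≠ D.d (k + 1) j → E' p = E p)
    (h2 : E' (D.c k (j + 1)) = some (Sum.inl (D.letA k (j + 1))))
    (h3 : E' (D.d k j) = some (Sum.inr (D.letB k j))) :
    D.St (Function.update J k (j + 1)) E' := by
  obtain ⟨hk, rfl, hj, hafter⟩ := hc
  refine ⟨fun i i' hi hi' => ?_, fun i hi => ?_, fun i hi => ?_, fun i j' hB => ?_, fun p hp => ?_⟩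
  · simp only [Function.update_apply]
    have := h.mono i i' hi hi'
    split_ifs with h4 h5 h5
    · exact le_rfl
    · subst h4
      exact hafter i' (by omega) hi'
    · subst h5
      omega
    · exact this
  · simp only [Function.update_apply]
    split_ifs with h4
    · omega
    · exact h.le i hi
  · simp only [Function.update_apply]
    split_ifs with h4
    · rw [h4]; exact h2
    · rw [← h.A i hi]
      rcases lt_or_gt_of_ne h4 with h5 | h5
      · have h6 := D.c_mem h5 hk.le (h.mono i k h5.le hk) hj.le
        refine h1 _ (fun h7 => ?_) (fun h7 => ?_)
        · rw [h7] at h6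
          exact D.c_notMem hk le_rfl hj.le le_rfl h6
        · rw [h7] at h6
          exact D.d_notMem hk (Nat.le_succ k) hj le_rfl h6
      · have h6 := D.c_notMem hi le_rfl (h.le i hi) le_rfl
        refine h1 _ (fun h7 => ?_) (fun h7 => ?_)
        · rw [h7] at h6
          exact h6 (D.c_mem h5 hi.le (hafter i h5 hi).le (h.le i hi))
        · rw [h7] at h6
          exact h6 (D.d_mem h5 hi.le (hafter i h5 hi) (h.le i hi))
  · obtain ⟨hB1, hB2, hB3, hB4⟩ := hB
    simp only [Function.update_apply] at hB3 hB4
    by_cases hjj : j' = J k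
    · subst hjj
      have hik : i = k := by
        by_contra hne
        rcases lt_or_gt_of_ne hne with h5 | h5
        · have h6 := hB4 i le_rfl (by omega)
          rw [if_neg hne] at h6
          have := h.mono i k h5.le hk
          omega
        · have h6 := hB3 k h5
          rw [if_pos rfl] at h6
          omega
      rw [hik]
      exact h3
    · have hB : OnB m n J i j' := by
        refine ⟨hB1, hB2, fun i' h4 => ?_, fun i' h4 h5 => ?_⟩
        · have h6 := hB3 i' h4
          split_ifs at h6 with h7
          · rw [h7]; omega
          · exact h6
        · have h6 := hB4 i' h4 h5
          split_ifs at h6 with h7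
          · rw [h7]; omega
          · exact h6
      rw [← h.B i j' hB]
      rcases lt_or_gt_of_ne hjj with h5 | h5
      · have hik : i ≤ k := by
          by_contra hne
          have := hB.before k (by omega)
          omega
        have h6 := D.d_mem (i := i) (i' := k) (j := j') (j' := J k) hik hk.le h5 hj.le
        refine h1 _ (fun h7 => ?_) (fun h7 => ?_)
        · rw [h7] at h6
          exact D.c_notMem hk le_rfl hj.le le_rfl h6
        · rw [h7] at h6
          exact D.d_notMem hk (Nat.le_succ k) hj le_rfl h6
      · have hik : k < i := by
          by_contra hne
          have := hB.after k (by omega) hk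
          omega
        have h6 := D.d_notMem (i := i) (i' := i) (j := j') (j' := j') hB1 le_rfl hB2 le_rfl
        refine h1 _ (fun h7 => ?_) (fun h7 => ?_)
        · rw [h7] at h6
          exact h6 (D.c_mem hik hB1 h5.le hB2.le)
        · rw [h7] at h6
          exact h6 (D.d_mem hik hB1 h5 hB2.le)
  · rw [← h.frame p hp]
    refine h1 _ ?_ ?_
    · rintro rfl
      rcases hp with hp | hp
      · exact D.c_notMem hk (Nat.zero_le _) hj.le (Nat.zero_le _) hp
      · exact hp (D.c_mem hk le_rfl hj.le le_rfl)
    · rintro rfl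
      rcases hp with hp | hp
      · exact D.d_notMem hk (Nat.zero_le _) hj (Nat.zero_le _) hp
      · exact hp (D.d_mem hk le_rfl hj le_rfl)

/-- The path `J` does not separate the two flips of a diagonal switch. -/
structure Good (D : Strips m n) (J : ℕ → ℕ) : Prop where
  ga : ∀ q j, q + 1 < m → j < n → D.DiagA q j → (J q ≤ j ↔ J (q + 1) ≤ j)
  gb : ∀ i q, i < m → q + 1 < n → D.DiagB i q → J i ≠ q + 1

theorem Good.update (h : Good D J) {k t : ℕ} (hkt : J k ≤ t)
    (h1 : ∀ l, J k ≤ l → l < t → l < n →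
      (k + 1 < m → ¬ D.DiagA k l) ∧ (0 < k → ¬ D.DiagA (k - 1) l))
    (h2 : ∀ q, t = q + 1 → q + 1 < n → ¬ D.DiagB k q) : Good D (Function.update J k t) := by
  refine ⟨fun q l hq hl hd => ?_, fun i q hi hq hd => ?_⟩
  · have h3 := h.ga q l hq hl hd
    simp only [Function.update_apply]
    have key : k = q ∨ k = q + 1 → (t ≤ l ↔ J k ≤ l) := by
      intro hkq
      refine ⟨fun h4 => hkt.trans h4, fun h4 => ?_⟩
      by_contra hcon
      rcases hkq with rfl | rfl
      · exact (h1 l h4 (by omega) hl).1 hq hd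
      · exact (h1 l h4 (by omega) hl).2 (by omega) (by simpa using hd)
    by_cases h4 : q = k
    · subst h4
      rw [if_pos rfl, if_neg (by omega), key (Or.inl rfl)]
      exact h3
    · by_cases h5 : q + 1 = k
      · subst h5
        rw [if_neg h4, if_pos rfl, key (Or.inr rfl)]
        exact h3
      · rw [if_neg h4, if_neg h5]
        exact h3
  · simp only [Function.update_apply]
    split_ifs with h4
    · subst h4
      intro h5
      exact h2 q h5 hq hd
    · exact h.gb i q hi hq hd

theorem letA_succ {k j : ℕ} (hk : k < m) (hj : j < n) (h1 : k + 1 < m → ¬ D.DiagA k j)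
    (h2 : 0 < k → ¬ D.DiagA (k - 1) j) : D.letA k (j + 1) = D.letA k j := by
  unfold letA
  rw [D.primeBit_succ hk le_rfl hj h1 h2]

theorem letB_succ {k j : ℕ} (hk : k < m) (hj : j < n) (h1 : j + 1 < n → ¬ D.DiagB k j)
    (h2 : 0 < j → ¬ D.DiagB k (j - 1)) : D.letB k j = D.letB (k + 1) j := by
  unfold letB
  congr 1
  refine (D.transpose.primeBit_succ (lo := 0) hj le_rfl hk (fun h => ?_) (fun h => ?_)).symm
  · rw [D.diagA_transpose_iff hk h]
    exact h1 h
  · rw [D.diagA_transpose_iff hk (by omega)]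
    exact h2 h

theorem adj_of_diagA {k j : ℕ} (hk : k + 1 < m) (hj : j < n) (h : D.DiagA k j) :
    Adj (D.c k j) (D.d (k + 1) j) ∧ Adj (D.c (k + 1) j) (D.d (k + 2) j) := by
  obtain ⟨e, h1, h2, h3⟩ := h
  have h4 := (Grid.DiagA.spec (G := D.toGrid) hk hj h1 h2 h3).1
  rw [h1, h2, h3, h4]
  exact ⟨Or.inl rfl, Or.inr rfl⟩

theorem adj_of_diagB {k j : ℕ} (h : D.DiagB k j) : Adj (D.c k j) (D.d (k + 1) j) := by
  obtain ⟨e, h1, h2, h3⟩ := h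
  rw [h1, h2]
  exact Or.inl rfl

/-- Nonadjacent boxes commute, so the flip leaves the filling as it is. No prime changes: the first
cell of a `DiagB` and both cells of a `DiagA` have adjacent boxes, and `Good` excludes a path that
has flipped only the first cell of a `DiagB`. -/
theorem St.flip_of_not_adj (h : D.St J E) (hg : Good D J) {k j : ℕ} (hc : Corner D J k j)
    (hadj : ¬ Adj (D.c k j) (D.d (k + 1) j)) :
    D.St (Function.update J k (j + 1)) E ∧ Good D (Function.update J k (j + 1)) := by
  have hA : k + 1 < m → ¬ D.DiagA k j := fun h1 h2 => hadj (adj_of_diagA h1 hc.lt' h2).1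
  have hA' : 0 < k → ¬ D.DiagA (k - 1) j := fun h1 h2 => by
    have h3 := (adj_of_diagA (by have := hc.lt; omega) hc.lt' h2).2
    rw [show k - 1 + 1 = k by omega, show k - 1 + 2 = k + 1 by omega] at h3
    exact hadj h3
  have hB : ¬ D.DiagB k j := fun h1 => hadj (adj_of_diagB h1)
  have hcell : D.d k j = D.d (k + 1) j ∧ D.c k (j + 1) = D.c k j := by
    rcases D.cell k j hc.lt hc.lt' with h1 | h1
    · exact absurd h1.1 hadj
    · exact h1.2
  constructor
  · refine h.flip hc (fun _ _ _ => rfl) ?_ ?_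
    · rw [hcell.2, letA_succ hc.lt hc.lt' hA hA']
      have := h.A k hc.lt
      rwa [hc.eq] at this
    · rw [hcell.1, letB_succ hc.lt hc.lt' (fun _ => hB)]
      · refine h.B (k + 1) j ⟨hc.lt, hc.lt', fun i' h1 => ?_, fun i' h1 h2 => hc.after i' h1 h2⟩
        rw [← hc.eq]
        exact h.mono i' k (by omega) hc.lt
      · intro h1 h2
        refine hg.gb k (j - 1) hc.lt (by have := hc.lt'; omega) h2 ?_
        have := hc.eq
        omega
  · refine hg.update (by have := hc.eq; omega) (fun l h1 h2 _ => ?_) (fun q h1 _ => ?_)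
    · have : l = j := by have := hc.eq; omega
      subst this
      exact ⟨hA, hA'⟩
    · have : q = j := by omega
      subst this
      exact hB

/-- Every corner of the path `J` can be flipped only by a switch. -/
def Tight (D : Strips m n) (J : ℕ → ℕ) : Prop :=
  ∀ k j, Corner D J k j → Adj (D.c k j) (D.d (k + 1) j)

/-- One filling may be shown by several paths; flipping all trivial corners leads to one whose
remaining corners are genuine switches. Each flip decreases the area beyond the path. -/
theorem St.exists_tight (h : D.St J E) (hg : Good D J) :
    ∃ J', D.St J' E ∧ Good D J' ∧ Tight D J' := by
  have key : ∀ N J, D.St J E → Good D J → ∑ i ∈ Finset.range m, (n - J i) ≤ N →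
      ∃ J', D.St J' E ∧ Good D J' ∧ Tight D J' := by
    intro N
    induction N with
    | zero =>
      intro J h hg hN
      refine ⟨J, h, hg, fun k j hc => ?_⟩
      have := Finset.single_le_sum (f := fun i => n - J i) (fun i _ => Nat.zero_le _)
        (Finset.mem_range.mpr hc.lt)
      have h1 := hc.eq
      have h2 := hc.lt'
      omega
    | succ N ih =>
      intro J h hg hN
      by_cases ht : Tight D J
      · exact ⟨J, h, hg, ht⟩
      · unfold Tight at ht
        push Not at ht
        obtain ⟨k, j, hc, hadj⟩ := ht
        obtain ⟨h1, h2⟩ := h.flip_of_not_adj hg hc hadj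
        refine ih _ h1 h2 ?_
        have h3 : ∑ i ∈ Finset.range m, (n - Function.update J k (j + 1) i) <
            ∑ i ∈ Finset.range m, (n - J i) := by
          refine Finset.sum_lt_sum (fun i _ => ?_) ⟨k, Finset.mem_range.mpr hc.lt, ?_⟩
          · simp only [Function.update_apply]
            split_ifs with h4
            · subst h4
              have := hc.eq
              omega
            · exact le_rfl
          · rw [Function.update_self, hc.eq]
            have := hc.lt'
            omega
        omega
  exact key _ J h hg le_rfl

end Strips

/-! ### The box selected by the switching process -/

theorem easternmost_eq {s : Finset (ℕ × ℕ)} (h : s.Nonempty) {p : ℕ × ℕ} (hp : p ∈ s)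
    (hmax : ∀ q ∈ s, q ≠ p → q.2 < p.2) : easternmost s h = p := by
  by_contra hne
  have h1 := hmax _ (easternmost_mem s h) hne
  have h2 := Finset.le_max' (s.image (fun p : ℕ × ℕ => toLex (p.2, p.1))) _
    (Finset.mem_image_of_mem _ hp)
  rw [Prod.Lex.le_iff] at h2
  unfold easternmost at h1
  simp only [Prod.snd_swap, ofLex_toLex] at h1 h2
  omega

theorem southernmost_eq {s : Finset (ℕ × ℕ)} (h : s.Nonempty) {p : ℕ × ℕ} (hp : p ∈ s)
    (hmax : ∀ q ∈ s, q ≠ p → q.1 < p.1) : southernmost s h = p := by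
  by_contra hne
  have h1 := hmax _ (southernmost_mem s h) hne
  have h2 := Finset.le_max' (s.image (fun p : ℕ × ℕ => toLex p)) _
    (Finset.mem_image_of_mem _ hp)
  rw [Prod.Lex.le_iff] at h2
  unfold southernmost at h1
  simp only [ofLex_toLex] at h1 h2
  omega

namespace Strips

variable {m n : ℕ} {D : Strips m n} {J : ℕ → ℕ} {F : BiFilling}

theorem St.isABox_iff (h : D.St J F.entry) {p : ℕ × ℕ} :
    IsABox D.a F p ↔ ∃ i < m, p = D.c i (J i) := by
  constructor
  · intro hp
    unfold IsABox at hp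
    by_cases hin : p ∈ D.K m n ∧ p ∉ D.K 0 0
    · rcases h.cover hin.1 hin.2 with h1 | ⟨i, j, h1, rfl⟩
      · exact h1
      · rw [h.B i j h1] at hp
        simp at hp
    · have hout : p ∈ D.K 0 0 ∨ p ∉ D.K m n := by tauto
      rw [h.frame p hout] at hp
      have h1 := D.outA p
      cases hE : D.E₀ p with
      | none => simp [hE] at hp
      | some x =>
        cases x with
        | inl x => exact absurd (by simpa [hE] using hp) (h1 x hout hE)
        | inr x => simp [hE] at hp
  · rintro ⟨i, hi, rfl⟩
    unfold IsABox
    rw [h.A i hi]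
    simp [letA]

theorem St.isBBox_iff (h : D.St J F.entry) {p : ℕ × ℕ} :
    IsBBox D.b F p ↔ ∃ i j, OnB m n J i j ∧ p = D.d i j := by
  constructor
  · intro hp
    unfold IsBBox at hp
    by_cases hin : p ∈ D.K m n ∧ p ∉ D.K 0 0
    · rcases h.cover hin.1 hin.2 with ⟨i, h1, rfl⟩ | h1
      · rw [h.A i h1] at hp
        simp at hp
      · exact h1
    · have hout : p ∈ D.K 0 0 ∨ p ∉ D.K m n := by tauto
      rw [h.frame p hout] at hp
      have h1 := D.outB p
      cases hE : D.E₀ p with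
      | none => simp [hE] at hp
      | some x =>
        cases x with
        | inr x => exact absurd (by simpa [hE] using hp) (h1 x hout hE)
        | inl x => simp [hE] at hp
  · rintro ⟨i, j, h1, rfl⟩
    unfold IsBBox
    rw [h.B i j h1]
    simp [letB]

theorem St.isPrimed_A (h : D.St J F.entry) {i : ℕ} (hi : i < m) :
    IsPrimed F (D.c i (J i)) ↔ primeBit (D.rowC (J i)) 0 m D.fa i = true := by
  unfold IsPrimed
  rw [h.A i hi]
  simp [letA]

theorem St.isPrimed_B (h : D.St J F.entry) {i j : ℕ} (hB : OnB m n J i j) :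
    IsPrimed F (D.d i j) ↔ primeBit (D.rowD i) 0 n D.fb j = true := by
  unfold IsPrimed
  rw [h.B i j hB]
  simp [letB]

/-- A `b`-box weakly southeast of the box of `aᵢ` has not been passed by `aᵢ`. -/
theorem St.bbox_southeast (h : D.St J F.entry) {i : ℕ} (hi : i < m) {q : ℕ × ℕ}
    (hq : IsBBox D.b F q) (h1 : (D.c i (J i)).1 ≤ q.1) (h2 : (D.c i (J i)).2 ≤ q.2) :
    ∃ i' j', i < i' ∧ J i ≤ j' ∧ OnB m n J i' j' ∧ q = D.d i' j' := by
  obtain ⟨i', j', hB, rfl⟩ := h.isBBox_iff.mp hq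
  have h3 : i < i' := by
    by_contra hcon
    have h4 := (D.lower i (J i) hi.le (h.le i hi)).lt
      (D.d_mem (not_lt.mp hcon) hi.le (hB.after i (not_lt.mp hcon) hi) (h.le i hi))
      (D.c_notMem hi le_rfl (h.le i hi) le_rfl) (D.c_diag hi (h.le i hi))
    omega
  exact ⟨i', j', h3, hB.before i h3, hB, rfl⟩

/-- `aₖ` is the next letter to be switched. -/
structure Active (D : Strips m n) (J : ℕ → ℕ) (k j : ℕ) : Prop where
  lt : k < m
  eq : J k = j
  lt' : j < n
  after : ∀ i, k < i → i < m → J i = n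

section active

variable {k j : ℕ} (h : D.St J F.entry) (hk : Active D J k j)
include h hk

theorem Active.onB {j' : ℕ} (h1 : j ≤ j') (h2 : j' < n) : OnB m n J (k + 1) j' := by
  refine ⟨hk.lt, h2, fun i hi => ?_, fun i hi hi' => ?_⟩
  · have := h.mono i k (by omega) hk.lt
    have := hk.eq
    omega
  · rw [hk.after i (by omega) hi']
    exact h2

omit h in
theorem Active.corner : Corner D J k j :=
  ⟨hk.lt, hk.eq, hk.lt', fun i h1 h2 => by rw [hk.after i h1 h2]; exact hk.lt'⟩

theorem Active.isBBox_iff {q : ℕ × ℕ} (h1 : (D.c k j).1 ≤ q.1) (h2 : (D.c k j).2 ≤ q.2) :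
    IsBBox D.b F q ↔ ∃ j', j ≤ j' ∧ j' < n ∧ q = D.d (k + 1) j' := by
  constructor
  · intro hq
    obtain ⟨i', j', h3, h4, h5, h6⟩ := h.bbox_southeast hk.lt hq (by rwa [hk.eq]) (by rwa [hk.eq])
    have h7 : i' = k + 1 := by
      by_contra hne
      have h8 := h5.before (k + 1) (by omega)
      rw [hk.after (k + 1) (by omega) (by have := h5.le; omega)] at h8
      have := h5.lt
      omega
    subst h7
    exact ⟨j', by rw [← hk.eq]; exact h4, h5.lt, h6⟩
  · rintro ⟨j', h3, h4, rfl⟩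
    exact h.isBBox_iff.mpr ⟨k + 1, j', hk.onB h h3 h4, rfl⟩

theorem Active.mem_switchable_iff (ht : Tight D J) : D.c k j ∈ switchable D.a D.b F := by
  have hA : IsABox D.a F (D.c k j) := h.isABox_iff.mpr ⟨k, hk.lt, by rw [hk.eq]⟩
  have hB : IsBBox D.b F (D.d (k + 1) j) :=
    h.isBBox_iff.mpr ⟨k + 1, j, hk.onB h le_rfl hk.lt', rfl⟩
  refine Finset.mem_filter.mpr ⟨hA.mem_shape, hA, ?_⟩
  rcases ht k j hk.corner with h1 | h1
  · exact Or.inl (h1 ▸ hB)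
  · exact Or.inr (h1 ▸ hB)

theorem Active.of_mem_switchable {q : ℕ × ℕ} (hq : q ∈ switchable D.a D.b F) (hne : q ≠ D.c k j) :
    ∃ i < k, q = D.c i (J i) := by
  obtain ⟨-, hA, hB⟩ := Finset.mem_filter.mp hq
  obtain ⟨i, hi, rfl⟩ := h.isABox_iff.mp hA
  refine ⟨i, ?_, rfl⟩
  have hik : i ≠ k := by
    rintro rfl
    exact hne (by rw [hk.eq])
  by_contra hcon
  have h1 := hk.after i (by omega) hi
  have h2 : ∃ i' j', i < i' ∧ J i ≤ j' ∧ OnB m n J i' j' := by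
    rcases hB with hB | hB <;>
    · obtain ⟨i', j', h3, h4, h5, -⟩ := h.bbox_southeast hi hB (by simp [east, south])
        (by simp [east, south])
      exact ⟨i', j', h3, h4, h5⟩
  obtain ⟨i', j', h3, h4, h5⟩ := h2
  have := h5.lt
  omega

/-- An unprimed letter is at or past the peak, from where columns increase; `aₖ` is therefore east
of it at level `J i`, and later moves only south or east. -/
theorem Active.col_lt_of_not_isPrimed {i : ℕ} (hi : i < k) (hp : ¬ IsPrimed F (D.c i (J i))) :
    (D.c i (J i)).2 < (D.c k j).2 := by
  have hkm := hk.lt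
  have hJ := h.le i (by omega)
  rw [h.isPrimed_A (by omega), Bool.not_eq_true] at hp
  obtain ⟨q, hq⟩ := D.peakA (by omega) (J i) hJ
  have h1 := D.col_lt hJ le_rfl hq (hq.ge_of_bit (Nat.zero_le _) hp) hi hkm
  have h2 := D.c_le hkm (h.mono i k hi.le hkm) (h.le k hkm)
  rw [hk.eq] at h2
  omega

/-- Induction downwards from `k`. Such a `DiagA` puts the peak at `aᵢ`, so `aᵢ₊₁`, `aᵢ₊₂` do not
ascend at level `l`. They do at level `j`, where `aₖ` is at or before the peak, so another `DiagA`
would occur for `i + 1`. Next to `aₖ` the contradiction comes from `Good`. -/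
theorem Active.not_diagA_of_isPrimed (hg : Good D J) (hp : IsPrimed F (D.c k j)) :
    ∀ s i, i + s + 1 = k → ∀ l, J i ≤ l → l < j → ¬ D.DiagA i l := by
  have hkm := hk.lt
  have hjn := hk.lt'
  have hkj := hk.eq
  obtain ⟨q, hq⟩ := D.peakA (by omega) j hjn.le
  have hkq : k ≤ q := by
    have := (h.isPrimed_A hkm).mp (by rw [hkj]; exact hp)
    rw [hkj] at this
    exact hq.le_of_bit hkm this
  intro s
  induction s with
  | zero =>
    rintro i hi l h1 h2 hd
    have h3 := (hg.ga i l (by omega) (by omega) hd).mp h1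
    rw [show i + 1 = k by omega] at h3
    omega
  | succ s ih =>
    intro i hi l h1 h2 hd
    have h3 := (hg.ga i l (by omega) (by omega) hd).mp h1
    obtain ⟨q', hq'⟩ := D.peakA (by omega) l (by omega)
    have h4 : i = q' := by
      obtain ⟨e, h4, -⟩ := hd
      exact D.eq_peak_of_diag (Nat.zero_le _) (by omega) le_rfl (by omega) hq' (by rw [h4])
    subst h4
    have h5 := hq'.dec (i + 1) (by omega) (by omega)
    obtain ⟨l', h6, h7, h8⟩ := D.exists_diagA (i := i + 1) (j := l) (j' := j) (by omega) h2.le hjn.le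
      (by omega) (hq.inc (i + 1) (Nat.zero_le _) (by omega))
    exact ih (i + 1) (by omega) l' (by omega) h7 h8

/-- At level `j` the rows increase strictly up to `aₖ`. Without a `DiagA` in between, the ascent
after `aᵢ` was present already at level `J i`, so `aᵢ` is primed there. -/
theorem Active.of_isPrimed (hg : Good D J) (hp : IsPrimed F (D.c k j)) {i : ℕ} (hi : i < k) :
    IsPrimed F (D.c i (J i)) ∧ (D.c i (J i)).1 < (D.c k j).1 := by
  have hkm := hk.lt
  have hjn := hk.lt'
  have hkj := hk.eq
  obtain ⟨q, hq⟩ := D.peakA (by omega) j hjn.le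
  have hkq : k ≤ q := by
    have := (h.isPrimed_A hkm).mp (by rw [hkj]; exact hp)
    rw [hkj] at this
    exact hq.le_of_bit hkm this
  have hJ : J i ≤ j := by rw [← hkj]; exact h.mono i k hi.le hkm
  have h1 : D.rowC (J i) i < D.rowC (J i) (i + 1) := by
    by_contra hcon
    obtain ⟨l, h2, h3, h4⟩ := D.exists_diagA (by omega) hJ hjn.le hcon
      (hq.inc i (Nat.zero_le _) (by omega))
    exact hk.not_diagA_of_isPrimed h hg hp (k - i - 1) i (by omega) l h2 h3 h4
  constructor
  · rw [h.isPrimed_A (by omega), primeBit, if_pos ⟨by omega, h1⟩]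
  · have h2 := D.c_le (i := i) (by omega) hJ hjn.le
    have h3 := hq.lt (Nat.zero_le _) hi hkq
    simp only [Grid.rowC] at h3
    omega

/-- All other switchable boxes belong to earlier letters. If `aₖ` is unprimed, the unprimed ones
among them are strictly west of it; if it is primed, all of them are primed and strictly north of
it. Thus the rule of choice selects the last letter that has not finished. -/
theorem Active.switchBox_eq (hg : Good D J) (ht : Tight D J) :
    switchBox D.a D.b F = some (D.c k j) := by
  have hmem := hk.mem_switchable_iff h ht
  by_cases hp : IsPrimed F (D.c k j)
  · have h1 : ∀ q ∈ switchable D.a D.b F, q ≠ D.c k j → IsPrimed F q ∧ q.1 < (D.c k j).1 := by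
      intro q hq hne
      obtain ⟨i, hi, rfl⟩ := hk.of_mem_switchable h hq hne
      exact hk.of_isPrimed h hg hp hi
    have h2 : ¬ ((switchable D.a D.b F).filter (fun p => ¬ IsPrimed F p)).Nonempty := by
      rintro ⟨q, hq⟩
      obtain ⟨hq1, hq2⟩ := Finset.mem_filter.mp hq
      by_cases hne : q = D.c k j
      · exact hq2 (hne ▸ hp)
      · exact hq2 (h1 q hq1 hne).1
    have h3 : (switchable D.a D.b F).Nonempty := ⟨_, hmem⟩
    rw [switchBox, dif_neg h2, dif_pos h3,
      southernmost_eq h3 hmem fun q hq hne => (h1 q hq hne).2]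
  · have hmem' : D.c k j ∈ (switchable D.a D.b F).filter (fun p => ¬ IsPrimed F p) :=
      Finset.mem_filter.mpr ⟨hmem, hp⟩
    have h1 : ((switchable D.a D.b F).filter (fun p => ¬ IsPrimed F p)).Nonempty := ⟨_, hmem'⟩
    rw [switchBox, dif_pos h1, easternmost_eq h1 hmem']
    intro q hq hne
    obtain ⟨hq1, hq2⟩ := Finset.mem_filter.mp hq
    obtain ⟨i, hi, rfl⟩ := hk.of_mem_switchable h hq1 hne
    exact hk.col_lt_of_not_isPrimed h hi hq2

end active

end Strips

/-! ### A switch as the flip of one or two cells -/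

namespace Strips

variable {m n : ℕ} {D : Strips m n} {J : ℕ → ℕ} {F : BiFilling} {k j : ℕ}

/-- The prime of the letters `b` is determined by a peak at all levels. -/
theorem peakD (hn : 0 < n) {i : ℕ} (hi : i ≤ m) : ∃ q, IsPeak (D.transpose.rowC i) 0 n q :=
  D.peakB hn i hi

section active

variable (h : D.St J F.entry) (hg : Good D J) (ht : Tight D J) (hk : Active D J k j)
include hk

include hg in
theorem Active.not_diagA (hkm : k + 1 < m) {l : ℕ} (hl : j ≤ l) (hl' : l < n) :
    ¬ D.DiagA k l := by
  intro hd
  have h1 := (hg.ga k l hkm hl' hd).mp (by rw [hk.eq]; exact hl)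
  rw [hk.after (k + 1) (by omega) hkm] at h1
  omega

include hg in
theorem Active.not_diagB_pred (hj : 0 < j) : ¬ D.DiagB k (j - 1) := by
  intro hd
  refine hg.gb k (j - 1) hk.lt (by have := hk.lt'; omega) hd ?_
  have := hk.eq
  omega

theorem Active.cell (hadj : Adj (D.c k j) (D.d (k + 1) j)) :
    D.d k j = D.c k j ∧ D.c k (j + 1) = D.d (k + 1) j := by
  rcases D.cell k j hk.lt hk.lt' with h1 | h1
  · exact h1.2
  · exact absurd hadj h1.1

include h hg in
-- Away from the diagonal configurations no prime moves, and the switch is the flip of a single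
-- cell.
theorem Active.swap (hadj : Adj (D.c k j) (D.d (k + 1) j)) (hA : 0 < k → ¬ D.DiagA (k - 1) j)
    (hB : j + 1 < n → ¬ D.DiagB k j) :
    D.St (Function.update J k (j + 1)) (F.swap (D.c k j) (D.d (k + 1) j)).entry ∧
      Good D (Function.update J k (j + 1)) := by
  have hcell := hk.cell hadj
  have hA' : k + 1 < m → ¬ D.DiagA k j := fun h1 => hk.not_diagA hg h1 le_rfl hk.lt'
  constructor
  · refine h.flip hk.corner (fun p h1 h2 => ?_) ?_ ?_
    · change F.entry (Equiv.swap _ _ p) = _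
      rw [Equiv.swap_apply_of_ne_of_ne h1 h2]
    · change F.entry (Equiv.swap _ _ _) = _
      rw [hcell.2, Equiv.swap_apply_right, letA_succ hk.lt hk.lt' hA' hA]
      have := h.A k hk.lt
      rwa [hk.eq] at this
    · change F.entry (Equiv.swap _ _ _) = _
      rw [hcell.1, Equiv.swap_apply_left, h.B _ _ (hk.onB h le_rfl hk.lt'),
        letB_succ hk.lt hk.lt' hB (fun h1 => hk.not_diagB_pred hg h1)]
  · refine hg.update (by have := hk.eq; omega) (fun l h1 h2 _ => ?_) (fun q h1 h2 => ?_)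
    · have : l = j := by have := hk.eq; omega
      subst this
      exact ⟨hA', hA⟩
    · have : q = j := by omega
      subst this
      exact hB h2

/-! ### Switches to the east -/

section east

variable (hE : D.d (k + 1) j = east (D.c k j))
include hE

omit hk in
theorem not_diagA_of_east (hk0 : 0 < k) : ¬ D.DiagA (k - 1) j := by
  rintro ⟨e, -, h2, h3⟩
  rw [show k - 1 + 1 = k by omega] at h2
  rw [show k - 1 + 2 = k + 1 by omega, hE, h2] at h3
  have := congrArg Prod.fst h3
  simp [east] at this

omit hE in
theorem Active.not_diagB_of_south (j' : ℕ) (hj' : j' < n)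
    (hS : south (D.c k j) = D.d (k + 1) j') : ¬ D.DiagB k j := by
  rintro ⟨e, h1, -, -⟩
  have h2 := D.d_diag (i := k + 1) hk.lt hj'
  rw [← hS, h1] at h2
  simp [south] at h2

include h in
-- If `bⱼ` were unprimed, it would be at or past the peak, and no later `b` could be in a lower row.
-- This is why (S5) asks for a prime.
theorem Active.isPrimed_east {j' : ℕ} (hj : j ≤ j') (hj' : j' < n)
    (hS : south (D.c k j) = D.d (k + 1) j') : IsPrimed F (east (D.c k j)) := by
  rw [← hE, h.isPrimed_B (hk.onB h le_rfl hk.lt')]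
  by_contra hcon
  obtain ⟨q, hq⟩ := D.peakB (by omega) (k + 1) hk.lt
  have h1 := hq.ge (hq.ge_of_bit (Nat.zero_le _) (by simpa using hcon)) hj hj'
  simp only [Grid.rowD, hE, ← hS, south, east] at h1
  omega

include h in
-- The `b` on the diagonal is the peak and `bⱼ` is primed, hence at or before it. Rows increase
-- strictly up to the peak and the two letters are in consecutive rows, so they are consecutive
-- letters.
theorem Active.diagSingle_iff : DiagSingle D.b F (D.c k j) ↔ j + 1 < n ∧ D.DiagB k j := by
  have hkm := hk.lt
  have hjn := hk.lt'
  have hB : IsBBox D.b F (east (D.c k j)) :=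
    h.isBBox_iff.mpr ⟨k + 1, j, hk.onB h le_rfl hjn, hE.symm⟩
  constructor
  · rintro ⟨h1, -, h2, h3⟩
    obtain ⟨j', h4, h5, h6⟩ := (hk.isBBox_iff h (by simp [southeast]) (by simp [southeast])).mp h3
    rw [← hE, h.isPrimed_B (hk.onB h le_rfl hjn)] at h2
    obtain ⟨q, hq⟩ := D.peakB (by omega) (k + 1) hkm
    have h7 := hq.le_of_bit hjn h2
    have h8 : j' = q := D.transpose.eq_peak_of_diag (j := k + 1) (Nat.zero_le _) h5 le_rfl hkm hq
      (by change (D.d (k + 1) j').1 = (D.d (k + 1) j').2; rw [← h6]; simp [southeast, h1])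
    have h9 : j' ≠ j := by
      rintro rfl
      rw [hE] at h6
      have := congrArg Prod.fst h6
      simp [southeast, east] at this
    have h10 : j' = j + 1 := by
      by_contra hne
      have h11 := hq.lt (i := j) (i' := j + 1) (Nat.zero_le _) (by omega) (by omega)
      have h12 := hq.lt (i := j + 1) (i' := j') (Nat.zero_le _) (by omega) (by omega)
      simp only [Grid.rowD, hE, ← h6, east, southeast] at h11 h12
      omega
    subst h10
    refine ⟨h5, (D.c k j).1, Prod.ext rfl h1, ?_, ?_⟩
    · rw [hE, east, h1]
    · rw [← h6, southeast, h1]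
  · rintro ⟨h1, e, h2, h3, h4⟩
    refine ⟨by rw [h2], hB, ?_, ?_⟩
    · rw [← hE, h.isPrimed_B (hk.onB h le_rfl hjn), primeBit,
        if_pos ⟨h1, by simp [Grid.rowD, h3, h4]⟩]
    · rw [h.isBBox_iff]
      exact ⟨k + 1, j + 1, hk.onB h (by omega) h1, by rw [h4, h2, southeast]⟩

include h hg in
-- In (S3), `aₖ` passes `bⱼ` and `bⱼ₊₁` at once. Physically `bⱼ₊₁` jumps to `(e, e)`, but in the
-- grid `bⱼ` goes there and takes over its prime, while `bⱼ₊₁` becomes unprimed in `(e, e + 1)`.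
theorem Active.diagonal_east (hj : j + 1 < n) (hd : D.DiagB k j) :
    D.St (Function.update J k (j + 2))
      (unprimeAt (F.swap (D.c k j) (southeast (D.c k j))) (east (D.c k j))).entry ∧
      Good D (Function.update J k (j + 2)) := by
  have hkm := hk.lt
  have hjn := hk.lt'
  have hcell := hk.cell (Or.inl hE)
  have hd' := hd
  obtain ⟨e, h1, h2, h3⟩ := hd
  obtain ⟨q, hq⟩ := peakD (D := D) (by omega) (i := k) hkm.le
  obtain ⟨q', hq'⟩ := peakD (D := D) (by omega) (i := k + 1) hkm
  have hbits := Grid.DiagA.bits (G := D.transpose) (i := j) (j := k) (f := D.fb) (Nat.zero_le _) hj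
    le_rfl hkm hq hq' ((D.diagA_transpose_iff hkm hj).mpr hd')
  have hcell' : D.d k (j + 1) = (e, e + 1) ∧ D.c k (j + 2) = (e + 1, e + 1) := by
    rcases D.cell k (j + 1) hkm hj with h4 | h4
    · exact ⟨by rw [h4.2.1, hcell.2, h2], by rw [h4.2.2, h3]⟩
    · exact absurd (Or.inr (by rw [hcell.2, h2, h3]; rfl)) h4.1
  rw [h1] at hcell
  rw [h2] at hcell
  have hrow : 0 < k → D.rowC j (k - 1) < D.rowC j k := by
    intro hk0
    obtain ⟨r, hr⟩ := D.peakA (by omega) j hjn.le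
    have h4 := D.eq_peak_of_diag (Nat.zero_le _) hkm le_rfl hjn.le hr (by rw [h1])
    exact hr.lt (Nat.zero_le _) (by omega) h4.le
  have hA : ∀ l, j ≤ l → l < j + 2 → (k + 1 < m → ¬ D.DiagA k l) ∧ (0 < k → ¬ D.DiagA (k - 1) l) := by
    intro l hl hl'
    refine ⟨fun h4 => hk.not_diagA hg h4 hl (by omega), fun h4 => ?_⟩
    by_cases hlj : l = j
    · subst hlj
      exact not_diagA_of_east hE h4
    -- At level `j` the diagonal letter `aₖ` is the peak, so `aₖ₋₁` is in a higher row. This ascent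
    -- persists at level `j + 1`, where a `DiagA` would need equal rows.
    · have : l = j + 1 := by omega
      subst this
      have h5 := D.rowC_lt_succ (i := k - 1) (j := j) (by omega) hjn
      rw [show k - 1 + 1 = k by omega] at h5
      have h6 := h5 (hrow h4)
      rintro ⟨e', h7, h8, -⟩
      rw [show k - 1 + 1 = k by omega] at h8
      simp [Grid.rowC, h7, h8] at h6
  have hlA : ∀ l, j ≤ l → l < j + 2 → D.letA k (l + 1) = D.letA k l := fun l hl hl' =>
    letA_succ hkm (by omega) (hA l hl hl').1 (hA l hl hl').2
  have hFA : F.entry (e, e) = some (Sum.inl (D.letA k j)) := by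
    have := h.A k hkm
    rwa [hk.eq, h1] at this
  have hFB : F.entry (e, e + 1) = some (Sum.inr (D.letB (k + 1) j)) := by
    rw [← h2]; exact h.B _ _ (hk.onB h le_rfl hjn)
  have hFB' : F.entry (e + 1, e + 1) = some (Sum.inr (D.letB (k + 1) (j + 1))) := by
    rw [← h3]; exact h.B _ _ (hk.onB h (by omega) hj)
  have hB1 : D.letB k j = D.letB (k + 1) (j + 1) := by
    unfold letB
    congr 1
    exact hbits.1.trans hbits.2.2.2.symm
  have hB2 : D.letB k (j + 1) = (D.letB (k + 1) j).erasePrime := by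
    unfold letB Letter.erasePrime
    congr 1
    exact hbits.2.1
  constructor
  -- The filling between the two flips does not occur in the switching process and serves only to
  -- apply `St.flip` twice.
  · have hst1 : D.St (Function.update J k (j + 1)) (Function.update (Function.update F.entry (e, e)
        (some (Sum.inr (D.letB k j)))) (e, e + 1) (some (Sum.inl (D.letA k (j + 1))))) := by
      refine h.flip hk.corner (fun p h4 h5 => ?_) ?_ ?_
      · rw [h1] at h4
        rw [h2] at h5
        rw [Function.update_of_ne h5, Function.update_of_ne h4]
      · rw [hcell.2, Function.update_self]
      · rw [hcell.1, Function.update_of_ne (by simp), Function.update_self]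
    have hcor : Corner D (Function.update J k (j + 1)) k (j + 1) := by
      refine ⟨hkm, by simp, hj, fun i h4 h5 => ?_⟩
      rw [Function.update_of_ne (by omega), hk.after i h4 h5]
      exact hj
    have hst2 := hst1.flip hcor (E' := (unprimeAt (F.swap (D.c k j) (southeast (D.c k j)))
      (east (D.c k j))).entry) (fun p h4 h5 => ?_) ?_ ?_
    · rwa [Function.update_idem] at hst2
    · rw [hcell.2] at h4
      rw [h3] at h5
      rw [Function.update_of_ne h4]
      simp only [unprimeAt, Filling.modify, Filling.swap, h1, southeast, east]
      rw [if_neg h4]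
      by_cases hp : p = (e, e)
      · subst hp
        rw [Equiv.swap_apply_left, Function.update_self, hFB', hB1]
      · rw [Equiv.swap_apply_of_ne_of_ne hp h5, Function.update_of_ne hp]
    · rw [hcell'.2]
      simp only [unprimeAt, Filling.modify, Filling.swap, h1, southeast, east]
      rw [if_neg (by simp), Equiv.swap_apply_right, hFA, hlA (j + 1) (by omega) (by omega),
        hlA j le_rfl (by omega)]
    · rw [hcell'.1]
      simp only [unprimeAt, Filling.modify, Filling.swap, h1, southeast, east]
      rw [if_pos trivial, Equiv.swap_apply_of_ne_of_ne (by simp) (by simp), hFB, hB2]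
      rfl
  · refine hg.update (by have := hk.eq; omega) (fun l h4 h5 _ => ?_) (fun q h4 h5 => ?_)
    · exact hA l (by have := hk.eq; omega) h5
    · have : q = j + 1 := by omega
      subst this
      rintro ⟨e', h6, -, -⟩
      rw [hcell.2] at h6
      have h7 := congrArg Prod.fst h6
      have h8 := congrArg Prod.snd h6
      simp only at h7 h8
      omega

include h hg in
theorem Active.switchAt_east : ∃ J', D.St J' (switchAt D.a D.b F (D.c k j)).entry ∧ Good D J' := by
  have hjn := hk.lt'
  have hB : IsBBox D.b F (east (D.c k j)) :=
    h.isBBox_iff.mpr ⟨k + 1, j, hk.onB h le_rfl hjn, hE.symm⟩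
  have hswap := fun h1 => hk.swap h hg (Or.inl hE) (fun h0 => not_diagA_of_east hE h0) h1
  rw [hE] at hswap
  unfold switchAt
  by_cases hS : IsBBox D.b F (south (D.c k j))
  · obtain ⟨j', h1, h2, h3⟩ := (hk.isBBox_iff h (by simp [south]) (by simp [south])).mp hS
    rw [if_pos ⟨hB, hS⟩, if_pos (hk.isPrimed_east h hE h1 h2 h3)]
    exact ⟨_, hswap fun _ => hk.not_diagB_of_south j' h2 h3⟩
  · rw [if_neg (fun h1 => hS h1.2), if_pos hB]
    by_cases hd : DiagSingle D.b F (D.c k j)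
    · rw [if_pos hd]
      obtain ⟨h1, h2⟩ := (hk.diagSingle_iff h hE).mp hd
      exact ⟨_, hk.diagonal_east h hg hE h1 h2⟩
    · rw [if_neg hd]
      exact ⟨_, hswap fun h1 h2 => hd ((hk.diagSingle_iff h hE).mpr ⟨h1, h2⟩)⟩

end east

end active

end Strips

namespace Strips

variable {m n : ℕ} {D : Strips m n} {J : ℕ → ℕ} {F : BiFilling} {k j : ℕ}

/-! ### Switches to the south -/

section south

variable (h : D.St J F.entry) (hg : Good D J) (ht : Tight D J) (hk : Active D J k j)
  (hS : D.d (k + 1) j = south (D.c k j))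
include hk hS

omit hk in
theorem not_diagB_of_eq_south : ¬ D.DiagB k j := by
  rintro ⟨e, h1, h2, -⟩
  rw [hS, h1] at h2
  have := congrArg Prod.fst h2
  simp [south] at this

include h in
-- If `bⱼ'` in the east were primed, rows would increase strictly from `bⱼ` to `bⱼ'`, but `bⱼ` in
-- the south is the lower one. So with two `b`-neighbors the prime tells which of them comes first.
theorem Active.not_isPrimed_east {j' : ℕ} (hj : j ≤ j') (hj' : j' < n)
    (hE : east (D.c k j) = D.d (k + 1) j') : ¬ IsPrimed F (east (D.c k j)) := by
  rw [hE, h.isPrimed_B (hk.onB h hj hj')]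
  intro hcon
  obtain ⟨q, hq⟩ := D.peakB (by omega) (k + 1) hk.lt
  have h0 : j ≠ j' := by
    rintro rfl
    rw [hS] at hE
    have := congrArg Prod.fst hE
    simp [south, east] at this
  have h1 := hq.lt (Nat.zero_le _) (by omega : j < j') (hq.le_of_bit hj' hcon)
  simp only [Grid.rowD, hS, ← hE, south, east] at h1
  omega

include h ht in
-- The letter on the diagonal is the peak at its level. Columns increase after it, so there is no
-- room for a letter between it and `aₖ`. If it lagged behind `aₖ`, tightness would let its next
-- switch lead into the box of `aₖ`.
theorem Active.diagA_of_diagPair (hd : DiagPair D.a D.b F (D.c k j)) :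
    0 < k ∧ J (k - 1) = j ∧ D.DiagA (k - 1) j := by
  have hkm := hk.lt
  have hjn := hk.lt'
  obtain ⟨h1, h2, h3, -⟩ := hd
  obtain ⟨i, hi, h4⟩ := h.isABox_iff.mp h3
  have h5 : D.c i (J i) = ((D.c k j).1, (D.c k j).1) := by
    rw [← h4, west, h1]
    simp
  have hik : i < k := by
    by_contra hcon
    by_cases hne : i = k
    · subst hne
      rw [hk.eq] at h5
      have := congrArg Prod.snd h5
      simp only at this
      omega
    · have h6 := D.c_lt (i := k) (i' := i) (j := j) (j' := J i) (by omega) hi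
        (by rw [hk.after i (by omega) hi]; exact hjn.le) (h.le i hi)
      rw [h5] at h6
      simp only at h6
      omega
  have hJi : J i ≤ j := by rw [← hk.eq]; exact h.mono i k hik.le hkm
  have hik' : k = i + 1 := by
    by_contra hne
    obtain ⟨q, hq⟩ := D.peakA (by omega) (J i) (h.le i hi)
    have h6 := D.eq_peak_of_diag (Nat.zero_le _) hi le_rfl (h.le i hi) hq (by rw [h5])
    have h7 := D.col_lt (i := i) (i' := i + 1) (h.le i hi) le_rfl hq h6.ge (by omega) (by omega)
    have h8 := D.col_lt (i := i + 1) (i' := k) (h.le i hi) le_rfl hq (by omega) (by omega) hkm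
    have h9 := D.c_le hkm hJi hjn.le
    rw [h5] at h7
    simp only at h7
    omega
  subst hik'
  have hJ : J i = j := by
    by_contra hne
    have hcor : Corner D J i (J i) := by
      refine ⟨hi, rfl, by omega, fun i' h6 h7 => ?_⟩
      by_cases h8 : i' = i + 1
      · rw [h8, hk.eq]; omega
      · rw [hk.after i' (by omega) h7]; omega
    have h10 : D.d (i + 1) (J i) = D.c (i + 1) j := by
      rcases ht i (J i) hcor with h6 | h6
      · rw [h6, h5]
        exact Prod.ext rfl (by simp [east, h1])
      · have h7 := D.d_diag (i := i + 1) (j := J i) hi (by omega)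
        rw [h6, h5] at h7
        simp [south] at h7
    have h11 := D.d_mem (i := i + 1) (i' := i + 1) (j := J i) (j' := j) le_rfl hi (by omega) hjn.le
    rw [h10] at h11
    exact D.c_notMem hkm le_rfl hjn.le le_rfl h11
  refine ⟨by omega, by simpa using hJ, (D.c (i + 1) j).1, ?_, ?_, ?_⟩
  · rw [hJ] at h5
    simpa using h5
  · simp only [Nat.add_sub_cancel]
    exact Prod.ext rfl h1
  · simp only [Nat.add_sub_cancel]
    rw [hS]
    exact Prod.ext rfl h1

include h ht in
-- Suppose `aₖ₋₁` lags behind. By tightness it has yet to move, so it reaches `(e, e)` by passing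
-- some earlier `bₗ` there. If `aₖ` moved when passing `bₗ`, the resulting ascent would persist,
-- against `DiagA`; if not, `bₗ` and `bⱼ` would both be on the diagonal at one level, hence both the
-- peak.
theorem Active.eq_of_diagA (hk0 : 0 < k) (hd : D.DiagA (k - 1) j) : J (k - 1) = j := by
  have hkm := hk.lt
  have hjn := hk.lt'
  obtain ⟨i, rfl⟩ : ∃ i, k = i + 1 := ⟨k - 1, by omega⟩
  simp only [Nat.add_sub_cancel] at hd ⊢
  obtain ⟨e, h1, h2, h3⟩ := hd
  have hJi : J i ≤ j := by rw [← hk.eq]; exact h.mono i (i + 1) (by omega) hkm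
  by_contra hne
  have hcor : Corner D J i (J i) := by
    refine ⟨by omega, rfl, by omega, fun i' h6 h7 => ?_⟩
    by_cases h8 : i' = i + 1
    · rw [h8, hk.eq]; omega
    · rw [hk.after i' (by omega) h7]; omega
  have h4 : D.c i (J i) ≠ (e, e) := by
    intro h4
    have h5 : D.c i (J i + 1) = D.d (i + 1) (J i) := by
      rcases D.cell i (J i) (by omega) (by omega) with h6 | h6
      · exact h6.2.2
      · exact absurd (ht i (J i) hcor) h6.1
    have h6 := (ht i (J i) hcor).add
    rw [← h5, h4] at h6
    have h7 := D.c_le (i := i) (j := J i + 1) (j' := j) (by omega) (by omega) hjn.le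
    rw [h1] at h7
    simp only at h6 h7
    omega
  obtain ⟨l, hl, hl1, hl2⟩ : ∃ l < j, D.c i l ≠ (e, e) ∧ D.c i (l + 1) = (e, e) := by
    have key : ∀ j', J i ≤ j' → D.c i j' = (e, e) →
        ∃ l < j', D.c i l ≠ (e, e) ∧ D.c i (l + 1) = (e, e) := by
      intro j' hj'
      induction j', hj' using Nat.le_induction with
      | base => exact fun h5 => absurd h5 h4
      | succ l hl ih =>
        intro h5
        by_cases h6 : D.c i l = (e, e)
        · obtain ⟨l', h7, h8⟩ := ih h6
          exact ⟨l', by omega, h8⟩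
        · exact ⟨l, by omega, h6, h5⟩
    exact key j hJi h1
  have h5 : Adj (D.c i l) (D.d (i + 1) l) ∧ D.d (i + 1) l = (e, e) := by
    rcases D.cell i l (by omega) (by omega) with h6 | h6
    · exact ⟨h6.1, by rw [← h6.2.2, hl2]⟩
    · exact absurd (by rw [← h6.2.2, hl2]) hl1
  have h6 : (D.c i l).1 < e := by
    have h7 := D.c_diag (i := i) (j := l) (by omega) (by omega)
    rcases h5.1 with h8 | h8
    · rw [h5.2] at h8
      have h9 := congrArg Prod.fst h8
      have h10 := congrArg Prod.snd h8
      simp only [east] at h9 h10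
      omega
    · rw [h5.2] at h8
      have h9 := congrArg Prod.fst h8
      simp only [south] at h9
      omega
  rcases D.cell (i + 1) l (by omega) (by omega) with h7 | h7
  · have h8 : D.rowC l i < D.rowC l (i + 1) := by
      simp only [Grid.rowC]
      rw [← h7.2.1, h5.2]
      exact h6
    have h9 := D.rowC_lt_mono (by omega) hl.le hjn.le h8
    simp [Grid.rowC, h1, h2] at h9
  · obtain ⟨q, hq⟩ := peakD (D := D) (by omega) (i := i + 1 + 1) hkm
    have h8 := D.transpose.eq_peak_of_diag (i := l) (j := i + 1 + 1) (Nat.zero_le _) (by omega)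
      le_rfl hkm hq (by change (D.d (i + 1 + 1) l).1 = (D.d (i + 1 + 1) l).2; rw [← h7.2.1, h5.2])
    have h9 := D.transpose.eq_peak_of_diag (i := j) (j := i + 1 + 1) (Nat.zero_le _) (by omega)
      le_rfl hkm hq (by change (D.d (i + 1 + 1) j).1 = (D.d (i + 1 + 1) j).2; rw [h3])
    omega

include h ht in
theorem Active.diagPair_iff :
    DiagPair D.a D.b F (D.c k j) ↔ 0 < k ∧ J (k - 1) = j ∧ D.DiagA (k - 1) j := by
  refine ⟨hk.diagA_of_diagPair h ht hS, ?_⟩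
  rintro ⟨h0, h1, hd⟩
  have hkm := hk.lt
  have hjn := hk.lt'
  obtain ⟨q, hq⟩ := D.peakA (by omega) j hjn.le
  obtain ⟨q', hq'⟩ := D.peakA (by omega) (j + 1) hjn
  have hbits := Grid.DiagA.bits (G := D.toGrid) (i := k - 1) (j := j) (f := D.fa) (Nat.zero_le _)
    (by omega) le_rfl hjn hq hq' hd
  obtain ⟨e, h2, h3, h4⟩ := hd
  rw [show k - 1 + 1 = k by omega] at h3 hbits
  refine ⟨by rw [h3], ?_, ?_, ?_⟩
  · have := h.isPrimed_A hkm
    rw [hk.eq] at this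
    rw [this, hbits.2.1]
    simp
  · rw [h.isABox_iff]
    exact ⟨k - 1, by omega, by rw [h1, h2, h3]; rfl⟩
  · rw [h.isBBox_iff]
    exact ⟨k + 1, j, hk.onB h le_rfl hjn, hS.symm⟩

include h hg in
-- In (S4) and (S7), `bⱼ` passes `aₖ` and `aₖ₋₁` at once: the cells `(k, j)` and `(k - 1, j)` are
-- flipped in this order, and the primes follow from `Grid.DiagA.bits`.
theorem Active.diagonal_south (hk0 : 0 < k) (hJ : J (k - 1) = j) (hd : D.DiagA (k - 1) j) :
    ∃ J', D.St J' (primeAt (F.swap (west (D.c k j)) (south (D.c k j))) (D.c k j)).entry ∧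
      Good D J' := by
  have hkm := hk.lt
  have hjn := hk.lt'
  obtain ⟨i, rfl⟩ : ∃ i, k = i + 1 := ⟨k - 1, by omega⟩
  simp only [Nat.add_sub_cancel] at hd hJ
  obtain ⟨q, hq⟩ := D.peakA (by omega) j hjn.le
  obtain ⟨q', hq'⟩ := D.peakA (by omega) (j + 1) hjn
  have hbits := Grid.DiagA.bits (G := D.toGrid) (i := i) (j := j) (f := D.fa) (Nat.zero_le _)
    (by omega) le_rfl hjn hq hq' hd
  have hd' := hd
  obtain ⟨e, h1, h2, h3⟩ := hd
  obtain ⟨h4, h5, h6, h7⟩ := Grid.DiagA.spec (G := D.toGrid) hkm hjn h1 h2 h3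
  have hB1 : j + 1 < n → ¬ D.DiagB (i + 1) j := fun _ => not_diagB_of_eq_south hS
  have hB2 : 0 < j → ¬ D.DiagB (i + 1) (j - 1) := fun h0 => hk.not_diagB_pred hg h0
  -- In a `DiagB`, the letter `bⱼ₊₁` would be in a lower row than `bⱼ`, and still so one level
  -- further, where `bⱼ` is on the diagonal and hence the peak.
  have hB3 : j + 1 < n → ¬ D.DiagB i j := by
    rintro h0 ⟨e', h8, -, h9⟩
    rw [h1] at h8
    have h10 : e = e' := congrArg Prod.fst h8
    subst h10
    have h11 : D.rowD (i + 1) j < D.rowD (i + 1) (j + 1) := by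
      simp [Grid.rowD, h4, h9]
    have h12 := D.transpose.rowC_lt_succ (i := j) (j := i + 1) h0 hkm h11
    obtain ⟨r, hr⟩ := peakD (D := D) (by omega) (i := i + 1 + 1) hkm
    have h13 := D.transpose.eq_peak_of_diag (i := j) (j := i + 1 + 1) (Nat.zero_le _) (by omega)
      le_rfl hkm hr (by change (D.d (i + 1 + 1) j).1 = (D.d (i + 1 + 1) j).2; rw [h3])
    have h14 := hr.dec j h13.ge h0
    omega
  have hB4 : 0 < j → ¬ D.DiagB i (j - 1) := fun h0 h8 =>
    hg.gb i (j - 1) (by omega) (by omega) h8 (by omega)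
  have hFA : F.entry (e, e) = some (Sum.inl (D.letA i j)) := by
    have := h.A i (by omega)
    rwa [hJ, h1] at this
  have hFA' : F.entry (e, e + 1) = some (Sum.inl (D.letA (i + 1) j)) := by
    have := h.A (i + 1) hkm
    rwa [hk.eq, h2] at this
  have hFB : F.entry (e + 1, e + 1) = some (Sum.inr (D.letB (i + 1 + 1) j)) := by
    rw [← h3]; exact h.B _ _ (hk.onB h le_rfl hjn)
  have hA1 : D.letA (i + 1) (j + 1) = D.letA i j := by
    unfold letA
    congr 1
    exact hbits.2.2.2.trans hbits.1.symm
  have hA2 : D.letA i (j + 1) = (D.letA (i + 1) j).addPrime := by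
    unfold letA Letter.addPrime
    congr 1
    exact hbits.2.2.1
  have hBB1 : D.letB (i + 1) j = D.letB (i + 1 + 1) j := letB_succ hkm hjn hB1 hB2
  have hBB2 : D.letB i j = D.letB (i + 1) j := letB_succ (by omega) hjn hB3 hB4
  refine ⟨Function.update (Function.update J (i + 1) (j + 1)) i (j + 1), ?_, ?_⟩
  · have hst1 : D.St (Function.update J (i + 1) (j + 1)) (Function.update (Function.update F.entry
        (e + 1, e + 1) (some (Sum.inl (D.letA (i + 1) (j + 1))))) (e, e + 1)
        (some (Sum.inr (D.letB (i + 1) j)))) := by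
      refine h.flip hk.corner (fun p h8 h9 => ?_) ?_ ?_
      · rw [h2] at h8
        rw [h3] at h9
        rw [Function.update_of_ne h8, Function.update_of_ne h9]
      · rw [h5, Function.update_of_ne (by simp), Function.update_self]
      · rw [h4, Function.update_self]
    have hcor : Corner D (Function.update J (i + 1) (j + 1)) i j := by
      refine ⟨by omega, by simpa using hJ, hjn, fun i' h8 h9 => ?_⟩
      by_cases h10 : i' = i + 1
      · rw [h10]; simp
      · rw [Function.update_of_ne h10, hk.after i' (by omega) h9]
        exact hjn
    refine hst1.flip hcor (fun p h8 h9 => ?_) ?_ ?_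
    · rw [h1] at h8
      rw [h4] at h9
      simp only [primeAt, Filling.modify, Filling.swap, h2, west, south, Nat.add_sub_cancel]
      rw [if_neg h9, Function.update_of_ne h9]
      by_cases hp : p = (e + 1, e + 1)
      · subst hp
        rw [Equiv.swap_apply_right, Function.update_self, hFA, hA1]
      · rw [Equiv.swap_apply_of_ne_of_ne h8 hp, Function.update_of_ne hp]
    · simp only [primeAt, Filling.modify, Filling.swap, h2, h7, west, south, Nat.add_sub_cancel]
      rw [if_pos trivial, Equiv.swap_apply_of_ne_of_ne (by simp) (by simp), hFA', hA2]
      rfl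
    · simp only [primeAt, Filling.modify, Filling.swap, h2, h6, west, south, Nat.add_sub_cancel]
      rw [if_neg (by simp), Equiv.swap_apply_left, hFB, hBB2, hBB1]
  · refine ⟨fun r l hr hl hdr => ?_, fun r l hr hl hdr => ?_⟩
    · have h8 := hg.ga r l hr hl hdr
      have hkj := hk.eq
      have h9 : r + 1 = i → l ≠ j := by
        rintro rfl rfl
        obtain ⟨e', -, h10, -⟩ := hdr
        rw [h1] at h10
        have h11 := congrArg Prod.fst h10
        have h12 := congrArg Prod.snd h10
        simp only at h11 h12
        omega
      have h10 : r = i + 1 → ¬ j ≤ l := by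
        rintro rfl h11
        exact hk.not_diagA hg hr h11 hl hdr
      by_cases hri : r = i
      · subst hri
        simp
      · by_cases hri' : r + 1 = i
        · subst hri'
          have h11 := h9 rfl
          rw [Function.update_of_ne (by omega), Function.update_of_ne (by omega),
            Function.update_self, h8]
          omega
        · by_cases hri2 : r = i + 1
          · subst hri2
            rw [Function.update_of_ne (by omega), Function.update_self,
              Function.update_of_ne (by omega), Function.update_of_ne (by omega)]
            have h11 := h10 rfl
            rw [hk.eq] at h8
            omega
          · rw [Function.update_of_ne (by omega), Function.update_of_ne (by omega),
              Function.update_of_ne (by omega), Function.update_of_ne (by omega)]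
            exact h8
    · have h8 := hg.gb r l hr hl hdr
      simp only [Function.update_apply]
      split_ifs with h9 h10
      · subst h9
        intro h11
        have : l = j := by omega
        subst this
        exact hB3 hl hdr
      · subst h10
        intro h11
        have : l = j := by omega
        subst this
        exact hB1 hl hdr
      · exact h8

include h hg ht in
theorem Active.switchAt_south : ∃ J', D.St J' (switchAt D.a D.b F (D.c k j)).entry ∧ Good D J' := by
  have hjn := hk.lt'
  have hB : IsBBox D.b F (south (D.c k j)) :=
    h.isBBox_iff.mpr ⟨k + 1, j, hk.onB h le_rfl hjn, hS.symm⟩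
  have hswap := fun h1 => hk.swap h hg (Or.inr hS) h1 (fun _ => not_diagB_of_eq_south hS)
  rw [hS] at hswap
  have key : ∃ J', D.St J' (if DiagPair D.a D.b F (D.c k j) then
      primeAt (F.swap (west (D.c k j)) (south (D.c k j))) (D.c k j)
      else F.swap (D.c k j) (south (D.c k j))).entry ∧ Good D J' := by
    split_ifs with hd
    · obtain ⟨h1, h2, h3⟩ := (hk.diagPair_iff h ht hS).mp hd
      exact hk.diagonal_south h hg hS h1 h2 h3
    · exact ⟨_, hswap fun h1 h2 =>
        hd ((hk.diagPair_iff h ht hS).mpr ⟨h1, hk.eq_of_diagA h ht hS h1 h2, h2⟩)⟩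
  unfold switchAt
  by_cases hE : IsBBox D.b F (east (D.c k j))
  · obtain ⟨j', h1, h2, h3⟩ := (hk.isBBox_iff h (by simp [east]) (by simp [east])).mp hE
    rw [if_pos ⟨hE, hB⟩, if_neg (hk.not_isPrimed_east h hS h1 h2 h3)]
    exact key
  · rw [if_neg (fun h1 => hE h1.1), if_neg hE, if_pos hB]
    exact key

end south

/-! ### From single switches to the switching process of two letters -/

theorem St.sigma (h : D.St J F.entry) (hg : Good D J) :
    ∃ J', D.St J' (sigma D.a D.b F).entry ∧ Good D J' := by
  classical
  obtain ⟨J, h, hg, ht⟩ := h.exists_tight hg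
  by_cases hs : (switchable D.a D.b F) = ∅
  · refine ⟨J, ?_, hg⟩
    rw [ShiftedSwitching.sigma, switchBox, dif_neg (by simp [hs]), dif_neg (by simp [hs])]
    exact h
  · by_cases hex : ∃ k, k < m ∧ J k < n
    · obtain ⟨k₀, hk₀⟩ := hex
      have hk1 := Nat.findGreatest_spec (P := fun k => k < m ∧ J k < n) hk₀.1.le hk₀
      set k := Nat.findGreatest (fun k => k < m ∧ J k < n) m with hkdef
      have hk : Active D J k (J k) := by
        refine ⟨hk1.1, rfl, hk1.2, fun i h1 h2 => ?_⟩
        have h3 := Nat.findGreatest_is_greatest (hkdef ▸ h1) h2.le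
        have := h.le i h2
        omega
      rw [ShiftedSwitching.sigma, hk.switchBox_eq h hg ht]
      rcases ht k (J k) hk.corner with h1 | h1
      · exact hk.switchAt_east h hg h1
      · exact hk.switchAt_south h hg ht h1
    · exfalso
      obtain ⟨q, hq⟩ := Finset.nonempty_iff_ne_empty.mpr hs
      obtain ⟨-, hA, hB⟩ := Finset.mem_filter.mp hq
      obtain ⟨i, hi, rfl⟩ := h.isABox_iff.mp hA
      have h2 : ∃ i' j', i < i' ∧ J i ≤ j' ∧ OnB m n J i' j' := by
        rcases hB with hB | hB <;>
        · obtain ⟨i', j', h3, h4, h5, -⟩ := h.bbox_southeast hi hB (by simp [east, south])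
            (by simp [east, south])
          exact ⟨i', j', h3, h4, h5⟩
      obtain ⟨i', j', h3, h4, h5⟩ := h2
      have := h5.lt
      exact hex ⟨i, hi, by omega⟩

/-- The switching process moves each letter `a` past all letters `b`. -/
theorem St.switchProcess (h : D.St (fun _ => 0) F.entry) :
    D.St (fun _ => n) (switchProcess D.a D.b F).entry := by
  classical
  have hg : Good D (fun _ => 0) := ⟨fun _ _ _ _ _ => Iff.rfl, fun _ _ _ _ _ => by omega⟩
  have key : ∀ t, ∃ J, D.St J ((ShiftedSwitching.sigma D.a D.b)^[t] F).entry ∧ Good D J := by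
    intro t
    induction t with
    | zero => exact ⟨_, h, hg⟩
    | succ t ih =>
      obtain ⟨J, h1, h2⟩ := ih
      rw [Function.iterate_succ_apply']
      exact h1.sigma h2
  obtain ⟨J, h1, h2⟩ := key (Nat.find (exists_fullySwitched D.a D.b F))
  have h3 := Nat.find_spec (exists_fullySwitched D.a D.b F)
  obtain ⟨J, h1, h2, ht⟩ := h1.exists_tight h2
  unfold ShiftedSwitching.switchProcess
  -- The last letter that had not passed all `b` would sit at a corner of the tight path, hence be
  -- switchable.
  have hJ : ∀ i < m, J i = n := by
    by_contra hex
    push Not at hex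
    obtain ⟨k₀, hk₀⟩ := hex
    have hk1 := Nat.findGreatest_spec (P := fun k => k < m ∧ J k ≠ n) hk₀.1.le hk₀
    set k := Nat.findGreatest (fun k => k < m ∧ J k ≠ n) m with hkdef
    have hk : Active D J k (J k) := by
      refine ⟨hk1.1, rfl, by have := h1.le k hk1.1; have := hk1.2; omega, fun i h4 h5 => ?_⟩
      have h6 := Nat.findGreatest_is_greatest (hkdef ▸ h4) h5.le
      tauto
    have h4 := hk.mem_switchable_iff h1 ht
    rw [h3] at h4
    simp at h4
  have hon : ∀ i j, OnB m n (fun _ => n) i j → OnB m n J i j := by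
    rintro i j ⟨h4, h5, h6, h7⟩
    refine ⟨h4, h5, fun i' h8 => ?_, fun i' h8 h9 => ?_⟩
    · have := h6 i' h8
      omega
    · rw [hJ i' h9]
      exact h5
  exact ⟨fun _ _ _ _ => le_rfl, fun _ _ => le_rfl, fun i hi => by
    have := h1.A i hi
    rwa [hJ i hi] at this,
    fun i j h4 => h1.B i j (hon i j h4), h1.frame⟩

end Strips

/-! ## Diagrams of strict partitions as lower sets -/

theorem StrictPartition.part_add_le_part_add (lam : StrictPartition) {i j : ℕ} (hij : i ≤ j)
    (h : 0 < lam.part j) : lam.part j + j ≤ lam.part i + i := by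
  induction j, hij using Nat.le_induction with
  | base => exact le_rfl
  | succ k hk ih =>
    rcases lam.strict k with h1 | h1
    · have := ih (by omega)
      omega
    · omega

theorem StrictPartition.isLower_diagram (lam : StrictPartition) :
    IsLower (lam.diagram : Set (ℕ × ℕ)) := by
  intro p hp
  rw [Finset.mem_coe, lam.mem_diagram] at hp
  refine ⟨hp.1, fun q h1 h2 h3 => ?_⟩
  rw [Finset.mem_coe, lam.mem_diagram]
  have := lam.part_add_le_part_add h2 (by omega)
  omega

theorem StrictPartition.contains_of_subset {lam mu : StrictPartition}
    (h : mu.diagram ⊆ lam.diagram) : lam.Contains mu := by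
  intro i
  by_contra hcon
  have h1 : (i, i + mu.part i - 1) ∈ mu.diagram := by
    rw [mu.mem_diagram]
    simp only
    omega
  have h2 := h h1
  rw [lam.mem_diagram] at h2
  simp only at h2
  omega

theorem StrictPartition.Contains.subset {lam mu : StrictPartition} (h : lam.Contains mu) :
    mu.diagram ⊆ lam.diagram := by
  intro p hp
  rw [StrictPartition.mem_diagram] at hp ⊢
  have := h p.1
  omega

theorem exists_diagram_eq {K : Set (ℕ × ℕ)} (hK : IsLower K) {lam : StrictPartition}
    (h : K ⊆ lam.diagram) : ∃ kappa : StrictPartition, (kappa.diagram : Set (ℕ × ℕ)) = K := by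
  classical
  have hex : ∀ i, ∃ n, (i, i + n) ∉ K := fun i => ⟨lam.part i, fun h1 => by
    have h2 := h h1
    rw [Finset.mem_coe, lam.mem_diagram] at h2
    simp only at h2
    omega⟩
  have hmem : ∀ i n, (i, i + n) ∈ K ↔ n < Nat.find (hex i) := by
    intro i n
    rw [Nat.lt_find_iff]
    refine ⟨fun h1 k hk => not_not.mpr ((hK _ h1).2 _ (by simp) le_rfl (by simpa using hk)),
      fun h1 => not_not.mp (h1 n le_rfl)⟩
  refine ⟨⟨fun i => Nat.find (hex i), fun i => ?_⟩, ?_⟩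
  · by_contra! hcon
    obtain ⟨n, hn⟩ : ∃ n, Nat.find (hex (i + 1)) = n + 1 :=
      Nat.exists_eq_succ_of_ne_zero hcon.2
    have h1 := (hmem (i + 1) n).mpr (by omega)
    have h2 := (hmem i (n + 1)).mp ((hK _ h1).2 (i, i + (n + 1)) (by simp) (by simp)
      (by simp only; omega))
    omega
  · ext p
    rw [Finset.mem_coe, StrictPartition.mem_diagram]
    simp only
    constructor
    · rintro ⟨h1, h2⟩
      have h3 := (hmem p.1 (p.2 - p.1)).mpr (by omega)
      rwa [show p.1 + (p.2 - p.1) = p.2 by omega] at h3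
    · intro h1
      have h2 := (hK p h1).1
      have h3 := (hmem p.1 (p.2 - p.1)).mp (by rwa [show p.1 + (p.2 - p.1) = p.2 by omega])
      omega

/-! ## Listings of tableaux -/

/-- The boxes of `S` are `c 0, …, c (N - 1)`, where those of the letter `v` are the boxes `c i` with
`st v ≤ i < st (v + 1)`; in each of these windows the rows are unimodal, and the primes are
determined by the rows, except for the one of the last box in the first part. -/
structure IsListing (st : ℕ → ℕ) (f : ℕ → Bool) (N : ℕ) (c : ℕ → ℕ × ℕ) (S : Filling Letter) :
    Prop where
  mono : Monotone st
  one : st 1 = 0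
  top : ∃ M, ∀ v ≥ M, st v = N
  peak : ∀ v, st v < st (v + 1) → ∃ q, IsPeak (fun i => (c i).1) (st v) (st (v + 1)) q
  entry : ∀ p x, S.entry p = some x ↔ ∃ i, st x.val ≤ i ∧ i < st (x.val + 1) ∧ p = c i ∧
    x.primed = primeBit (fun i => (c i).1) (st x.val) (st (x.val + 1)) (f x.val) i

namespace IsListing

variable {st : ℕ → ℕ} {f : ℕ → Bool} {N : ℕ} {c : ℕ → ℕ × ℕ} {S : Filling Letter}
  (h : IsListing st f N c S)
include h

theorem st_le (v : ℕ) : st v ≤ N := by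
  obtain ⟨M, hM⟩ := h.top
  rw [← hM (max v M) (le_max_right _ _)]
  exact h.mono (le_max_left _ _)

theorem exists_window {i : ℕ} (hi : i < N) : ∃ v, 0 < v ∧ st v ≤ i ∧ i < st (v + 1) := by
  classical
  obtain ⟨M, hM⟩ := h.top
  have hex : ∃ v, i < st v := ⟨M, by rw [hM M le_rfl]; exact hi⟩
  have h1 := Nat.find_spec hex
  have h2 : 1 < Nat.find hex := by
    rw [Nat.lt_find_iff]
    intro v hv
    have := h.mono hv
    rw [h.one] at this
    omega
  refine ⟨Nat.find hex - 1, by omega, ?_, ?_⟩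
  · exact not_lt.mp (Nat.find_min hex (by omega))
  · rwa [show Nat.find hex - 1 + 1 = Nat.find hex by omega]

theorem window_le {v w i i' : ℕ} (h1 : st v ≤ i) (hi : i ≤ i') (h2 : i' < st (w + 1)) :
    v ≤ w := by
  by_contra hcon
  have := h.mono (show w + 1 ≤ v by omega)
  omega

theorem window_unique {v w i : ℕ} (h1 : st v ≤ i) (h2 : i < st (v + 1)) (h3 : st w ≤ i)
    (h4 : i < st (w + 1)) : v = w :=
  le_antisymm (h.window_le h1 le_rfl h4) (h.window_le h3 le_rfl h2)

theorem entry_c {v i : ℕ} (hv : 0 < v) (h1 : st v ≤ i) (h2 : i < st (v + 1)) :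
    S.entry (c i) = some ⟨v, hv, primeBit (fun i => (c i).1) (st v) (st (v + 1)) (f v) i⟩ :=
  (h.entry _ _).mpr ⟨i, h1, h2, rfl, rfl⟩

theorem mem_shape {p : ℕ × ℕ} : p ∈ S.shape ↔ ∃ i < N, p = c i := by
  rw [S.mem_shape, Option.isSome_iff_exists]
  constructor
  · rintro ⟨x, hx⟩
    obtain ⟨i, h1, h2, h3, -⟩ := (h.entry p x).mp hx
    exact ⟨i, h2.trans_le (h.st_le _), h3⟩
  · rintro ⟨i, hi, rfl⟩
    obtain ⟨v, hv, h1, h2⟩ := h.exists_window hi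
    exact ⟨_, h.entry_c hv h1 h2⟩

theorem maxLetter_le_iff (v : ℕ) : maxLetter S ≤ v ↔ ∀ w > v, st w = st (w + 1) := by
  unfold maxLetter
  rw [Finset.sup_le_iff]
  constructor
  · intro h1 w hw
    by_contra hne
    have h2 : st w < st (w + 1) := lt_of_le_of_ne (h.mono (Nat.le_succ w)) hne
    have h3 := h.entry_c (by omega : 0 < w) le_rfl h2
    have h4 := h1 (c (st w)) (by rw [S.mem_shape, h3]; rfl)
    rw [h3] at h4
    simp at h4
    omega
  · intro h1 p hp
    rw [S.mem_shape, Option.isSome_iff_exists] at hp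
    obtain ⟨x, hx⟩ := hp
    rw [hx]
    obtain ⟨i, h2, h3, -⟩ := (h.entry p x).mp hx
    by_contra hcon
    have := h1 x.val (by simpa using hcon)
    omega

theorem st_of_maxLetter_lt {v : ℕ} (hv : maxLetter S < v) : st v = N := by
  obtain ⟨M, hM⟩ := h.top
  have h1 := (h.maxLetter_le_iff _).mp le_rfl
  have h2 : ∀ w, v ≤ w → st v = st w := by
    intro w hw
    induction w, hw using Nat.le_induction with
    | base => rfl
    | succ k hk ih => rw [ih, h1 k (by omega)]
  rw [h2 (max v M) (le_max_left _ _), hM _ (le_max_right _ _)]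

theorem congr {c' : ℕ → ℕ × ℕ} (hc : ∀ i < N, c' i = c i) : IsListing st f N c' S := by
  have hbit : ∀ v i, i < st (v + 1) →
      primeBit (fun i => (c' i).1) (st v) (st (v + 1)) (f v) i =
        primeBit (fun i => (c i).1) (st v) (st (v + 1)) (f v) i := by
    intro v i h1
    have h2 := h.st_le (v + 1)
    unfold primeBit
    have h3 : c' (i - 1) = c (i - 1) := hc _ (by omega)
    by_cases h4 : i + 1 < st (v + 1)
    · simp only [hc i (by omega), hc (i + 1) (by omega), h3]
    · simp only [hc i (by omega), h3, h4, false_and, if_false]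
  refine ⟨h.mono, h.one, h.top, fun v hv => ?_, fun p x => ?_⟩
  · obtain ⟨q, hq⟩ := h.peak v hv
    have h2 := h.st_le (v + 1)
    have h3 := hq.lt_hi
    refine ⟨q, hq.lo_le, hq.lt_hi, fun i h4 h5 => ?_, fun i h4 h5 => ?_⟩
    · simp only [hc i (by omega), hc (i + 1) (by omega)]
      exact hq.inc i h4 h5
    · simp only [hc i (by omega), hc (i + 1) (by omega)]
      exact hq.dec i h4 h5
  · rw [h.entry]
    refine exists_congr fun i => and_congr_right fun h1 => and_congr_right fun h2 => ?_
    have h3 := h.st_le (x.val + 1)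
    rw [hc i (by omega), hbit x.val i h2]

theorem eq_of_listing {S' : Filling Letter} (h' : IsListing st f N c S') : S = S' :=
  Filling.ext fun p => Option.ext fun x => by rw [h.entry, h'.entry]

end IsListing

/-- A filling which is listed along a growth grid is a shifted tableau. -/
theorem IsListing.isSYT {st : ℕ → ℕ} {f : ℕ → Bool} {m n j : ℕ} {G : Grid m n}
    {S : Filling Letter} (h : IsListing st f m (fun i => G.c i j) S) (hj : j ≤ n)
    {lam mu : StrictPartition} (hmu : (mu.diagram : Set (ℕ × ℕ)) = G.K 0 j)
    (hlam : (lam.diagram : Set (ℕ × ℕ)) = G.K m j) : IsSYT lam mu S := by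
  have hsub : mu.diagram ⊆ lam.diagram := by
    rw [← Finset.coe_subset, hmu, hlam]
    exact G.K_mono (Nat.zero_le _) le_rfl le_rfl hj
  have hlt : ∀ {i i' : ℕ}, i < m → i' < m → (G.c i j).1 ≤ (G.c i' j).1 →
      (G.c i j).2 ≤ (G.c i' j).2 → i ≤ i' := by
    intro i i' h1 h2 h3 h4
    by_contra hcon
    have := G.c_lt (i := i') (i' := i) (by omega) h1 le_rfl hj
    omega
  have hwin : ∀ {x : Letter} {i : ℕ}, st x.val ≤ i → i < st (x.val + 1) → i < m ∧
      ∃ q, IsPeak (G.rowC j) (st x.val) (st (x.val + 1)) q := fun h1 h2 =>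
    ⟨h2.trans_le (h.st_le _), h.peak _ (by omega)⟩
  refine ⟨StrictPartition.contains_of_subset hsub, ?_, ?_, ?_, ?_, ?_⟩
  · ext p
    rw [h.mem_shape, Finset.mem_sdiff, ← Finset.mem_coe, ← Finset.mem_coe, hmu, hlam]
    constructor
    · rintro ⟨i, hi, rfl⟩
      exact ⟨G.c_mem hi le_rfl le_rfl hj, G.c_notMem hi (Nat.zero_le _) hj le_rfl⟩
    · rintro ⟨h1, h2⟩
      obtain ⟨s, -, h4, h5⟩ := G.exists_c (Nat.zero_le _) le_rfl hj h1 h2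
      exact ⟨s, h4, h5⟩
  · intro i j₁ j₂ x y hlt' hx hy
    obtain ⟨s, h1, h2, h3, h4⟩ := (h.entry _ _).mp hx
    obtain ⟨t, h5, h6, h7, h8⟩ := (h.entry _ _).mp hy
    obtain ⟨hs, q, hq⟩ := hwin h1 h2
    obtain ⟨ht, -⟩ := hwin h5 h6
    have h9 : s ≤ t := hlt hs ht (by simp [← h3, ← h7]) (by simp [← h3, ← h7, hlt'.le])
    rcases (h.window_le h1 h9 h6).lt_or_eq with h10 | h10
    · exact Or.inl h10
    · refine Or.inr ⟨h10, ?_⟩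
      -- An unprimed letter is at or past the peak, a primed one at or before it; in this order the
      -- two indices coincide.
      by_contra! hcon
      rw [← h10] at h5 h6 h8
      rw [ne_eq, ne_eq, Bool.not_eq_true, Bool.not_eq_false, h4, h8] at hcon
      have h11 := hq.ge_of_bit h1 hcon.1
      have h12 := hq.le_of_bit h6 hcon.2
      have h13 : s = t := by omega
      subst h13
      rw [← h7] at h3
      have := congrArg Prod.snd h3
      simp only at this
      omega
  · intro i₁ i₂ k x y hlt' hx hy
    obtain ⟨s, h1, h2, h3, h4⟩ := (h.entry _ _).mp hx
    obtain ⟨t, h5, h6, h7, h8⟩ := (h.entry _ _).mp hy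
    obtain ⟨hs, q, hq⟩ := hwin h1 h2
    obtain ⟨ht, -⟩ := hwin h5 h6
    have h9 : s ≤ t := hlt hs ht (by simp [← h3, ← h7, hlt'.le]) (by simp [← h3, ← h7])
    rcases (h.window_le h1 h9 h6).lt_or_eq with h10 | h10
    · exact Or.inl h10
    · refine Or.inr ⟨h10, Or.inl ?_⟩
      by_contra hcon
      rw [← h10] at h5 h6 h8
      rw [Bool.not_eq_true, h4] at hcon
      have h11 := hq.ge_of_bit h1 hcon
      -- From an unprimed letter on, columns increase strictly, so nothing of the same window
      -- follows in its column.
      rcases h9.lt_or_eq with h12 | rfl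
      · have := G.col_lt hj (h.st_le _) hq h11 h12 h6
        simp [← h3, ← h7] at this
      · rw [← h7] at h3
        have := congrArg Prod.fst h3
        simp only at this
        omega
  · intro i₁ i₂ k x hp hx hy
    obtain ⟨s, h1, h2, h3, h4⟩ := (h.entry _ _).mp hx
    obtain ⟨t, h5, h6, h7, h8⟩ := (h.entry _ _).mp hy
    obtain ⟨hs, q, hq⟩ := hwin h1 h2
    rw [hp] at h4 h8
    have h9 := hq.ge_of_bit h1 h4.symm
    have h10 := hq.ge_of_bit h5 h8.symm
    rcases lt_trichotomy s t with h11 | h11 | h11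
    · have := G.col_lt hj (h.st_le _) hq h9 h11 h6
      simp [← h3, ← h7] at this
    · subst h11
      rw [← h7] at h3
      exact congrArg Prod.fst h3
    · have := G.col_lt hj (h.st_le _) hq h10 h11 h2
      simp [← h3, ← h7] at this
  · intro k j₁ j₂ x hp hx hy
    obtain ⟨s, h1, h2, h3, h4⟩ := (h.entry _ _).mp hx
    obtain ⟨t, h5, h6, h7, h8⟩ := (h.entry _ _).mp hy
    obtain ⟨hs, q, hq⟩ := hwin h1 h2
    rw [hp] at h4 h8
    have h9 := hq.le_of_bit h2 h4.symm
    have h10 := hq.le_of_bit h6 h8.symm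
    rcases lt_trichotomy s t with h11 | h11 | h11
    · have := hq.lt h1 h11 h10
      simp [Grid.rowC, ← h3, ← h7] at this
    · subst h11
      rw [← h7] at h3
      exact congrArg Prod.snd h3
    · have := hq.lt h5 h11 h9
      simp [Grid.rowC, ← h3, ← h7] at this

/-! ## The listing of a tableau -/

theorem exists_sorted {α β : Type*} [LinearOrder β] [Inhabited α] (s : Finset α) (key : α → β)
    (hkey : ∀ p ∈ s, ∀ q ∈ s, key p = key q → p = q) :
    ∃ c : ℕ → α, (∀ i < s.card, c i ∈ s) ∧ (∀ p ∈ s, ∃ i < s.card, c i = p) ∧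
      ∀ i i', i < i' → i' < s.card → key (c i) < key (c i') := by
  classical
  have hcard : (s.image key).card = s.card :=
    Finset.card_image_of_injOn fun p hp q hq h => hkey p hp q hq h
  set e := (s.image key).orderEmbOfFin hcard with he
  have hex : ∀ i : Fin s.card, ∃ p ∈ s, key p = e i := fun i =>
    Finset.mem_image.mp (Finset.orderEmbOfFin_mem _ hcard i)
  choose g hg hg' using hex
  refine ⟨fun i => if h : i < s.card then g ⟨i, h⟩ else default, fun i hi => ?_, fun p hp => ?_,
    fun i i' h1 h2 => ?_⟩
  · simp only [hi, dif_pos, hg]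
  · have h1 : key p ∈ Set.range e := by
      rw [he, Finset.range_orderEmbOfFin]
      exact Finset.mem_coe.mpr (Finset.mem_image_of_mem _ hp)
    obtain ⟨i, hi⟩ := h1
    refine ⟨i, i.2, ?_⟩
    simp only [i.2, dif_pos]
    exact hkey _ (hg _) _ hp ((hg' _).trans hi)
  · simp only [h2, h1.trans h2, dif_pos, hg']
    exact e.strictMono h1

theorem exists_threshold (N : ℕ) (P : ℕ → Prop) (hP : ∀ i i', i ≤ i' → i' < N → P i' → P i) :
    ∃ t ≤ N, ∀ i < N, i < t ↔ P i := by
  classical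
  by_cases hex : ∃ t, t < N ∧ ¬ P t
  · refine ⟨Nat.find hex, (Nat.find_spec hex).1.le, fun i hi => ⟨fun h1 => ?_, fun h1 => ?_⟩⟩
    · by_contra hcon
      exact Nat.find_min hex h1 ⟨hi, hcon⟩
    · by_contra hcon
      exact (Nat.find_spec hex).2 (hP _ i (by omega) hi h1)
  · push Not at hex
    exact ⟨N, le_rfl, fun i hi => ⟨fun _ => hex i hi, fun _ => hi⟩⟩

/-- The key by which the boxes of a tableau are listed: first by letters, then from north to south
for primed and from west to east for unprimed letters. -/
def listKey (S : Filling Letter) (p : ℕ × ℕ) : ℕ ×ₗ ℕ :=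
  (S.entry p).elim (toLex (0, 0)) fun x =>
    toLex (if x.primed then (2 * x.val, p.1) else (2 * x.val + 1, p.2))

section key

variable {S : Filling Letter} {p q : ℕ × ℕ} {x y : Letter}

theorem listKey_lt_iff (hx : S.entry p = some x) (hy : S.entry q = some y) :
    listKey S p < listKey S q ↔ x.val < y.val ∨ x.val = y.val ∧
      (x.primed = true ∧ y.primed = false ∨ x.primed = true ∧ y.primed = true ∧ p.1 < q.1 ∨
        x.primed = false ∧ y.primed = false ∧ p.2 < q.2) := by
  unfold listKey
  rw [hx, hy, Option.elim_some, Option.elim_some, Prod.Lex.lt_iff]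
  cases x.primed <;> cases y.primed <;> simp <;> omega

theorem listKey_inj {lam mu : StrictPartition} (hS : IsSYT lam mu S) (hp : p ∈ S.shape)
    (hq : q ∈ S.shape) (h : listKey S p = listKey S q) : p = q := by
  rw [S.mem_shape, Option.isSome_iff_exists] at hp hq
  obtain ⟨x, hx⟩ := hp
  obtain ⟨y, hy⟩ := hq
  have h1 : ¬ listKey S p < listKey S q := by rw [h]; exact lt_irrefl _
  have h2 : ¬ listKey S q < listKey S p := by rw [h]; exact lt_irrefl _
  rw [listKey_lt_iff hx hy] at h1
  rw [listKey_lt_iff hy hx] at h2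
  have hv : x.val = y.val := by omega
  obtain ⟨p₁, p₂⟩ := p
  obtain ⟨q₁, q₂⟩ := q
  cases hxp : x.primed <;> cases hyp : y.primed <;> simp only [hxp, hyp, hv] at h1 h2
  · have hxy : x = y := Letter.ext hv (hxp.trans hyp.symm)
    subst hxy
    have h3 : p₂ = q₂ := by simp at h1 h2; omega
    subst h3
    rw [hS.col_unprimed _ _ _ _ hxp hx hy]
  · simp at h2
  · simp at h1
  · have hxy : x = y := Letter.ext hv (hxp.trans hyp.symm)
    subst hxy
    have h3 : p₁ = q₁ := by simp at h1 h2; omega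
    subst h3
    rw [hS.row_primed _ _ _ _ hxp hx hy]

theorem listKey_lt_row {lam mu : StrictPartition} (hS : IsSYT lam mu S) {i j k : ℕ} (hjk : j < k)
    (hp : (i, j) ∈ S.shape) (hq : (i, k) ∈ S.shape) : listKey S (i, j) < listKey S (i, k) := by
  rw [S.mem_shape, Option.isSome_iff_exists] at hp hq
  obtain ⟨x, hx⟩ := hp
  obtain ⟨y, hy⟩ := hq
  rw [listKey_lt_iff hx hy]
  rcases hS.row_weak i j k x y hjk hx hy with h1 | ⟨h1, h2⟩
  · exact Or.inl h1
  · refine Or.inr ⟨h1, ?_⟩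
    cases hxp : x.primed <;> cases hyp : y.primed
    · exact Or.inr (Or.inr ⟨rfl, rfl, hjk⟩)
    · simp [hxp, hyp] at h2
    · exact Or.inl ⟨rfl, rfl⟩
    · have hxy : x = y := Letter.ext h1 (hxp.trans hyp.symm)
      subst hxy
      exact absurd (hS.row_primed _ _ _ _ hxp hx hy) hjk.ne

theorem listKey_lt_col {lam mu : StrictPartition} (hS : IsSYT lam mu S) {i j k : ℕ} (hik : i < k)
    (hp : (i, j) ∈ S.shape) (hq : (k, j) ∈ S.shape) : listKey S (i, j) < listKey S (k, j) := by
  rw [S.mem_shape, Option.isSome_iff_exists] at hp hq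
  obtain ⟨x, hx⟩ := hp
  obtain ⟨y, hy⟩ := hq
  rw [listKey_lt_iff hx hy]
  rcases hS.col_weak i k j x y hik hx hy with h1 | ⟨h1, h2⟩
  · exact Or.inl h1
  · refine Or.inr ⟨h1, ?_⟩
    cases hxp : x.primed <;> cases hyp : y.primed
    · have hxy : x = y := Letter.ext h1 (hxp.trans hyp.symm)
      subst hxy
      exact absurd (hS.col_unprimed _ _ _ _ hxp hx hy) hik.ne
    · simp [hxp, hyp] at h2
    · exact Or.inl ⟨rfl, rfl⟩
    · exact Or.inr (Or.inl ⟨rfl, rfl, hik⟩)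

/-- The corner `(p₁, q₂)` belongs to the skew shape too, so one step along a row and one along a
column suffice. Consequently the listing adds boxes in an order compatible with the poset. -/
theorem listKey_lt_of_le {lam mu : StrictPartition} (hS : IsSYT lam mu S) (hp : p ∈ S.shape)
    (hq : q ∈ S.shape) (h1 : p.1 ≤ q.1) (h2 : p.2 ≤ q.2) (hne : p ≠ q) :
    listKey S p < listKey S q := by
  obtain ⟨p₁, p₂⟩ := p
  obtain ⟨q₁, q₂⟩ := q
  simp only at h1 h2
  have hr : (p₁, q₂) ∈ S.shape := by
    rw [hS.shape_eq, Finset.mem_sdiff] at hp hq ⊢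
    have h3 := (lam.isLower_diagram _ hp.1).1
    refine ⟨(lam.isLower_diagram _ hq.1).2 _ (by simp only at h3 ⊢; omega) h1 le_rfl, fun h4 => ?_⟩
    exact hp.2 ((mu.isLower_diagram _ h4).2 _ h3 le_rfl h2)
  rcases h1.lt_or_eq with h3 | rfl
  · rcases h2.lt_or_eq with h4 | rfl
    · exact (listKey_lt_row hS h4 hp hr).trans (listKey_lt_col hS h3 hr hq)
    · exact listKey_lt_col hS h3 hp hq
  · rcases h2.lt_or_eq with h4 | rfl
    · exact listKey_lt_row hS h4 hp hr
    · exact absurd rfl hne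

end key

theorem BoxChain.cases {K : Set (ℕ × ℕ)} {c : ℕ → ℕ × ℕ} {N i : ℕ} (hK : IsLower K)
    (h : BoxChain K c N) (hi : i + 1 < N) :
    ((c (i + 1)).1 ≤ (c i).1 ∧ (c i).2 < (c (i + 1)).2) ∨
    ((c i).1 < (c (i + 1)).1 ∧ (c (i + 1)).2 ≤ (c i).2) := by
  have h1 := h (i + 1) hi
  rw [grow_succ] at h1
  have h2 : IsLower (grow K c i) := BoxChain.lower hK (m := i) (fun j hj => h j (by omega)) i le_rfl
  have := (h i (by omega)).cases h2 h1
  omega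

/-- Primed letters come first and ascend, the unprimed ones descend weakly, so the whole window is a
hook. Away from the peak, the two conditions force the bit. -/
theorem exists_peak_and_bit {r : ℕ → ℕ} {bit : ℕ → Bool} {lo hi : ℕ}
    (h1 : ∀ i, lo ≤ i → i + 1 < hi → bit i = true → bit (i + 1) = true → r i < r (i + 1))
    (h2 : ∀ i, lo ≤ i → i + 1 < hi → bit i = false → bit (i + 1) = false ∧ r (i + 1) ≤ r i) :
    ∃ f, (lo < hi → ∃ q, IsPeak r lo hi q) ∧
      ∀ i, lo ≤ i → i < hi → bit i = primeBit r lo hi f i := by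
  by_cases hlt : lo < hi
  swap
  · exact ⟨true, fun h => absurd h hlt, fun i _ _ => by omega⟩
  have hmono : ∀ i i', lo ≤ i → i ≤ i' → i' < hi → bit i' = true → bit i = true := by
    intro i i' h3 h4
    induction i', h4 using Nat.le_induction with
    | base => exact fun _ h => h
    | succ k hk ih =>
      intro h5 h6
      refine ih (by omega) ?_
      by_contra hcon
      rw [(h2 k (by omega) h5 (by simpa using hcon)).1] at h6
      exact Bool.noConfusion h6
  have hpeak : ∃ q, IsPeak r lo hi q := by
    obtain ⟨t, ht, ht'⟩ := exists_threshold (hi - lo) (fun i => bit (lo + i) = true)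
      (fun i i' h3 h4 h5 => hmono _ _ (by omega) (by omega) (by omega) h5)
    have hbit : ∀ i, lo ≤ i → i < hi → (i < lo + t ↔ bit i = true) := by
      intro i h3 h4
      have := ht' (i - lo) (by omega)
      rw [show lo + (i - lo) = i by omega] at this
      rw [← this]
      omega
    rw [← hook_iff_isPeak hlt]
    have hpair1 : ∀ i i', lo ≤ i → i < i' → i' < lo + t → r i < r i' := by
      intro i i' h3 h4
      induction i', h4 using Nat.le_induction with
      | base =>
        exact fun h5 => h1 i h3 (by change i + 1 < lo + t at h5; omega)
          ((hbit i h3 (by omega)).mp (by omega))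
          ((hbit (i + 1) (by omega) (by change i + 1 < lo + t at h5; omega)).mp h5)
      | succ k hk ih =>
        exact fun h5 => (ih (by omega)).trans (h1 k (by omega) (by omega)
          ((hbit k (by omega) (by omega)).mp (by omega))
          ((hbit (k + 1) (by omega) (by omega)).mp h5))
    have hpair2 : ∀ i i', lo + t ≤ i → i ≤ i' → i' < hi → r i ≥ r i' := by
      intro i i' h3 h4
      induction i', h4 using Nat.le_induction with
      | base => exact fun _ => le_rfl
      | succ k hk ih =>
        intro h5
        refine (h2 k (by omega) h5 ?_).2.trans (ih (by omega))
        have := hbit k (by omega) (by omega)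
        rw [← Bool.not_eq_true, ← this]
        omega
    refine ⟨(List.Ico lo (lo + t)).map r, (List.Ico (lo + t) hi).map r, _, _, ?_,
      List.Sublist.refl _, List.Sublist.refl _, pairwise_ico_map hpair1,
      pairwise_ico_map fun i i' h3 h4 h5 => hpair2 i i' h3 h4.le h5, ?_⟩
    · rw [← List.map_append, List.Ico.append_consecutive (by omega) (by omega)]
    · simp only [List.length_map, List.Ico.length]
      omega
  refine ⟨?_, ?_, ?_⟩
  -- The free prime is the one at the peak.
  · exact bit hpeak.choose
  · exact fun _ => hpeak
  · have hq := hpeak.choose_spec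
    set q := hpeak.choose
    intro i h3 h4
    rcases lt_trichotomy i q with h5 | h5 | h5
    · rw [hq.bit_lt h3 h5]
      by_contra hcon
      have h6 := hq.lt_hi
      have h7 := hq.inc i h3 h5
      have h8 := (h2 i h3 (by omega) (by simpa using hcon)).2
      omega
    · rw [h5, hq.bit_eq]
    · rw [hq.bit_gt h5 h4]
      by_contra hcon
      have h6 := hq.lo_le
      have h7 := hq.dec (i - 1) (by omega) (by omega)
      have h8 := h1 (i - 1) (by omega) (by omega)
        (hmono (i - 1) i (by omega) (by omega) h4 (by simpa using hcon))
      rw [show i - 1 + 1 = i by omega] at h8 h7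
      have := h8 (by simpa using hcon)
      omega

/-- Every shifted tableau has a listing, along which its boxes can be added one by one. -/
theorem IsSYT.exists_listing {lam mu : StrictPartition} {S : Filling Letter}
    (hS : IsSYT lam mu S) : ∃ st f N c, IsListing st f N c S ∧
      BoxChain (mu.diagram : Set (ℕ × ℕ)) c N ∧
      grow (mu.diagram : Set (ℕ × ℕ)) c N = (lam.diagram : Set (ℕ × ℕ)) := by
  obtain ⟨c, hc1, hc2, hc3⟩ := exists_sorted S.shape (listKey S)
    fun p hp q hq => listKey_inj hS hp hq
  set N := S.shape.card
  have hent : ∀ i, ∃ x : Letter, i < N → S.entry (c i) = some x := by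
    intro i
    by_cases hi : i < N
    · have h1 := hc1 i hi
      rw [S.mem_shape, Option.isSome_iff_exists] at h1
      exact h1.imp fun x hx _ => hx
    -- An arbitrary letter for the indices outside the listing.
    · exact ⟨⟨1, one_pos, true⟩, fun h => absurd h hi⟩
  choose L hL using hent
  have hord : ∀ i i', i ≤ i' → i' < N → (L i).val ≤ (L i').val := by
    intro i i' h1 h2
    rcases h1.lt_or_eq with h1 | rfl
    · have h3 := (listKey_lt_iff (hL i (by omega)) (hL i' h2)).mp (hc3 i i' h1 h2)
      omega
    · exact le_rfl
  have hlt : ∀ i i', i < N → i' < N → listKey S (c i) < listKey S (c i') → i < i' := by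
    intro i i' h1 h2 h3
    by_contra hcon
    rcases (not_lt.mp hcon).lt_or_eq with h4 | rfl
    · exact lt_asymm h3 (hc3 i' i h4 h1)
    · exact lt_irrefl _ h3
  have hchain : BoxChain (mu.diagram : Set (ℕ × ℕ)) c N := by
    intro i hi
    have h1 := hc1 i hi
    rw [hS.shape_eq, Finset.mem_sdiff] at h1
    refine ⟨?_, (lam.isLower_diagram _ h1.1).1, fun q h2 h3 h4 hne => ?_⟩
    · rintro (h2 | ⟨k, hk, h2⟩)
      · exact h1.2 h2
      · have := hc3 k i hk hi
        rw [← h2] at this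
        exact lt_irrefl _ this
    · by_cases hq : q ∈ mu.diagram
      · exact Or.inl hq
      · have hq' : q ∈ S.shape := by
          rw [hS.shape_eq, Finset.mem_sdiff]
          exact ⟨(lam.isLower_diagram _ h1.1).2 q h2 h3 h4, hq⟩
        obtain ⟨k, hk, rfl⟩ := hc2 q hq'
        exact Or.inr ⟨k, hlt k i hk hi (listKey_lt_of_le hS hq' (hc1 i hi) h3 h4 hne), rfl⟩
  have hst : ∀ v, ∃ t ≤ N, ∀ i < N, i < t ↔ (L i).val < v := fun v =>
    exists_threshold N _ fun i i' h1 h2 h3 => (hord i i' h1 h2).trans_lt h3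
  choose st hst1 hst2 using hst
  have hwin : ∀ v i, st v ≤ i → i < st (v + 1) → i < N ∧ (L i).val = v := by
    intro v i h1 h2
    have h3 : i < N := h2.trans_le (hst1 _)
    have h4 := (hst2 (v + 1) i h3).mp h2
    have h5 := mt (hst2 v i h3).mpr (by omega)
    exact ⟨h3, by omega⟩
  have hbits : ∀ v, ∃ f, (st v < st (v + 1) →
      ∃ q, IsPeak (fun i => (c i).1) (st v) (st (v + 1)) q) ∧
      ∀ i, st v ≤ i → i < st (v + 1) →
        (L i).primed = primeBit (fun i => (c i).1) (st v) (st (v + 1)) f i := by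
    intro v
    refine exists_peak_and_bit (fun i h1 h2 h3 h4 => ?_) (fun i h1 h2 h3 => ?_)
    · obtain ⟨h5, h6⟩ := hwin v i h1 (by omega)
      obtain ⟨h7, h8⟩ := hwin v (i + 1) (by omega) h2
      have h9 := (listKey_lt_iff (hL i h5) (hL (i + 1) h7)).mp (hc3 i (i + 1) (by omega) h7)
      rw [h3, h4] at h9
      simp at h9
      omega
    · obtain ⟨h5, h6⟩ := hwin v i h1 (by omega)
      obtain ⟨h7, h8⟩ := hwin v (i + 1) (by omega) h2
      have h9 := (listKey_lt_iff (hL i h5) (hL (i + 1) h7)).mp (hc3 i (i + 1) (by omega) h7)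
      rw [h3] at h9
      have h10 := hchain.cases mu.isLower_diagram h7
      rcases h9 with h9 | ⟨-, h9 | h9 | ⟨-, h9, h11⟩⟩
      · omega
      · simp at h9
      · simp at h9
      · exact ⟨h9, by omega⟩
  choose f hf1 hf2 using hbits
  refine ⟨st, f, N, c, ⟨?_, ?_, ?_, hf1, ?_⟩, hchain, ?_⟩
  · refine monotone_nat_of_le_succ fun v => ?_
    by_contra hcon
    have h1 : st (v + 1) < N := by have := hst1 v; omega
    have h2 := (hst2 v _ h1).mp (by omega)
    have h3 := (hst2 (v + 1) _ h1).mpr (by omega)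
    omega
  · by_contra hcon
    have h1 : 0 < N := by have := hst1 1; omega
    have h2 := (hst2 1 0 h1).mp (by omega)
    have := (L 0).pos
    omega
  -- One more than the largest letter; for `N = 0` any bound will do.
  · refine ⟨(L (N - 1)).val + 1, fun v hv => ?_⟩
    by_contra hcon
    have h1 : N - 1 < N := by have := hst1 v; omega
    have h2 := (hst2 v (N - 1) h1).mpr (by omega)
    have := hst1 v
    omega
  · intro p x
    constructor
    · intro hx
      have hp : p ∈ S.shape := by rw [S.mem_shape, hx]; rfl
      obtain ⟨i, hi, rfl⟩ := hc2 p hp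
      have h1 : L i = x := Option.some.inj ((hL i hi).symm.trans hx)
      subst h1
      have h2 : st (L i).val ≤ i := by
        by_contra hcon
        have := (hst2 _ i hi).mp (not_le.mp hcon)
        omega
      have h3 : i < st ((L i).val + 1) := (hst2 _ i hi).mpr (Nat.lt_succ_self _)
      exact ⟨i, h2, h3, rfl, hf2 _ i h2 h3⟩
    · rintro ⟨i, h1, h2, rfl, h3⟩
      obtain ⟨h4, h5⟩ := hwin _ i h1 h2
      rw [hL i h4]
      exact congrArg some (Letter.ext h5 ((hf2 _ i h1 h2).trans h3.symm))
  · ext p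
    constructor
    · rintro (hp | ⟨k, hk, rfl⟩)
      · exact hS.contains.subset hp
      · have := hc1 k hk
        rw [hS.shape_eq, Finset.mem_sdiff] at this
        exact this.1
    · intro hp
      by_cases hq : p ∈ mu.diagram
      · exact Or.inl hq
      · obtain ⟨k, hk, rfl⟩ := hc2 p (by rw [hS.shape_eq, Finset.mem_sdiff]; exact ⟨hp, hq⟩)
        exact Or.inr ⟨k, hk, rfl⟩

/-! ## The whole switching process -/

theorem isPeak_shift {r : ℕ → ℕ} {lo hi q : ℕ} (h : IsPeak r lo hi q) :
    IsPeak (fun i => r (lo + i)) 0 (hi - lo) (q - lo) := by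
  have h1 := h.lo_le
  have h2 := h.lt_hi
  exact ⟨Nat.zero_le _, by omega, fun i _ h3 => h.inc (lo + i) (by omega) (by omega),
    fun i h3 h4 => h.dec (lo + i) (by omega) (by omega)⟩

theorem primeBit_shift (r : ℕ → ℕ) {lo hi i : ℕ} (f : Bool) :
    primeBit (fun i => r (lo + i)) 0 (hi - lo) f i = primeBit r lo hi f (lo + i) := by
  unfold primeBit
  have h1 : (i + 1 < hi - lo ∧ r (lo + i) < r (lo + (i + 1))) ↔
      (lo + i + 1 < hi ∧ r (lo + i) < r (lo + i + 1)) := by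
    rw [Nat.add_assoc]
    exact and_congr_left' (by omega)
  have h2 : (0 < i ∧ r (lo + i) ≤ r (lo + (i - 1))) ↔
      (lo < lo + i ∧ r (lo + i) ≤ r (lo + i - 1)) := by
    by_cases hi : i = 0
    · subst hi
      simp
    · rw [show lo + (i - 1) = lo + i - 1 by omega]
      exact and_congr_left' (by omega)
  simp only [h1, h2]

/-- The path of the switching process before the letters `a` of the first tableau pass the letters
`b` of the second one. -/
def switchPath (s t : ℕ → ℕ) (N a b i : ℕ) : ℕ :=
  if i < s a then 0 else if i < s (a + 1) then t b else N

section path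

variable {s t : ℕ → ℕ} {M N a b : ℕ}

theorem switchPath_mono (hs : Monotone s) (ht : t b ≤ N) {i i' : ℕ} (h : i ≤ i') :
    switchPath s t N a b i ≤ switchPath s t N a b i' := by
  have := hs (Nat.le_succ a)
  unfold switchPath
  split_ifs <;> omega

theorem switchPath_le (ht : t b ≤ N) (i : ℕ) : switchPath s t N a b i ≤ N := by
  unfold switchPath
  split_ifs <;> omega

theorem onB_switchPath_iff (hs : Monotone s) (hs' : s (a + 1) ≤ M) (_ : t b ≤ N) {i j : ℕ} :
    OnB M N (switchPath s t N a b) i j ↔ j < N ∧ i = if j < t b then s a else s (a + 1) := by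
  have h0 : s a ≤ s (a + 1) := hs (Nat.le_succ a)
  constructor
  · rintro ⟨h1, h2, h3, h4⟩
    refine ⟨h2, ?_⟩
    simp only [switchPath] at h3 h4
    split_ifs with hj
    · refine le_antisymm ?_ ?_
      · by_contra hcon
        have := h3 (s a) (not_le.mp hcon)
        split_ifs at this <;> omega
      · by_contra hcon
        have := h4 i le_rfl (by omega)
        rw [if_pos (not_le.mp hcon)] at this
        omega
    · refine le_antisymm ?_ ?_
      · by_contra hcon
        have := h3 (s (a + 1)) (not_le.mp hcon)
        split_ifs at this <;> omega
      · by_contra hcon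
        have := h4 i le_rfl (by omega)
        split_ifs at this <;> omega
  · rintro ⟨h1, h2⟩
    refine ⟨?_, h1, fun i' h3 => ?_, fun i' h3 h4 => ?_⟩
    · split_ifs at h2 <;> omega
    · unfold switchPath
      split_ifs at h2 ⊢ <;> omega
    · unfold switchPath
      split_ifs at h2 ⊢ <;> omega

end path

/-- The filling `E` shows the letters of two listed tableaux when each `aᵢ` has passed the first
`J i` boxes of the second tableau. -/
structure ShowsPath {M N : ℕ} (G : Grid M N) (s t : ℕ → ℕ) (f g : ℕ → Bool) (J : ℕ → ℕ)
    (E : ℕ × ℕ → Option (Letter ⊕ Letter)) : Prop where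
  A : ∀ v (hv : 0 < v) i, s v ≤ i → i < s (v + 1) → E (G.c i (J i)) =
    some (Sum.inl ⟨v, hv, primeBit (G.rowC (J i)) (s v) (s (v + 1)) (f v) i⟩)
  B : ∀ w (hw : 0 < w) i j, t w ≤ j → j < t (w + 1) → OnB M N J i j → E (G.d i j) =
    some (Sum.inr ⟨w, hw, primeBit (G.rowD i) (t w) (t (w + 1)) (g w) j⟩)
  frame : ∀ p, p ∈ G.K 0 0 ∨ p ∉ G.K M N → E p = none

/-! ### Tracing the whole process in the growth grid -/

section global

variable {M N : ℕ} {G : Grid M N} {s t : ℕ → ℕ} {f g : ℕ → Bool} {S T : Filling Letter}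
  (hS : IsListing s f M (fun i => G.c i 0) S) (hT : IsListing t g N (fun j => G.d M j) T)
include hS hT

theorem ShowsPath.cases {J : ℕ → ℕ} {E : ℕ × ℕ → Option (Letter ⊕ Letter)}
    (h : ShowsPath G s t f g J E) (hmono : ∀ i i', i ≤ i' → i' < M → J i ≤ J i')
    (hle : ∀ i < M, J i ≤ N) {p : ℕ × ℕ} {x : Letter ⊕ Letter} (hx : E p = some x) :
    (∃ v, ∃ hv : 0 < v, ∃ i, s v ≤ i ∧ i < s (v + 1) ∧ p = G.c i (J i) ∧
      x = Sum.inl ⟨v, hv, primeBit (G.rowC (J i)) (s v) (s (v + 1)) (f v) i⟩) ∨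
    ∃ w, ∃ hw : 0 < w, ∃ i j, t w ≤ j ∧ j < t (w + 1) ∧ OnB M N J i j ∧ p = G.d i j ∧
      x = Sum.inr ⟨w, hw, primeBit (G.rowD i) (t w) (t (w + 1)) (g w) j⟩ := by
  by_cases hp : p ∈ G.K 0 0 ∨ p ∉ G.K M N
  · rw [h.frame p hp] at hx
    exact absurd hx (by simp)
  · push Not at hp
    rcases G.cover hmono hle hp.2 hp.1 with ⟨i, hi, rfl⟩ | ⟨i, j, hB, rfl⟩
    · obtain ⟨v, hv, h1, h2⟩ := hS.exists_window hi
      rw [h.A v hv i h1 h2] at hx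
      exact Or.inl ⟨v, hv, i, h1, h2, rfl, (Option.some.inj hx).symm⟩
    · obtain ⟨w, hw, h1, h2⟩ := hT.exists_window hB.lt
      rw [h.B w hw i j h1 h2 hB] at hx
      exact Or.inr ⟨w, hw, i, j, h1, h2, hB, rfl, (Option.some.inj hx).symm⟩

omit hT in
theorem exists_peak_rowC {v j : ℕ} (hj : j ≤ N) (hv : s v < s (v + 1)) :
    ∃ q, IsPeak (G.rowC j) (s v) (s (v + 1)) q :=
  G.exists_peak hj hv (hS.st_le _) (hS.peak v hv)

omit hS in
theorem exists_peak_rowD {w i : ℕ} (hi : i ≤ M) (hw : t w < t (w + 1)) :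
    ∃ q, IsPeak (G.rowD i) (t w) (t (w + 1)) q := by
  have h1 := hT.peak w hw
  rw [← hook_iff_isPeak hw] at h1 ⊢
  -- `T` is listed along the far side `i = M`, so the hook is first carried to level `0` and then to
  -- level `i`.
  have h2 := (G.transpose.hook_rows (N := t (w + 1) - t w) le_rfl hw.le (hT.st_le _)).mp h1
  exact (G.transpose.hook_rows hi hw.le (hT.st_le _)).mpr h2

/-- The letters `a` of the first tableau pass the letters `b` of the second one. -/
theorem ShowsPath.switchProcess {a b : ℕ} (ha : 0 < a) (hb : 0 < b) {F : BiFilling}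
    (h : ShowsPath G s t f g (switchPath s t N a b) F.entry) :
    ShowsPath G s t f g (switchPath s t N a (b + 1)) (switchProcess a b F).entry := by
  have hs0 : s a ≤ s (a + 1) := hS.mono (Nat.le_succ a)
  have ht0 : t b ≤ t (b + 1) := hT.mono (Nat.le_succ b)
  have hsM := hS.st_le
  have htN := hT.st_le
  have hsM' := hS.st_le (a + 1)
  have htN' := hT.st_le (b + 1)
  have hmono : ∀ i i', i ≤ i' → i' < M → switchPath s t N a b i ≤ switchPath s t N a b i' :=
    fun i i' h1 _ => switchPath_mono hS.mono (htN b) h1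
  have hle : ∀ i < M, switchPath s t N a b i ≤ N := fun i _ => switchPath_le (htN b) i
  have hJ : ∀ {i}, s a ≤ i → i < s (a + 1) → switchPath s t N a b i = t b := fun h1 h2 => by
    rw [switchPath, if_neg (by omega), if_pos h2]
  have hJ' : ∀ {i}, s a ≤ i → i < s (a + 1) → switchPath s t N a (b + 1) i = t (b + 1) :=
    fun h1 h2 => by rw [switchPath, if_neg (by omega), if_pos h2]
  have hB : ∀ {i j}, t b ≤ j → j < N → i = s (a + 1) →
      OnB M N (switchPath s t N a b) i j := fun h1 h2 h3 =>
    (onB_switchPath_iff hS.mono hsM' (htN b)).mpr ⟨h2, by rw [if_neg (by omega)]; exact h3⟩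
  -- The windows of `a` and `b` cut out a rectangle of the grid; all other letters form its frame.
  let D : Strips (s (a + 1) - s a) (t (b + 1) - t b) :=
    { toGrid := G.sub (s a) (t b) (s (a + 1) - s a) (t (b + 1) - t b) (by omega) (by omega)
      a := a
      b := b
      ha := ha
      hb := hb
      fa := f a
      fb := g b
      peakA := fun h1 j hj => by
        obtain ⟨q, hq⟩ := exists_peak_rowC hS (j := t b + j) (by omega)
          (show s a < s (a + 1) by omega)
        exact ⟨_, isPeak_shift hq⟩
      peakB := fun h1 i hi => by
        obtain ⟨q, hq⟩ := exists_peak_rowD hT (i := s a + i) (by omega)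
          (show t b < t (b + 1) by omega)
        exact ⟨_, isPeak_shift hq⟩
      E₀ := F.entry
      outA := fun p x hp hx hxa => by
        rcases h.cases hS hT hmono hle hx with ⟨v, hv, i, h1, h2, rfl, h3⟩ | ⟨w, hw, i, j, -, -, -, -, h3⟩
        · have h4 : v = a := by rw [← hxa, Sum.inl.inj h3]
          subst h4
          rw [hJ h1 h2] at hp
          rcases hp with hp | hp
          · exact G.c_notMem (by omega) h1 (htN _) le_rfl hp
          · refine hp (G.c_mem ?_ ?_ ?_ ?_) <;> omega
        · exact absurd h3 (by simp)
      outB := fun p x hp hx hxb => by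
        rcases h.cases hS hT hmono hle hx with ⟨v, hv, i, -, -, -, h3⟩ | ⟨w, hw, i, j, h1, h2, hB', rfl, h3⟩
        · exact absurd h3 (by simp)
        · have h4 : w = b := by rw [← hxb, Sum.inr.inj h3]
          subst h4
          have h5 := ((onB_switchPath_iff hS.mono hsM' (htN w)).mp hB').2
          rw [if_neg (by omega)] at h5
          subst h5
          rcases hp with hp | hp
          · exact G.d_notMem hsM' hs0 (by omega) h1 hp
          · refine hp (G.d_mem ?_ ?_ ?_ ?_) <;> omega }
  have hDA : ∀ i j, D.letA i j =
      ⟨a, ha, primeBit (G.rowC (t b + j)) (s a) (s (a + 1)) (f a) (s a + i)⟩ := fun i j => by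
    rw [← primeBit_shift]
    rfl
  have hDB : ∀ i j, D.letB i j =
      ⟨b, hb, primeBit (G.rowD (s a + i)) (t b) (t (b + 1)) (g b) (t b + j)⟩ := fun i j => by
    rw [← primeBit_shift]
    rfl
  have hst : D.St (fun _ => 0) F.entry := by
    refine ⟨fun _ _ _ _ => le_rfl, fun _ _ => Nat.zero_le _, fun i hi => ?_, fun i j hij => ?_,
      fun _ _ => rfl⟩
    · have h1 := h.A a ha (s a + i) (by omega) (by omega)
      rw [hJ (by omega) (by omega)] at h1
      rw [hDA]
      exact h1
    · have h1 : i = s (a + 1) - s a := by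
        have h2 := hij.le
        by_contra hne
        have := hij.after i le_rfl (by omega)
        omega
      have h2 := hij.lt
      have h3 := h.B b hb (s a + i) (t b + j) (by omega) (by omega)
        (hB (by omega) (by omega) (by omega))
      rw [hDB]
      exact h3
  have hfin := hst.switchProcess
  have hframe : ∀ p, (p ∈ G.K (s a) (t b) ∨ p ∉ G.K (s (a + 1)) (t (b + 1))) →
      (ShiftedSwitching.switchProcess a b F).entry p = F.entry p := fun p hp => by
    refine hfin.frame p (hp.imp id fun h1 => ?_)
    change p ∉ G.K (s a + (s (a + 1) - s a)) (t b + (t (b + 1) - t b))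
    rwa [show s a + (s (a + 1) - s a) = s (a + 1) by omega,
      show t b + (t (b + 1) - t b) = t (b + 1) by omega]
  refine ⟨fun v hv i h1 h2 => ?_, fun w hw i j h1 h2 hij => ?_, fun p hp => ?_⟩
  · have hiM := h2.trans_le (hsM _)
    by_cases hva : s a ≤ i ∧ i < s (a + 1)
    · have h3 : v = a := hS.window_unique h1 h2 hva.1 hva.2
      subst h3
      have h4 := hfin.A (i - s v) (by omega)
      rw [hDA] at h4
      change _ = _ at h4
      rw [hJ' h1 h2]
      have h5 : D.c (i - s v) (t (b + 1) - t b) = G.c i (t (b + 1)) := by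
        change G.c (s v + (i - s v)) (t b + (t (b + 1) - t b)) = _
        rw [show s v + (i - s v) = i by omega, show t b + (t (b + 1) - t b) = t (b + 1) by omega]
      rw [h5, show s v + (i - s v) = i by omega,
        show t b + (t (b + 1) - t b) = t (b + 1) by omega] at h4
      exact h4
    · have h3 : switchPath s t N a (b + 1) i = switchPath s t N a b i := by
        unfold switchPath
        split_ifs <;> omega
      rw [h3, hframe, h.A v hv i h1 h2]
      by_cases h4 : i < s a
      · left
        rw [switchPath, if_pos h4]
        exact G.c_mem h4 (hsM a) (Nat.zero_le _) (htN b)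
      · right
        rw [switchPath, if_neg h4, if_neg (by omega)]
        exact G.c_notMem hiM (by omega) le_rfl (htN _)
  · obtain ⟨h3, h4⟩ := (onB_switchPath_iff hS.mono hsM' htN').mp hij
    by_cases hwb : t b ≤ j ∧ j < t (b + 1)
    · have h5 : w = b := hT.window_unique h1 h2 hwb.1 hwb.2
      subst h5
      rw [if_pos h2] at h4
      subst h4
      have h5 := hfin.B 0 (j - t w) ⟨Nat.zero_le _, by omega, fun i' h6 => by omega,
        fun i' h6 h7 => by omega⟩
      rw [hDB] at h5
      have h6 : D.d 0 (j - t w) = G.d (s a) j := by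
        change G.d (s a + 0) (t w + (j - t w)) = _
        rw [show t w + (j - t w) = j by omega, Nat.add_zero]
      rw [h6, show t w + (j - t w) = j by omega] at h5
      exact h5
    · have h5 : i = if j < t b then s a else s (a + 1) := by
        rw [h4]
        split_ifs <;> omega
      rw [hframe, h.B w hw i j h1 h2 ((onB_switchPath_iff hS.mono hsM' (htN b)).mpr ⟨h3, h5⟩)]
      by_cases h6 : j < t b
      · left
        rw [if_pos h6] at h5
        subst h5
        exact G.d_mem le_rfl (hsM _) h6 (htN _)
      · right
        rw [if_neg h6] at h5
        subst h5
        exact G.d_notMem hsM' le_rfl h3 (by omega)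
  · rw [hframe, h.frame p hp]
    refine hp.imp (fun h1 => ?_) (fun h1 h2 => ?_)
    · exact G.K_mono (Nat.zero_le _) (hsM _) (Nat.zero_le _) (htN _) h1
    · exact h1 (G.K_mono hsM' le_rfl htN' le_rfl h2)

omit hT in
theorem ShowsPath.congr {J J' : ℕ → ℕ} {E : ℕ × ℕ → Option (Letter ⊕ Letter)}
    (h : ShowsPath G s t f g J E) (hJ : ∀ i < M, J i = J' i) : ShowsPath G s t f g J' E := by
  refine ⟨fun v hv i h1 h2 => ?_, fun w hw i j h1 h2 hij => ?_, h.frame⟩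
  · rw [← hJ i (h2.trans_le (hS.st_le _))]
    exact h.A v hv i h1 h2
  · refine h.B w hw i j h1 h2 ⟨hij.le, hij.lt, fun i' h3 => ?_, fun i' h3 h4 => ?_⟩
    · rw [hJ i' (h3.trans_le hij.le)]
      exact hij.before i' h3
    · rw [hJ i' h4]
      exact hij.after i' h3 h4

theorem ShowsPath.switchRow {a : ℕ} (ha : 0 < a) {F : BiFilling}
    (h : ShowsPath G s t f g (switchPath s t N a 1) F.entry) (n : ℕ) :
    ShowsPath G s t f g (switchPath s t N a (n + 1)) (switchRow a n F).entry := by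
  unfold ShiftedSwitching.switchRow
  induction n with
  | zero => exact h
  | succ n ih =>
    rw [List.range_succ, List.foldl_append]
    exact ih.switchProcess hS hT ha (Nat.succ_pos n)

theorem ShowsPath.switchAll {n : ℕ} (hn : t (n + 1) = N) (m : ℕ) {F : BiFilling}
    (h : ShowsPath G s t f g (switchPath s t N m 1) F.entry) :
    ShowsPath G s t f g (fun _ => N) (switchAll m n F).entry := by
  unfold ShiftedSwitching.switchAll
  induction m generalizing F with
  | zero =>
    refine h.congr hS fun i hi => ?_
    have h1 := hS.mono (Nat.zero_le 1)
    rw [hS.one] at h1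
    rw [switchPath, if_neg (by omega), if_neg (by rw [hS.one]; omega)]
  | succ m ih =>
    rw [List.range_succ, List.reverse_append]
    -- Since `t (n + 1) = N` and `t 1 = 0`, the path after the last step for one letter is the path
    -- before the first step for the preceding letter.
    refine ih ((h.switchRow hS hT (Nat.succ_pos m) n).congr hS fun i hi => ?_)
    unfold switchPath
    rw [hn, hT.one]
    have := hS.mono (Nat.le_succ m)
    split_ifs <;> omega

theorem showsPath_union (hdisj : ∀ i < M, ∀ j < N, G.c i 0 ≠ G.d M j) (a : ℕ)
    (ha : s (a + 1) = M) :
    ShowsPath G s t f g (switchPath s t N a 1) (union S T).entry := by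
  have h0 : ∀ i < M, switchPath s t N a 1 i = 0 := fun i hi => by
    unfold switchPath
    rw [ha, hT.one]
    split_ifs <;> rfl
  have hSn : ∀ p, (∀ i < M, p ≠ G.c i 0) → S.entry p = none := fun p hp => by
    rw [Option.eq_none_iff_forall_ne_some]
    intro x hx
    have := hS.mem_shape.mp ((S.mem_shape p).mpr (by rw [hx]; rfl))
    obtain ⟨i, hi, h1⟩ := this
    exact hp i hi h1
  have hTn : ∀ p, (∀ j < N, p ≠ G.d M j) → T.entry p = none := fun p hp => by
    rw [Option.eq_none_iff_forall_ne_some]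
    intro x hx
    have := hT.mem_shape.mp ((T.mem_shape p).mpr (by rw [hx]; rfl))
    obtain ⟨i, hi, h1⟩ := this
    exact hp i hi h1
  refine ⟨fun v hv i h1 h2 => ?_, fun w hw i j h1 h2 hij => ?_, fun p hp => ?_⟩
  · have hi := h2.trans_le (hS.st_le _)
    rw [h0 i hi]
    simp only [union]
    rw [hS.entry_c hv h1 h2]
    rfl
  · have hj := h2.trans_le (hT.st_le _)
    have hi : i = M := by
      by_contra hne
      have h3 := hij.le
      have := hij.after i le_rfl (by omega)
      rw [h0 i (by omega)] at this
      omega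
    subst hi
    simp only [union]
    rw [hSn _ fun i' hi' h3 => hdisj i' hi' j hj h3.symm, hT.entry_c hw h1 h2]
    rfl
  · simp only [union]
    rw [hSn p ?_, hTn p ?_]
    · rfl
    · rintro j hj rfl
      rcases hp with hp | hp
      · exact G.d_notMem le_rfl (Nat.zero_le _) hj (Nat.zero_le _) hp
      · exact hp (G.d_mem le_rfl le_rfl hj le_rfl)
    · rintro i hi rfl
      rcases hp with hp | hp
      · exact G.c_notMem hi (Nat.zero_le _) (Nat.zero_le _) le_rfl hp
      · exact hp (G.c_mem hi le_rfl (Nat.zero_le _) le_rfl)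

/-- The switching of two tableaux listed along a growth grid. -/
theorem isListing_tableauSwitching :
    IsListing t g N (fun j => G.d 0 j) (tableauSwitching (S, T)).1 ∧
      IsListing s f M (fun i => G.c i N) (tableauSwitching (S, T)).2 := by
  have hfin : ShowsPath G s t f g (fun _ => N) (switched S T).entry := by
    refine (showsPath_union hS hT (fun i hi j hj h1 => ?_) (maxLetter S)
      (hS.st_of_maxLetter_lt (Nat.lt_succ_self _))).switchAll hS hT
      (hT.st_of_maxLetter_lt (Nat.lt_succ_self _)) (maxLetter S)
    have h2 := G.c_mem hi le_rfl (le_refl 0) (Nat.zero_le _)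
    rw [h1] at h2
    exact G.d_notMem le_rfl le_rfl hj (Nat.zero_le _) h2
  have hcases := fun {p x} => hfin.cases hS hT (fun _ _ _ _ => le_rfl) (fun _ _ => le_rfl)
    (p := p) (x := x)
  constructor
  · refine ⟨hT.mono, hT.one, hT.top, fun v hv => exists_peak_rowD hT (Nat.zero_le _) hv,
      fun p x => ?_⟩
    have h1 : (tableauSwitching (S, T)).1.entry p = some x ↔
        (switched S T).entry p = some (Sum.inr x) := by
      change ((switched S T).entry p).bind Sum.getRight? = some x ↔ _
      rw [Option.bind_eq_some_iff]
      simp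
    rw [h1]
    constructor
    · intro h2
      rcases hcases h2 with ⟨v, hv, i, -, -, -, h3⟩ | ⟨w, hw, i, j, h3, h4, h5, rfl, h6⟩
      · exact absurd h3 (by simp)
      · have h7 := Sum.inr.inj h6
        have hi : i = 0 := by
          by_contra hne
          have h8 := h5.before 0 (by omega)
          have := h5.lt
          omega
        subst hi h7
        exact ⟨j, h3, h4, rfl, rfl⟩
    · rintro ⟨j, h2, h3, rfl, h4⟩
      rw [hfin.B x.val x.pos 0 j h2 h3 ⟨Nat.zero_le _, h3.trans_le (hT.st_le _),
        fun i' h5 => by omega, fun i' _ _ => h3.trans_le (hT.st_le _)⟩]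
      exact congrArg (some ∘ Sum.inr) (Letter.ext rfl h4.symm)
  · refine ⟨hS.mono, hS.one, hS.top, fun v hv => exists_peak_rowC hS le_rfl hv, fun p x => ?_⟩
    have h1 : (tableauSwitching (S, T)).2.entry p = some x ↔
        (switched S T).entry p = some (Sum.inl x) := by
      change ((switched S T).entry p).bind Sum.getLeft? = some x ↔ _
      rw [Option.bind_eq_some_iff]
      simp
    rw [h1]
    constructor
    · intro h2
      rcases hcases h2 with ⟨v, hv, i, h3, h4, rfl, h5⟩ | ⟨w, hw, i, j, -, -, -, -, h3⟩
      · have h7 := Sum.inl.inj h5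
        subst h7
        exact ⟨i, h3, h4, rfl, rfl⟩
      · exact absurd h3 (by simp)
    · rintro ⟨i, h2, h3, rfl, h4⟩
      rw [hfin.A x.val x.pos i h2 h3]
      exact congrArg (some ∘ Sum.inl) (Letter.ext rfl h4.symm)

end global

/-- Tableau switching is an involution. -/
theorem tableauSwitching_tableauSwitching {M N : ℕ} {G : Grid M N} {s t : ℕ → ℕ} {f g : ℕ → Bool}
    {S T : Filling Letter} (hS : IsListing s f M (fun i => G.c i 0) S)
    (hT : IsListing t g N (fun j => G.d M j) T) :
    tableauSwitching (tableauSwitching (S, T)) = (S, T) := by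
  obtain ⟨h1, h2⟩ := isListing_tableauSwitching hS hT
  -- The result is listed along the initial sides of the transposed grid, whose final sides are the
  -- original ones, and a listing determines its filling.
  obtain ⟨h3, h4⟩ := isListing_tableauSwitching (G := G.transpose) h1 h2
  exact Prod.ext (h3.eq_of_listing hS) (h4.eq_of_listing hT)

/-! ## Hooks in two consecutive letters -/

/-- The inequalities of the lattice property for the letters `i` and `i + 1`, in terms of the lists
of the rows of the letters `i'`, `i`, `(i + 1)'` and `i + 1`. -/
structure RowLattice (l₁ l₂ l₃ l₄ : List ℕ) : Prop where
  primed : ∀ r ∈ l₃, l₄.countP (· ≤ r) < l₂.countP (· < r)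
  unprimed : ∀ s g t, l₄ = s ++ g :: t → t.length < l₂.countP (· < g)
  hat : ∀ r, r ∈ l₂ ∨ r ∈ l₃ → l₄.length + l₃.countP (r < ·) < l₂.length + l₁.countP (r ≤ ·)

theorem length_le_countP {u l : List ℕ} (h : u.Sublist l) {p : ℕ → Bool} (hp : ∀ x ∈ u, p x) :
    u.length ≤ l.countP p := by
  rw [← List.countP_eq_length.mpr hp]
  exact h.countP_le

theorem countP_add_countP_not {l : List ℕ} {p q : ℕ → Bool} (h : ∀ x, p x = !q x) :
    l.countP p + l.countP q = l.length := by
  have := List.length_eq_countP_add_countP q (l := l)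
  have h1 : l.countP p = l.countP (fun a => decide (¬ q a = true)) :=
    List.countP_congr fun x _ => by simp [h x]
  omega

theorem length_le_one {u : List ℕ} (h : u.Pairwise (· < ·)) (h' : u.Pairwise (· ≥ ·)) :
    u.length ≤ 1 := by
  match u with
  | [] => simp
  | [_] => simp
  | a :: b :: u =>
    have h1 := List.rel_of_pairwise_cons h (a' := b) (by simp)
    have h2 := List.rel_of_pairwise_cons h' (a' := b) (by simp)
    omega

section lattice

variable {l₁ l₂ l₃ l₄ : List ℕ}

section

variable (h : RowLattice l₁ l₂ l₃ l₄)
include h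

/-- If `r` is the first entry of the subword beyond `l₂`, those taken from `l₂` are at least `r`.
The lattice inequality at `r` says that the entries of `l₂` below `r` outnumber what follows `r`. -/
theorem RowLattice.length_dec_le (h₃ : l₃.Pairwise (· < ·)) {v₂ v₃ v₄ : List ℕ}
    (hv₂ : v₂.Sublist l₂) (hv₃ : v₃.Sublist l₃) (hv₄ : v₄.Sublist l₄)
    (hv : (v₂ ++ (v₃ ++ v₄)).Pairwise (· ≥ ·)) : v₂.length + v₃.length + v₄.length ≤ l₂.length := by
  rw [List.pairwise_append, List.pairwise_append] at hv
  obtain ⟨-, ⟨hv3, -, hv34⟩, hv234⟩ := hv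
  have key : ∀ r, (∀ x ∈ v₂, x ≥ r) → v₂.length + l₂.countP (· < r) ≤ l₂.length := fun r hr => by
    have h1 := length_le_countP (p := fun x => decide (r ≤ x)) hv₂ (by simpa using hr)
    have h2 := countP_add_countP_not (l := l₂) (p := fun x => decide (r ≤ x))
      (q := fun x => decide (x < r)) (fun x => by simp [← decide_not])
    omega
  cases v₃ with
  | nil =>
    cases v₄ with
    | nil => simpa using hv₂.length_le
    | cons g v₄ =>
      obtain ⟨s, t, h1, h2, h3⟩ := List.cons_sublist_iff.mp hv₄
      obtain ⟨s', t', rfl⟩ := List.append_of_mem h2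
      have h4 := h.unprimed s' g (t' ++ t) (by rw [h1]; simp)
      have h5 := key g fun x hx => hv234 x hx g (by simp)
      have h6 := h3.length_le
      simp only [List.length_cons, List.length_append, List.length_nil] at h4 ⊢
      omega
  | cons r v₃ =>
    have h1 := length_le_one (h₃.sublist hv₃) hv3
    have h2 := h.primed r (hv₃.subset (by simp))
    have h3 := key r fun x hx => hv234 x hx r (by simp)
    have h4 := length_le_countP (p := fun x => decide (x ≤ r)) hv₄
      (fun x hx => by simpa using hv34 r (by simp) x hx)
    omega

/-- The inequality `hat` at `r`, with the entries of `l₁` that are at least `r` being those missed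
by `u₁`. -/
theorem RowLattice.length_inc_le {u₁ u₃ u₄ : List ℕ} {r : ℕ} (hu₁ : u₁.Sublist l₁)
    (hu₁' : ∀ x ∈ u₁, x < r) (hr : r ∈ l₂ ∨ r ∈ l₃) (hu₃ : u₃.Sublist l₃) (hu₃' : ∀ x ∈ u₃, r < x)
    (hu₄ : u₄.Sublist l₄) : u₁.length + 1 + u₃.length + u₄.length ≤ l₁.length + l₂.length := by
  have h1 := length_le_countP (p := fun x => decide (x < r)) hu₁ (by simpa using hu₁')
  have h2 := countP_add_countP_not (l := l₁) (p := fun x => decide (r ≤ x))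
    (q := fun x => decide (x < r)) (fun x => by simp [← decide_not])
  have h3 := length_le_countP (p := fun x => decide (r < x)) hu₃ (by simpa using hu₃')
  have h4 := h.hat r hr
  have h5 := hu₄.length_le
  omega

/-- The cases are the lists in which the hook can turn. As `l₁`, `l₃` increase and `l₂`, `l₄`
decrease, one part of the hook uses at most one entry from a list of the wrong kind, and each case
comes down to one of the two estimates above. -/
theorem RowLattice.length_le {x₁ x₂ u v : List ℕ} (h₂ : l₂.Pairwise (· ≥ ·))
    (h₃ : l₃.Pairwise (· < ·)) (h₄ : l₄.Pairwise (· ≥ ·))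
    (hx : l₁ ++ (l₂ ++ (l₃ ++ l₄)) = x₁ ++ x₂) (hu : u.Sublist x₁) (hv : v.Sublist x₂)
    (hu' : u.Pairwise (· < ·)) (hv' : v.Pairwise (· ≥ ·)) :
    u.length + v.length ≤ l₁.length + l₂.length := by
  -- the part of `u` in `l₂` has at most one element, which can be moved to `v`
  have one : ∀ u₁ r v₃ v₄ : List ℕ, u₁.Sublist l₁ → r.Sublist l₂ → v₃.Sublist l₃ →
      v₄.Sublist l₄ → (u₁ ++ r).Pairwise (· < ·) → (v₃ ++ v₄).Pairwise (· ≥ ·) →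
      u₁.length + r.length + v₃.length + v₄.length ≤ l₁.length + l₂.length := by
    intro u₁ r v₃ v₄ h5 h6 h7 h8 h9 h10
    have h11 := h5.length_le
    have h12 := length_le_one ((List.pairwise_append.mp h9).2.1) (h₂.sublist h6)
    match r with
    | [] =>
      have := h.length_dec_le h₃ (List.nil_sublist _) h7 h8 (by simpa using h10)
      simp only [List.length_nil] at this ⊢
      omega
    | a :: b :: r => simp at h12
    | [r] =>
      have hur : ∀ x ∈ u₁, x < r := fun x hx => (List.pairwise_append.mp h9).2.2 x hx r (by simp)
      by_cases hc : ∀ y ∈ v₃, r < y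
      · have := h.length_inc_le h5 hur (Or.inl (h6.subset (by simp))) h7 hc h8
        simp only [List.length_cons, List.length_nil]
        omega
      · push Not at hc
        obtain ⟨y, hy, hyr⟩ := hc
        have h13 := length_le_one (h₃.sublist h7) ((List.pairwise_append.mp h10).1)
        obtain ⟨s, t, rfl⟩ := List.append_of_mem hy
        simp only [List.length_append, List.length_cons] at h13
        obtain rfl := List.eq_nil_of_length_eq_zero (show s.length = 0 by omega)
        obtain rfl := List.eq_nil_of_length_eq_zero (show t.length = 0 by omega)
        have := h.length_dec_le h₃ h6 h7 h8 (by
          simp only [List.nil_append, List.cons_append, List.pairwise_cons] at h10 ⊢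
          refine ⟨fun x hx => ?_, h10⟩
          rcases List.mem_cons.mp hx with rfl | hx
          · exact hyr
          · exact (h10.1 x hx).trans hyr)
        simp only [List.length_cons, List.length_nil, List.nil_append] at this ⊢
        omega
  rcases List.append_eq_append_iff.mp hx with ⟨y, rfl, hy⟩ | ⟨y, rfl, rfl⟩
  swap
  · obtain ⟨v₁, w, rfl, hv₁, hw⟩ := List.sublist_append_iff.mp hv
    obtain ⟨v₂, w, rfl, hv₂, hw⟩ := List.sublist_append_iff.mp hw
    obtain ⟨v₃, v₄, rfl, hv₃, hv₄⟩ := List.sublist_append_iff.mp hw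
    have h5 := h.length_dec_le h₃ hv₂ hv₃ hv₄ (List.pairwise_append.mp hv').2.1
    have h6 := hu.length_le
    have h7 := hv₁.length_le
    simp only [List.length_append]
    omega
  obtain ⟨u₁, w, rfl, hu₁, hw⟩ := List.sublist_append_iff.mp hu
  have hu₁l := hu₁.length_le
  rcases List.append_eq_append_iff.mp hy with ⟨z, rfl, hz⟩ | ⟨z, rfl, rfl⟩
  swap
  · obtain ⟨v₂, v', rfl, hv₂, hv''⟩ := List.sublist_append_iff.mp hv
    obtain ⟨v₃, v₄, rfl, hv₃, hv₄⟩ := List.sublist_append_iff.mp hv''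
    match v₂ with
    | [] =>
      have := one u₁ w v₃ v₄ hu₁ (hw.trans (List.sublist_append_left _ _)) hv₃ hv₄ hu'
        (by simpa using hv')
      simp only [List.length_append, List.length_nil] at this ⊢
      omega
    | a :: v₂ =>
      have h5 : (w ++ a :: v₂).Sublist (y ++ z) := hw.append hv₂
      have h6 := h.length_dec_le h₃ h5 hv₃ hv₄ (by
        rw [List.append_assoc, List.pairwise_append]
        have h7 := h₂.sublist h5
        rw [List.pairwise_append] at h7
        refine ⟨h7.1, hv', fun x hx b hb => ?_⟩
        have h8 := h7.2.2 x hx a (by simp)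
        rw [List.cons_append] at hv' hb
        rcases List.mem_cons.mp hb with rfl | hb
        · exact h8
        · exact (List.rel_of_pairwise_cons hv' hb).trans h8)
      simp only [List.length_append, List.length_cons] at h6 ⊢
      omega
  obtain ⟨u₂, w, rfl, hu₂, hw⟩ := List.sublist_append_iff.mp hw
  have hu12 : (u₁ ++ u₂).Pairwise (· < ·) := by
    rw [← List.append_assoc] at hu'
    exact (List.pairwise_append.mp hu').1
  have hu₂l := length_le_one ((List.pairwise_append.mp hu12).2.1) (h₂.sublist hu₂)
  rw [List.pairwise_append, List.pairwise_append] at hu'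
  obtain ⟨-, ⟨-, hw', h2w⟩, h12w⟩ := hu'
  rcases List.append_eq_append_iff.mp hz with ⟨z', rfl, rfl⟩ | ⟨z', rfl, rfl⟩
  · obtain ⟨u₃, u₄, rfl, hu₃, hu₄⟩ := List.sublist_append_iff.mp hw
    have h5 : (u₄ ++ v).Sublist (z' ++ x₂) := hu₄.append hv
    match u₂, u₃ with
    | [], [] =>
      have := h.length_dec_le h₃ (List.nil_sublist _) (List.nil_sublist _) h5
        (by simpa using h₄.sublist h5)
      simp only [List.length_append, List.length_nil] at this ⊢
      omega
    | [], r :: u₃ =>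
      have := h.length_inc_le (u₃ := u₃) hu₁ (fun x hx => h12w x hx r (by simp))
        (Or.inr (hu₃.subset (by simp))) ((List.sublist_cons_self _ _).trans hu₃)
        (fun x hx => List.rel_of_pairwise_cons ((List.pairwise_append.mp hw').1) hx) h5
      simp only [List.length_append, List.length_nil, List.length_cons] at this ⊢
      omega
    | a :: b :: u, _ => simp at hu₂l
    | [r], u₃ =>
      have := h.length_inc_le hu₁ (fun x hx => h12w x hx r (by simp))
        (Or.inl (hu₂.subset (by simp))) hu₃ (fun x hx => h2w r (by simp) x (by simp [hx])) h5
      simp only [List.length_append, List.length_nil, List.length_cons] at this ⊢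
      omega
  · obtain ⟨v₃, v₄, rfl, hv₃, hv₄⟩ := List.sublist_append_iff.mp hv
    have h5 : (w ++ v₃).Sublist (z ++ z') := hw.append hv₃
    have h6 := h₃.sublist h5
    match u₂, w with
    | u₂, [] =>
      have := one u₁ u₂ v₃ v₄ hu₁ hu₂ (hv₃.trans (List.sublist_append_right _ _)) hv₄ hu12 hv'
      simp only [List.length_append, List.length_nil] at this ⊢
      omega
    | [], r :: u₃ =>
      have := h.length_inc_le (u₃ := u₃ ++ v₃) hu₁ (fun x hx => h12w x hx r (by simp))
        (Or.inr (h5.subset (by simp))) ((List.sublist_cons_self _ _).trans h5)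
        (fun x hx => List.rel_of_pairwise_cons h6 hx) hv₄
      simp only [List.length_append, List.length_nil, List.length_cons] at this ⊢
      omega
    | a :: b :: u, _ => simp at hu₂l
    | [r], a :: u₃ =>
      have := h.length_inc_le (u₃ := a :: u₃ ++ v₃) hu₁ (fun x hx => h12w x hx r (by simp))
        (Or.inl (hu₂.subset (by simp))) h5 (fun x hx => by
          have h7 := h2w r (by simp) a (by simp)
          rcases List.mem_cons.mp hx with rfl | hx
          · exact h7
          · exact h7.trans (List.rel_of_pairwise_cons h6 hx)) hv₄
      simp only [List.length_append, List.length_nil, List.length_cons] at this ⊢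
      omega

end

/-- Each inequality is the bound for one test hook: all of `l₁` followed by a decreasing word
through the letter in question, or, for `hat`, an increasing word from `l₁` through `r` into `l₃`,
followed by all of `l₄`. -/
theorem rowLattice_of_hook (h₁ : l₁.Pairwise (· < ·)) (h₂ : l₂.Pairwise (· ≥ ·))
    (h₃ : l₃.Pairwise (· < ·)) (h₄ : l₄.Pairwise (· ≥ ·))
    (h : ∀ N, Hook (l₁ ++ (l₂ ++ (l₃ ++ l₄))) N → N ≤ l₁.length + l₂.length) :
    RowLattice l₁ l₂ l₃ l₄ := by
  have key : ∀ (l : List ℕ) (r : ℕ), (l.filter (r ≤ ·)).length + l.countP (· < r) = l.length :=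
    fun l r => by
      rw [← List.countP_eq_length_filter]
      exact countP_add_countP_not fun x => by simp [← decide_not]
  have key' : ∀ (l : List ℕ) (r : ℕ), l.countP (r ≤ ·) + (l.filter (· < r)).length = l.length :=
    fun l r => by
      rw [← List.countP_eq_length_filter]
      exact countP_add_countP_not fun x => by simp [← decide_not]
  refine ⟨fun r hr => ?_, fun s g t ht => ?_, fun r hr => ?_⟩
  · have h5 := h _ ⟨l₁, _, l₁, l₂.filter (r ≤ ·) ++ ([r] ++ l₄.filter (· ≤ r)), rfl,
      List.Sublist.refl _, List.filter_sublist.append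
        ((List.singleton_sublist.mpr hr).append List.filter_sublist), h₁, ?_, le_rfl⟩
    · have h6 := key l₂ r
      simp only [List.length_append, List.length_cons, List.length_nil,
        ← List.countP_eq_length_filter] at h5 h6
      omega
    · rw [List.pairwise_append, List.pairwise_append]
      refine ⟨h₂.filter _, ⟨by simp, h₄.filter _, by simp⟩, ?_⟩
      intro a ha b hb
      simp at ha hb
      omega
  · subst ht
    have h5 := h _ ⟨l₁, _, l₁, l₂.filter (g ≤ ·) ++ ([] ++ (g :: t)), rfl,
      List.Sublist.refl _, List.filter_sublist.append
        ((List.nil_sublist _).append (List.sublist_append_right _ _)), h₁, ?_, le_rfl⟩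
    · have h6 := key l₂ g
      simp only [List.length_append, List.length_cons, List.length_nil] at h5 h6
      omega
    · rw [List.nil_append, List.pairwise_append]
      have h6 := (List.pairwise_append.mp h₄).2.1
      refine ⟨h₂.filter _, h6, ?_⟩
      intro a ha b hb
      simp only [List.mem_filter, decide_eq_true_eq] at ha
      rcases List.mem_cons.mp hb with rfl | hb
      · exact ha.2
      · exact (List.rel_of_pairwise_cons h6 hb).trans ha.2
  · have h5 : ∃ z : List ℕ, z.Sublist (l₂ ++ l₃) ∧ z.Pairwise (· < ·) ∧ (∀ x ∈ z, r ≤ x) ∧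
        z.length = 1 + l₃.countP (r < ·) := by
      rcases hr with hr | hr
      · refine ⟨[r] ++ l₃.filter (r < ·), (List.singleton_sublist.mpr hr).append List.filter_sublist,
          ?_, ?_, ?_⟩
        · rw [List.pairwise_append]
          exact ⟨by simp, h₃.filter _, by simp⟩
        · intro x hx
          simp at hx
          omega
        · rw [List.countP_eq_length_filter]
          simp [Nat.add_comm]
      · obtain ⟨s, t, rfl⟩ := List.append_of_mem hr
        have h6 := List.pairwise_append.mp h₃
        refine ⟨r :: t, (List.sublist_append_right s _).trans (List.sublist_append_right _ _), h6.2.1,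
          fun x hx => ?_, ?_⟩
        · rcases List.mem_cons.mp hx with rfl | hx
          · exact le_rfl
          · exact (List.rel_of_pairwise_cons h6.2.1 hx).le
        · have h7 : s.countP (r < ·) = 0 := by
            rw [List.countP_eq_zero]
            intro x hx
            have := h6.2.2 x hx r (by simp)
            simp
            omega
          have h8 : t.countP (r < ·) = t.length := by
            rw [List.countP_eq_length]
            intro x hx
            simpa using List.rel_of_pairwise_cons h6.2.1 hx
          rw [List.countP_append, List.countP_cons, h7, h8]
          simp [Nat.add_comm]
    obtain ⟨z, hz, hz', hz'', hzl⟩ := h5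
    have h6 := h _ ⟨l₁ ++ (l₂ ++ l₃), l₄, l₁.filter (· < r) ++ z, l₄, by simp,
      List.filter_sublist.append hz, List.Sublist.refl _, ?_, h₄, le_rfl⟩
    · have h7 := key' l₁ r
      simp only [List.length_append] at h6
      omega
    · rw [List.pairwise_append]
      refine ⟨h₁.filter _, hz', fun a ha b hb => ?_⟩
      have := hz'' b hb
      simp at ha
      omega

theorem rowLattice_iff_hook (h₁ : l₁.Pairwise (· < ·)) (h₂ : l₂.Pairwise (· ≥ ·))
    (h₃ : l₃.Pairwise (· < ·)) (h₄ : l₄.Pairwise (· ≥ ·)) : RowLattice l₁ l₂ l₃ l₄ ↔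
      ∀ N, Hook (l₁ ++ (l₂ ++ (l₃ ++ l₄))) N → N ≤ l₁.length + l₂.length := by
  refine ⟨?_, rowLattice_of_hook h₁ h₂ h₃ h₄⟩
  rintro h N ⟨x₁, x₂, u, v, hx, hu, hv, hu', hv', hN⟩
  exact hN.trans (h.length_le h₂ h₃ h₄ hx hu hv hu' hv')

end lattice

/-! ## The lattice property in terms of splittings of the word -/

/-- The number of letters `k` (for `b = false`) or `k'` (for `b = true`) in a word. -/
def letterCount (k : ℕ) (b : Bool) (w : List Letter) : ℕ :=
  w.countP (fun x => x.val = k ∧ x.primed = b)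

theorem letterCount_append (k : ℕ) (b : Bool) (w w' : List Letter) :
    letterCount k b (w ++ w') = letterCount k b w + letterCount k b w' :=
  List.countP_append

/-- The letter by which a letter is replaced in the second half of `w ŵ`. -/
def hatLetter (x : Letter) : Letter :=
  if x.primed = true then x.erasePrime else ⟨x.val + 1, Nat.succ_pos _, true⟩

theorem hatWord_eq (w : List Letter) : hatWord w = w.reverse.map hatLetter := rfl

theorem letterCount_hatWord (k : ℕ) (w : List Letter) :
    letterCount k false (hatWord w) = letterCount k true w := by
  rw [hatWord_eq, letterCount, List.countP_map, List.countP_reverse]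
  refine List.countP_congr fun x _ => ?_
  cases h : x.primed <;> simp [hatLetter, h, Letter.erasePrime]

/-- The multiplicity of `i + 1` starts equal to that of `i` and increases in steps of one; being
blocked at equality, it never exceeds that of `i`. So to differ means to be smaller. -/
theorem isLatticeWord_iff_lt (w : List Letter) : IsLatticeWord w ↔
    ∀ i j x, 1 ≤ i → (w ++ hatWord w)[j]? = some x → x.val = i + 1 →
      mult w (i + 1) j < mult w i j := by
  constructor
  · intro h i j x hi
    have hle : ∀ j, mult w (i + 1) j ≤ mult w i j := by
      intro j
      induction j with
      | zero => simp [mult]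
      | succ j ih =>
        unfold mult at ih ⊢
        rw [List.take_add_one, List.countP_append, List.countP_append]
        cases hx : (w ++ hatWord w)[j]? with
        | none => simpa using ih
        | some x =>
          have h1 := h i j x hi hx
          simp only [mult] at h1
          simp only [Option.toList_some, List.countP_singleton]
          by_cases h2 : x.val = i + 1
          · have h3 : (List.take j (w ++ hatWord w)).countP
                (fun x => decide (x.val = i + 1 ∧ x.primed = false)) ≠ _ := fun h3 => h1 h3 h2
            split_ifs <;> omega
          · rw [if_neg (by simp [h2])]
            split_ifs <;> omega
    intro hx hv
    refine lt_of_le_of_ne (hle j) fun h1 => h i j x hi hx h1 hv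
  · intro h i j x hi hx h1 h2
    have := h i j x hi hx h2
    omega

/-- A position in the second half of `w ŵ` corresponds to a letter `x` of `w`. The part of `ŵ`
before it comes from the letters after `x`, and its unprimed letters come from the primed ones
there. -/
theorem isLatticeWord_iff (w : List Letter) : IsLatticeWord w ↔
    (∀ i, 1 ≤ i → ∀ pre x post, w = pre ++ x :: post → x.val = i + 1 →
      letterCount (i + 1) false pre < letterCount i false pre) ∧
    (∀ i, 1 ≤ i → ∀ pre x post, w = pre ++ x :: post →
      (x.val = i ∧ x.primed = false ∨ x.val = i + 1 ∧ x.primed = true) →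
      letterCount (i + 1) false w + letterCount (i + 1) true post <
        letterCount i false w + letterCount i true post) := by
  rw [isLatticeWord_iff_lt]
  have hval : ∀ (i : ℕ) (x : Letter), (hatLetter x).val = i + 1 ↔
      (x.val = i ∧ x.primed = false ∨ x.val = i + 1 ∧ x.primed = true) := fun i x => by
    cases h : x.primed <;> simp [hatLetter, h, Letter.erasePrime]
  constructor
  · intro h
    refine ⟨fun i hi pre x post hw hx => ?_, fun i hi pre x post hw hx => ?_⟩
    · have h1 := h i pre.length x hi (by rw [hw]; simp) hx
      have h2 : (w ++ hatWord w).take pre.length = pre := by rw [hw]; simp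
      simp only [mult, h2] at h1
      exact h1
    · have h0 : w ++ hatWord w = (w ++ hatWord post) ++ hatLetter x :: hatWord pre := by
        conv_lhs => rw [hw]
        rw [hw]
        simp [hatWord_eq]
      have h1 := h i (w ++ hatWord post).length (hatLetter x) hi
        (by rw [h0, List.getElem?_append_right le_rfl]; simp) ((hval i x).mpr hx)
      have h2 : (w ++ hatWord w).take (w ++ hatWord post).length = w ++ hatWord post := by
        rw [h0]; exact List.take_left
      simp only [mult, h2] at h1
      have h3 := fun k => letterCount_append k false w (hatWord post)
      simp only [letterCount_hatWord] at h3
      rw [← h3, ← h3]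
      exact h1
  · rintro ⟨h1, h2⟩ i j x hi hx hv
    obtain ⟨hj, hx'⟩ := List.getElem?_eq_some_iff.mp hx
    have hsplit : w ++ hatWord w = (w ++ hatWord w).take j ++ x :: (w ++ hatWord w).drop (j + 1) := by
      rw [← hx', List.cons_getElem_drop_succ, List.take_append_drop]
    change letterCount (i + 1) false ((w ++ hatWord w).take j) <
      letterCount i false ((w ++ hatWord w).take j)
    rcases List.append_eq_append_iff.mp hsplit with ⟨y, h3, h4⟩ | ⟨y, h3, h4⟩
    · rw [hatWord_eq, List.map_eq_append_iff] at h4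
      obtain ⟨a, b, h5, h6, h7⟩ := h4
      rw [List.map_eq_cons_iff] at h7
      obtain ⟨z, b', h8, h9, -⟩ := h7
      have h10 : w = b'.reverse ++ z :: a.reverse := by
        rw [← List.reverse_reverse w, h5, h8]
        simp
      have h11 := h2 i hi _ z _ h10 ((hval i z).mp (by rw [h9]; exact hv))
      have h12 : y = hatWord a.reverse := by rw [hatWord_eq, List.reverse_reverse, h6]
      rw [h3, h12, letterCount_append, letterCount_append, letterCount_hatWord,
        letterCount_hatWord]
      exact h11
    · cases y with
      -- The boundary case: the letter considered is the first of `ŵ`.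
      | nil =>
        rw [List.nil_append] at h4
        rw [List.append_nil] at h3
        rw [hatWord_eq, eq_comm, List.map_eq_cons_iff] at h4
        obtain ⟨z, b', h8, h9, -⟩ := h4
        have h10 : w = b'.reverse ++ z :: [] := by
          rw [← List.reverse_reverse w, h8]
          simp
        have h11 := h2 i hi _ z _ h10 ((hval i z).mp (by rw [h9]; exact hv))
        rw [← h3]
        simpa [letterCount] using h11
      | cons z y =>
        rw [List.cons_append, List.cons.injEq] at h4
        obtain ⟨rfl, -⟩ := h4
        exact h1 i hi _ _ _ h3 hv

/-! ## The reading order -/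

/-- The box `p` is read before the box `q`. -/
def Reads (p q : ℕ × ℕ) : Prop := p.1 < q.1 ∨ p.1 = q.1 ∧ q.2 < p.2

/-- A list of boxes in reading order, possibly with empty ones, lets a splitting of the word be
lifted to a splitting at a box. -/
theorem exists_reading (T : Filling Letter) : ∃ B : List (ℕ × ℕ), B.Pairwise Reads ∧
    (∀ p ∈ T.shape, p ∈ B) ∧ word T = B.filterMap T.entry := by
  refine ⟨(List.range (T.shape.sup (fun p => p.1 + 1))).flatMap (fun i =>
    (List.range (T.shape.sup (fun p => p.2 + 1))).reverse.map (fun j => (i, j))), ?_, ?_, ?_⟩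
  · rw [List.pairwise_flatMap]
    refine ⟨fun i _ => ?_, List.pairwise_lt_range.imp fun {i i'} hlt p hp q hq => ?_⟩
    · rw [List.pairwise_map, List.pairwise_reverse]
      exact List.pairwise_lt_range.imp fun h => Or.inr ⟨rfl, h⟩
    · obtain ⟨j, -, rfl⟩ := List.mem_map.mp hp
      obtain ⟨j', -, rfl⟩ := List.mem_map.mp hq
      exact Or.inl hlt
  · intro p hp
    rw [List.mem_flatMap]
    refine ⟨p.1, List.mem_range.mpr ?_, List.mem_map.mpr ⟨p.2, ?_, rfl⟩⟩
    · exact Finset.le_sup (f := fun p : ℕ × ℕ => p.1 + 1) hp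
    · rw [List.mem_reverse, List.mem_range]
      exact Finset.le_sup (f := fun p : ℕ × ℕ => p.2 + 1) hp
  · rw [List.filterMap_flatMap]
    simp only [List.filterMap_map]
    rfl

theorem Reads.irrefl (p : ℕ × ℕ) : ¬ Reads p p := by
  unfold Reads
  omega

theorem Reads.asymm {p q : ℕ × ℕ} (h : Reads p q) : ¬ Reads q p := by
  unfold Reads at h ⊢
  omega

theorem mem_left_iff_reads {pre post : List (ℕ × ℕ)} {p q : ℕ × ℕ}
    (hB : (pre ++ p :: post).Pairwise Reads) (hq : q ∈ pre ++ p :: post) :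
    q ∈ pre ↔ Reads q p := by
  obtain ⟨-, h1, h2⟩ := List.pairwise_append.mp hB
  refine ⟨fun h => h2 q h p (by simp), fun h => ?_⟩
  rcases List.mem_append.mp hq with h3 | h3
  · exact h3
  · rcases List.mem_cons.mp h3 with rfl | h3
    · exact absurd h (Reads.irrefl _)
    · exact absurd h (List.rel_of_pairwise_cons h1 h3).asymm

theorem mem_right_iff_reads {pre post : List (ℕ × ℕ)} {p q : ℕ × ℕ}
    (hB : (pre ++ p :: post).Pairwise Reads) (hq : q ∈ pre ++ p :: post) :
    q ∈ post ↔ Reads p q := by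
  obtain ⟨-, h1, h2⟩ := List.pairwise_append.mp hB
  refine ⟨fun h => List.rel_of_pairwise_cons h1 h, fun h => ?_⟩
  rcases List.mem_append.mp hq with h3 | h3
  · exact absurd h (h2 q h3 p (by simp)).asymm
  · rcases List.mem_cons.mp h3 with rfl | h3
    · exact absurd h (Reads.irrefl _)
    · exact h3

theorem nodup_of_reads {B : List (ℕ × ℕ)} (h : B.Pairwise Reads) : B.Nodup :=
  List.Pairwise.imp (S := fun p q => p ≠ q)
    (fun {p q} h1 h2 => Reads.irrefl q (by rwa [h2] at h1)) h

theorem filterMap_eq_append_cons_iff {α β : Type*} {e : α → Option β} {B : List α} {pre post : List β}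
    {x : β} : B.filterMap e = pre ++ x :: post ↔ ∃ B₁ p B₂, B = B₁ ++ p :: B₂ ∧ e p = some x ∧
      B₁.filterMap e = pre ∧ B₂.filterMap e = post := by
  constructor
  · intro h
    obtain ⟨l₁, l₂, rfl, h1, h2⟩ := List.filterMap_eq_append_iff.mp h
    obtain ⟨l₃, a, l₄, rfl, h3, h4, h5⟩ := List.filterMap_eq_cons_iff.mp h2
    refine ⟨l₁ ++ l₃, a, l₄, by simp, h4, ?_, h5⟩
    rw [List.filterMap_append, h1, List.filterMap_eq_nil_iff.mpr h3, List.append_nil]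
  · rintro ⟨B₁, p, B₂, rfl, h1, rfl, rfl⟩
    rw [List.filterMap_append, List.filterMap_cons_some h1]

theorem countP_filterMap_entry {T : Filling Letter} {pre : List (ℕ × ℕ)} (hpre : pre.Nodup)
    {P : Letter → Bool} {c : ℕ → ℕ × ℕ} {a b : ℕ}
    (hinj : ∀ i i', a ≤ i → i < b → a ≤ i' → i' < b → c i = c i' → i = i')
    (hP : ∀ p x, T.entry p = some x → P x = true → ∃ i, a ≤ i ∧ i < b ∧ p = c i)
    (hP' : ∀ i, a ≤ i → i < b → ∃ x, T.entry (c i) = some x ∧ P x = true) :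
    (pre.filterMap T.entry).countP P = (List.Ico a b).countP (fun i => c i ∈ pre) := by
  rw [List.countP_filterMap, List.countP_eq_length_filter, List.countP_eq_length_filter,
    ← List.length_map (f := c) (as := (List.Ico a b).filter _)]
  refine List.Perm.length_eq ((List.perm_ext_iff_of_nodup (hpre.filter _) ?_).mpr fun p => ?_)
  · rw [List.nodup_map_iff_inj_on ((List.Ico.nodup a b).filter _)]
    intro i hi i' hi' h
    simp only [List.mem_filter, List.Ico.mem] at hi hi'
    exact hinj i i' hi.1.1 hi.1.2 hi'.1.1 hi'.1.2 h
  · simp only [List.mem_filter, List.mem_map, List.Ico.mem, decide_eq_true_eq]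
    constructor
    · rintro ⟨h1, h2⟩
      cases hx : T.entry p with
      | none => simp [hx] at h2
      | some x =>
        obtain ⟨i, h3, h4, rfl⟩ := hP p x hx (by simpa [hx] using h2)
        exact ⟨i, ⟨⟨h3, h4⟩, h1⟩, rfl⟩
    · rintro ⟨i, ⟨⟨h1, h2⟩, h3⟩, rfl⟩
      obtain ⟨x, hx, hx'⟩ := hP' i h1 h2
      exact ⟨h3, by simpa [hx] using hx'⟩

/-! ## Littlewood–Richardson–Stembridge tableaux in terms of listings -/

/-- The peak of the window `[lo, hi)`, or `lo` if this window is empty. -/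
structure IsTurn (r : ℕ → ℕ) (lo hi t : ℕ) : Prop where
  le : lo ≤ t
  le' : t ≤ hi
  peak : lo < hi → IsPeak r lo hi t

namespace IsTurn

variable {r : ℕ → ℕ} {lo hi t : ℕ} (h : IsTurn r lo hi t)
include h

theorem lt {i i' : ℕ} (h1 : lo ≤ i) (h2 : i < i') (h3 : i' < t) : r i < r i' :=
  (h.peak (by have := h.le'; omega)).lt h1 h2 h3.le

theorem ge {i i' : ℕ} (h1 : t ≤ i) (h2 : i ≤ i') (h3 : i' < hi) : r i' ≤ r i :=
  (h.peak (by have := h.le; omega)).ge h1 h2 h3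

theorem bit {i : ℕ} (h1 : lo ≤ i) (h2 : i < hi) : primeBit r lo hi false i = decide (i < t) := by
  have hp := h.peak (by omega)
  rcases lt_trichotomy i t with h3 | rfl | h3
  · rw [hp.bit_lt h1 h3, decide_eq_true h3]
  · simp [hp.bit_eq]
  · rw [hp.bit_gt h3 h2, decide_eq_false (by omega)]

theorem pairwise_lt : ((List.Ico lo t).map r).Pairwise (· < ·) :=
  pairwise_ico_map fun _ _ h1 h2 h3 => h.lt h1 h2 h3

theorem pairwise_ge : ((List.Ico t hi).map r).Pairwise (· ≥ ·) :=
  pairwise_ico_map fun _ _ h1 h2 h3 => h.ge h1 h2.le h3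

end IsTurn

theorem Grid.reads_iff {m n : ℕ} (G : Grid m n) {i i' j : ℕ} (hi : i < m) (hi' : i' < m)
    (hj : j ≤ n) : Reads (G.c i j) (G.c i' j) ↔
      G.rowC j i < G.rowC j i' ∨ G.rowC j i = G.rowC j i' ∧ i' < i := by
  unfold Reads Grid.rowC
  refine or_congr_right (and_congr_right fun h => ?_)
  rcases lt_trichotomy i i' with h1 | rfl | h1
  · have := G.c_lt h1 hi' le_rfl hj
    omega
  · simp
  · have := G.c_lt h1 hi le_rfl hj
    omega

section lattice

variable {st t : ℕ → ℕ} {f : ℕ → Bool} {m n j : ℕ} {G : Grid m n} {T : Filling Letter}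
  (h : IsListing st f m (fun i => G.c i j) T) (hj : j ≤ n)
  (ht : ∀ v, 0 < v → IsTurn (G.rowC j) (st v) (st (v + 1)) (t v))
  (hf : ∀ v, 0 < v → st v < st (v + 1) → f v = false)
include h hj ht hf

omit hj in
-- With the free primes absent, the peak is the first unprimed letter, so the turn separates primed
-- from unprimed letters.
theorem entry_iff_of_flag {p : ℕ × ℕ} {x : Letter} : T.entry p = some x ↔
    ∃ i, st x.val ≤ i ∧ i < st (x.val + 1) ∧ p = G.c i j ∧ x.primed = decide (i < t x.val) := by
  rw [h.entry]
  refine exists_congr fun i => and_congr_right fun h1 => and_congr_right fun h2 =>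
    and_congr_right fun _ => ?_
  rw [hf x.val x.pos (by omega), ← (ht x.val x.pos).bit h1 h2]
  rfl

theorem letterCount_false {pre : List (ℕ × ℕ)} (hpre : pre.Nodup) {v : ℕ} (hv : 0 < v) :
    letterCount v false (pre.filterMap T.entry) =
      (List.Ico (t v) (st (v + 1))).countP (fun i => G.c i j ∈ pre) := by
  have hm := h.st_le (v + 1)
  refine countP_filterMap_entry hpre (fun i i' h1 h2 h3 h4 h5 => ?_) (fun p x hx hP => ?_)
    (fun i h1 h2 => ?_)
  · exact G.c_injOn (by omega) (by omega) hj h5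
  · obtain ⟨i, h1, h2, h3, h4⟩ := (entry_iff_of_flag h ht hf).mp hx
    simp only [decide_eq_true_eq] at hP
    obtain ⟨rfl, hP⟩ := hP
    rw [hP, eq_comm, decide_eq_false_iff_not] at h4
    exact ⟨i, by omega, h2, h3⟩
  · have h3 := (ht v hv).le
    refine ⟨⟨v, hv, false⟩, (entry_iff_of_flag h ht hf).mpr ⟨i, by simp; omega, h2, rfl, ?_⟩, ?_⟩
    · simp [h1]
    · simp

theorem letterCount_true {pre : List (ℕ × ℕ)} (hpre : pre.Nodup) {v : ℕ} (hv : 0 < v) :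
    letterCount v true (pre.filterMap T.entry) =
      (List.Ico (st v) (t v)).countP (fun i => G.c i j ∈ pre) := by
  have hm := h.st_le (v + 1)
  have hv' := (ht v hv).le'
  refine countP_filterMap_entry hpre (fun i i' h1 h2 h3 h4 h5 => ?_) (fun p x hx hP => ?_)
    (fun i h1 h2 => ?_)
  · exact G.c_injOn (by omega) (by omega) hj h5
  · obtain ⟨i, h1, h2, h3, h4⟩ := (entry_iff_of_flag h ht hf).mp hx
    simp only [decide_eq_true_eq] at hP
    obtain ⟨rfl, hP⟩ := hP
    rw [hP, eq_comm, decide_eq_true_iff] at h4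
    exact ⟨i, h1, h4, h3⟩
  · refine ⟨⟨v, hv, true⟩, (entry_iff_of_flag h ht hf).mpr ⟨i, h1, by simp; omega, rfl, ?_⟩, ?_⟩
    · simp [h2]
    · simp

theorem letterCount_false_all {B : List (ℕ × ℕ)} (hB : B.Nodup) (hmem : ∀ i < m, G.c i j ∈ B)
    {v : ℕ} (hv : 0 < v) : letterCount v false (B.filterMap T.entry) = st (v + 1) - t v := by
  have hm := h.st_le (v + 1)
  rw [letterCount_false h hj ht hf hB hv, List.countP_eq_length.mpr, List.Ico.length]
  intro i hi
  rw [List.Ico.mem] at hi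
  simpa using hmem i (by omega)

section split

variable {B₁ B₂ : List (ℕ × ℕ)} {k : ℕ} (hB : (B₁ ++ G.c k j :: B₂).Pairwise Reads)
  (hmem : ∀ i < m, G.c i j ∈ B₁ ++ G.c k j :: B₂)
include hB hmem

omit h ht hf in
theorem countP_mem_left {a b : ℕ} (hb : b ≤ m) (hk : k < m) {P : ℕ → Bool}
    (hP : ∀ i, a ≤ i → i < b →
      ((G.rowC j i < G.rowC j k ∨ G.rowC j i = G.rowC j k ∧ k < i) ↔ P (G.rowC j i) = true)) :
    (List.Ico a b).countP (fun i => G.c i j ∈ B₁) = ((List.Ico a b).map (G.rowC j)).countP P := by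
  rw [List.countP_map]
  refine List.countP_congr fun i hi => ?_
  rw [List.Ico.mem] at hi
  rw [decide_eq_true_iff, mem_left_iff_reads hB (hmem i (by omega)),
    G.reads_iff (by omega) hk hj, hP i hi.1 hi.2]
  rfl

omit h ht hf in
theorem countP_mem_right {a b : ℕ} (hb : b ≤ m) (hk : k < m) {P : ℕ → Bool}
    (hP : ∀ i, a ≤ i → i < b →
      ((G.rowC j k < G.rowC j i ∨ G.rowC j k = G.rowC j i ∧ i < k) ↔ P (G.rowC j i) = true)) :
    (List.Ico a b).countP (fun i => G.c i j ∈ B₂) = ((List.Ico a b).map (G.rowC j)).countP P := by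
  rw [List.countP_map]
  refine List.countP_congr fun i hi => ?_
  rw [List.Ico.mem] at hi
  rw [decide_eq_true_iff, mem_right_iff_reads hB (hmem i (by omega)),
    G.reads_iff hk (by omega) hj, hP i hi.1 hi.2]
  rfl

/-- Whether the inequality is strict depends on ties: within a row, later letters of the listing are
further east and so are read earlier. A letter listed before `k` in the row of `k` is thus read
after it and not counted. -/
theorem letterCount_left_pred {v : ℕ} (hv : 0 < v) (hk : st (v + 1) ≤ k) (hk' : k < m) :
    letterCount v false (B₁.filterMap T.entry) =
      ((List.Ico (t v) (st (v + 1))).map (G.rowC j)).countP (· < G.rowC j k) := by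
  rw [letterCount_false h hj ht hf (List.pairwise_append.mp (nodup_of_reads hB)).1 hv]
  refine countP_mem_left hj hB hmem (h.st_le _) hk' fun i h1 h2 => ?_
  rw [decide_eq_true_iff]
  omega

theorem letterCount_left_primed {v : ℕ} (hv : 0 < v) (hk : k < t v) :
    letterCount v false (B₁.filterMap T.entry) =
      ((List.Ico (t v) (st (v + 1))).map (G.rowC j)).countP (· ≤ G.rowC j k) := by
  have := (ht v hv).le'
  have := h.st_le (v + 1)
  rw [letterCount_false h hj ht hf (List.pairwise_append.mp (nodup_of_reads hB)).1 hv]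
  refine countP_mem_left hj hB hmem (h.st_le _) (by omega) fun i h1 h2 => ?_
  rw [decide_eq_true_iff]
  omega

theorem letterCount_left_unprimed {v : ℕ} (hv : 0 < v) (hk : t v ≤ k) (hk' : k < st (v + 1)) :
    letterCount v false (B₁.filterMap T.entry) = st (v + 1) - (k + 1) := by
  have hm := h.st_le (v + 1)
  rw [letterCount_false h hj ht hf (List.pairwise_append.mp (nodup_of_reads hB)).1 hv,
    ← List.Ico.append_consecutive (m := k + 1) (by omega) (by omega), List.countP_append]
  have key : ∀ i, t v ≤ i → i < st (v + 1) → (G.c i j ∈ B₁ ↔ k < i) := by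
    intro i h1 h2
    rw [mem_left_iff_reads hB (hmem i (by omega)), G.reads_iff (by omega) (by omega) hj]
    rcases lt_or_ge k i with h3 | h3
    · have := (ht v hv).ge hk h3.le h2
      omega
    · have := (ht v hv).ge h1 h3 hk'
      omega
  rw [List.countP_eq_zero.mpr, List.countP_eq_length.mpr, List.Ico.length, Nat.zero_add]
  · intro i hi
    rw [List.Ico.mem] at hi
    simpa using (key i (by omega) hi.2).mpr (by omega)
  · intro i hi
    rw [List.Ico.mem] at hi
    simpa using mt (key i hi.1 (by omega)).mp (by omega)

theorem letterCount_right_pred {v : ℕ} (hv : 0 < v) (hk : t v ≤ k) (hk' : k < m) :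
    letterCount v true (B₂.filterMap T.entry) =
      ((List.Ico (st v) (t v)).map (G.rowC j)).countP (G.rowC j k ≤ ·) := by
  have := (ht v hv).le'
  have := h.st_le (v + 1)
  rw [letterCount_true h hj ht hf
    (List.pairwise_cons.mp (List.pairwise_append.mp (nodup_of_reads hB)).2.1).2 hv]
  refine countP_mem_right hj hB hmem (by omega) hk' fun i h1 h2 => ?_
  rw [decide_eq_true_iff]
  omega

theorem letterCount_right_same {v : ℕ} (hv : 0 < v) (hk : k < t v) :
    letterCount v true (B₂.filterMap T.entry) =
      ((List.Ico (st v) (t v)).map (G.rowC j)).countP (G.rowC j k < ·) := by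
  have := (ht v hv).le'
  have := h.st_le (v + 1)
  rw [letterCount_true h hj ht hf
    (List.pairwise_cons.mp (List.pairwise_append.mp (nodup_of_reads hB)).2.1).2 hv]
  refine countP_mem_right hj hB hmem (by omega) (by omega) fun i h1 h2 => ?_
  rw [decide_eq_true_iff]
  refine ⟨fun h3 => ?_, Or.inl⟩
  rcases h3 with h3 | ⟨h3, h4⟩
  · exact h3
  · have := (ht v hv).lt h1 h4 hk
    omega

end split

/-- The two halves of `isLatticeWord_iff` are translated into rows: the first yields `primed` and
`unprimed`, according to the prime of the letter `v + 1`, and the second yields `hat`. -/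
theorem isLatticeWord_iff_rowLattice : IsLatticeWord (word T) ↔ ∀ v, 0 < v →
    RowLattice ((List.Ico (st v) (t v)).map (G.rowC j))
      ((List.Ico (t v) (st (v + 1))).map (G.rowC j))
      ((List.Ico (st (v + 1)) (t (v + 1))).map (G.rowC j))
      ((List.Ico (t (v + 1)) (st (v + 1 + 1))).map (G.rowC j)) := by
  obtain ⟨B, hB, hBmem, hword⟩ := exists_reading T
  have hmem : ∀ i < m, G.c i j ∈ B := fun i hi => hBmem _ (h.mem_shape.mpr ⟨i, hi, rfl⟩)
  have hall := fun v (hv : 0 < v) =>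
    letterCount_false_all h hj ht hf (nodup_of_reads hB) hmem hv
  rw [isLatticeWord_iff, hword]
  constructor
  · rintro ⟨h1, h2⟩ v hv
    have hle := (ht v hv).le
    have hle' := (ht v hv).le'
    have hle1 := (ht (v + 1) (by omega)).le
    have hle1' := (ht (v + 1) (by omega)).le'
    have hm := h.st_le (v + 1 + 1)
    have hm' := h.st_le (v + 1)
    refine ⟨fun r hr => ?_, fun s g u hs => ?_, fun r hr => ?_⟩
    · obtain ⟨k, hk, rfl⟩ := List.mem_map.mp hr
      rw [List.Ico.mem] at hk
      obtain ⟨B₁, B₂, rfl⟩ := List.append_of_mem (hmem k (by omega))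
      have h3 := h1 v hv _ ⟨v + 1, by omega, true⟩ _
        (filterMap_eq_append_cons_iff.mpr ⟨B₁, _, B₂, rfl, (entry_iff_of_flag h ht hf).mpr
          ⟨k, hk.1, by simp; omega, rfl, by simp [hk.2]⟩, rfl, rfl⟩) rfl
      rwa [letterCount_left_pred h hj ht hf hB hmem hv hk.1 (by omega),
        letterCount_left_primed h hj ht hf hB hmem (by omega) hk.2] at h3
    · obtain ⟨k, hk1, hk2, -, rfl, rfl⟩ := ico_map_eq_append_cons hle1' hs
      obtain ⟨B₁, B₂, rfl⟩ := List.append_of_mem (hmem k (by omega))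
      have h3 := h1 v hv _ ⟨v + 1, by omega, false⟩ _
        (filterMap_eq_append_cons_iff.mpr ⟨B₁, _, B₂, rfl, (entry_iff_of_flag h ht hf).mpr
          ⟨k, by simp; omega, hk2, rfl, by simp [hk1]⟩, rfl, rfl⟩) rfl
      rw [letterCount_left_pred h hj ht hf hB hmem hv (by omega) (by omega),
        letterCount_left_unprimed h hj ht hf hB hmem (by omega) hk1 hk2] at h3
      rwa [List.length_map, List.Ico.length]
    · have key : ∃ k, t v ≤ k ∧ k < t (v + 1) ∧ r = G.rowC j k ∧
          ∃ x : Letter, T.entry (G.c k j) = some x ∧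
            (x.val = v ∧ x.primed = false ∨ x.val = v + 1 ∧ x.primed = true) := by
        rcases hr with hr | hr
        · obtain ⟨k, hk, rfl⟩ := List.mem_map.mp hr
          rw [List.Ico.mem] at hk
          refine ⟨k, hk.1, by omega, rfl, ⟨v, hv, false⟩, (entry_iff_of_flag h ht hf).mpr
            ⟨k, by simp; omega, hk.2, rfl, by simp [hk.1]⟩, Or.inl ⟨rfl, rfl⟩⟩
        · obtain ⟨k, hk, rfl⟩ := List.mem_map.mp hr
          rw [List.Ico.mem] at hk
          refine ⟨k, by omega, hk.2, rfl, ⟨v + 1, by omega, true⟩, (entry_iff_of_flag h ht hf).mpr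
            ⟨k, hk.1, by simp; omega, rfl, by simp [hk.2]⟩, Or.inr ⟨rfl, rfl⟩⟩
      obtain ⟨k, hk1, hk2, rfl, x, hx, hx'⟩ := key
      obtain ⟨B₁, B₂, rfl⟩ := List.append_of_mem (hmem k (by omega))
      have h3 := h2 v hv _ x _
        (filterMap_eq_append_cons_iff.mpr ⟨B₁, _, B₂, rfl, hx, rfl, rfl⟩) hx'
      rw [hall v hv, hall (v + 1) (by omega),
        letterCount_right_pred h hj ht hf hB hmem hv hk1 (by omega),
        letterCount_right_same h hj ht hf hB hmem (by omega) hk2] at h3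
      rwa [List.length_map, List.length_map, List.Ico.length, List.Ico.length]
  · intro hrl
    refine ⟨fun v hv pre x post hw hxv => ?_, fun v hv pre x post hw hxv => ?_⟩ <;>
    obtain ⟨B₁, p, B₂, rfl, hx, rfl, rfl⟩ := filterMap_eq_append_cons_iff.mp hw <;>
    obtain ⟨k, hk1, hk2, rfl, hk3⟩ := (entry_iff_of_flag h ht hf).mp hx <;>
    have hle := (ht v hv).le <;>
    have hle' := (ht v hv).le' <;>
    have hle1 := (ht (v + 1) (by omega)).le <;>
    have hle1' := (ht (v + 1) (by omega)).le' <;>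
    have hm := h.st_le (v + 1 + 1) <;>
    have hm' := h.st_le (v + 1)
    · rw [hxv] at hk1 hk2 hk3
      rw [letterCount_left_pred h hj ht hf hB hmem hv hk1 (by omega)]
      by_cases hk : k < t (v + 1)
      · rw [letterCount_left_primed h hj ht hf hB hmem (by omega) hk]
        exact (hrl v hv).primed _ (List.mem_map_of_mem (List.Ico.mem.mpr ⟨hk1, hk⟩))
      · rw [letterCount_left_unprimed h hj ht hf hB hmem (by omega) (by omega) hk2]
        have h3 := (hrl v hv).unprimed ((List.Ico (t (v + 1)) k).map (G.rowC j)) (G.rowC j k)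
          ((List.Ico (k + 1) (st (v + 1 + 1))).map (G.rowC j)) (by
            rw [← List.map_cons, ← List.map_append, ← List.Ico.eq_cons hk2,
              List.Ico.append_consecutive (by omega) (by omega)])
        rwa [List.length_map, List.Ico.length] at h3
    · have key : t v ≤ k ∧ k < t (v + 1) ∧
          (G.rowC j k ∈ (List.Ico (t v) (st (v + 1))).map (G.rowC j) ∨
          G.rowC j k ∈ (List.Ico (st (v + 1)) (t (v + 1))).map (G.rowC j)) := by
        rcases hxv with ⟨h3, h4⟩ | ⟨h3, h4⟩
        · rw [h3] at hk1 hk2 hk3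
          rw [h4, eq_comm, decide_eq_false_iff_not] at hk3
          exact ⟨by omega, by omega, Or.inl (List.mem_map_of_mem
            (List.Ico.mem.mpr ⟨by omega, hk2⟩))⟩
        · rw [h3] at hk1 hk2 hk3
          rw [h4, eq_comm, decide_eq_true_iff] at hk3
          exact ⟨by omega, by omega, Or.inr (List.mem_map_of_mem
            (List.Ico.mem.mpr ⟨hk1, hk3⟩))⟩
      obtain ⟨h3, h4, h5⟩ := key
      have h6 := (hrl v hv).hat _ h5
      rw [hall v hv, hall (v + 1) (by omega),
        letterCount_right_pred h hj ht hf hB hmem hv h3 (by omega),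
        letterCount_right_same h hj ht hf hB hmem (by omega) h4]
      rwa [List.length_map, List.length_map, List.Ico.length, List.Ico.length] at h6

end lattice

section listing

variable {st : ℕ → ℕ} {f : ℕ → Bool} {m n j : ℕ} {G : Grid m n} {T : Filling Letter}
  (h : IsListing st f m (fun i => G.c i j) T) (hj : j ≤ n)
include h hj

theorem weight_eq {v : ℕ} (hv : 0 < v) : weight T v = st (v + 1) - st v := by
  have hm := h.st_le (v + 1)
  have h1 : T.shape.filter (fun p => (T.entry p).any (fun x => x.val = v) = true) =
      (Finset.Ico (st v) (st (v + 1))).image (fun i => G.c i j) := by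
    ext p
    rw [Finset.mem_filter, Finset.mem_image]
    constructor
    · rintro ⟨-, h2⟩
      cases hx : T.entry p with
      | none => simp [hx] at h2
      | some x =>
        obtain ⟨i, h3, h4, h5, -⟩ := (h.entry p x).mp hx
        have h6 : x.val = v := by simpa [hx] using h2
        subst h6
        exact ⟨i, Finset.mem_Ico.mpr ⟨h3, h4⟩, h5.symm⟩
    · rintro ⟨i, hi, rfl⟩
      rw [Finset.mem_Ico] at hi
      have h2 := h.entry_c hv hi.1 hi.2
      refine ⟨?_, ?_⟩
      · rw [T.mem_shape, h2]; rfl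
      · rw [h2]; simp
  rw [weight, h1, Finset.card_image_of_injOn, Nat.card_Ico]
  intro i hi i' hi' heq
  rw [Finset.coe_Ico, Set.mem_Ico] at hi hi'
  exact G.c_injOn (by omega) (by omega) hj heq

/-- The peak is in the lowest row of its window and is the first, hence westernmost, letter in this
row; so it is read last, and its prime is the free one. -/
theorem getLast?_filter_word {v : ℕ} (hv : 0 < v) (hlt : st v < st (v + 1)) :
    ((word T).filter (fun y => y.val = v)).getLast? = some ⟨v, hv, f v⟩ := by
  have hm := h.st_le (v + 1)
  obtain ⟨q, hq⟩ := h.peak v hlt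
  have hq1 := hq.lo_le
  have hq2 := hq.lt_hi
  obtain ⟨B, hB, hBmem, hword⟩ := exists_reading T
  obtain ⟨B₁, B₂, rfl⟩ := List.append_of_mem (hBmem (G.c q j) (h.mem_shape.mpr ⟨q, by omega, rfl⟩))
  have hent := h.entry_c hv hq1 hq2
  rw [hq.bit_eq] at hent
  have hnil : (B₂.filterMap T.entry).filter (fun y => y.val = v) = [] := by
    rw [List.filter_eq_nil_iff]
    intro y hy hyv
    obtain ⟨p, hp, hpy⟩ := List.mem_filterMap.mp hy
    obtain ⟨i, h1, h2, rfl, -⟩ := (h.entry p y).mp hpy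
    rw [decide_eq_true_iff] at hyv
    rw [hyv] at h1 h2
    have h3 := List.rel_of_pairwise_cons (List.pairwise_append.mp hB).2.1 hp
    rw [G.reads_iff (by omega) (by omega) hj] at h3
    simp only [Grid.rowC] at h3
    rcases le_or_gt q i with h4 | h4
    · have := hq.ge le_rfl h4 h2
      omega
    · have := hq.lt h1 h4 le_rfl
      omega
  rw [hword, List.filterMap_append, List.filterMap_cons_some hent, List.filter_append,
    List.filter_cons_of_pos (by simp), hnil, List.getLast?_append]
  simp

theorem isLRSWord_flags_iff :
    (∀ i x, ((word T).filter (fun y => y.val = i)).getLast? = some x → x.primed = false) ↔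
      ∀ v, 0 < v → st v < st (v + 1) → f v = false := by
  constructor
  · intro h1 v hv hlt
    exact h1 v _ (getLast?_filter_word h hj hv hlt)
  · intro h1 v x hx
    obtain ⟨hx1, hx2⟩ := List.mem_filter.mp (List.mem_of_getLast? hx)
    rw [decide_eq_true_iff] at hx2
    obtain ⟨B, -, -, hword⟩ := exists_reading T
    rw [hword] at hx1
    obtain ⟨p, -, hp⟩ := List.mem_filterMap.mp hx1
    obtain ⟨i, h2, h3, -⟩ := (h.entry p x).mp hp
    have hv : 0 < v := by have := x.pos; omega
    rw [hx2] at h2 h3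
    have h4 : st v < st (v + 1) := by omega
    rw [getLast?_filter_word h hj hv h4] at hx
    rw [← Option.some.inj hx]
    exact h1 v hv h4

/-- A listed tableau is a Littlewood–Richardson–Stembridge tableau if and only if its weight is
strict, the last of the letters `v` and `v'` is unprimed for each `v`, and a hook subword of the rows
of two consecutive letters is not longer than the number of the first of these letters. -/
theorem isLRS_iff {lam mu : StrictPartition} (hmu : (mu.diagram : Set (ℕ × ℕ)) = G.K 0 j)
    (hlam : (lam.diagram : Set (ℕ × ℕ)) = G.K m j) : IsLRS lam mu T ↔
      (∃ rho : StrictPartition, ∀ k, st (k + 1 + 1) - st (k + 1) = rho.part k) ∧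
      (∀ v, 0 < v → st v < st (v + 1) → f v = false) ∧
      ∀ v, 0 < v → ∀ N, Hook (G.rows j (st v) (st (v + 1 + 1))) N → N ≤ st (v + 1) - st v := by
  have hlat : (∀ v, 0 < v → st v < st (v + 1) → f v = false) → (IsLatticeWord (word T) ↔
      ∀ v, 0 < v → ∀ N, Hook (G.rows j (st v) (st (v + 1 + 1))) N → N ≤ st (v + 1) - st v) := by
    intro hf
    have hex : ∀ v, ∃ t, 0 < v → IsTurn (G.rowC j) (st v) (st (v + 1)) t := by
      intro v
      by_cases hlt : st v < st (v + 1)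
      · obtain ⟨q, hq⟩ := h.peak v hlt
        exact ⟨q, fun _ => ⟨hq.lo_le, hq.lt_hi.le, fun _ => hq⟩⟩
      · exact ⟨st v, fun _ => ⟨le_rfl, h.mono (Nat.le_succ v), fun h1 => absurd h1 hlt⟩⟩
    choose t ht using hex
    rw [isLatticeWord_iff_rowLattice h hj ht hf]
    refine forall_congr' fun v => forall_congr' fun hv => ?_
    have hv' : 0 < v + 1 := by omega
    have hle := (ht v hv).le
    have hle' := (ht v hv).le'
    have hle1 := (ht (v + 1) hv').le
    have hle1' := (ht (v + 1) hv').le'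
    rw [rowLattice_iff_hook (ht v hv).pairwise_lt (ht v hv).pairwise_ge (ht _ hv').pairwise_lt
      (ht _ hv').pairwise_ge, ← List.map_append, ← List.map_append, ← List.map_append,
      List.Ico.append_consecutive hle1 hle1', List.Ico.append_consecutive hle' (by omega),
      List.Ico.append_consecutive hle (by omega), List.length_map, List.length_map,
      List.Ico.length, List.Ico.length, show t v - st v + (st (v + 1) - t v) = st (v + 1) - st v by
        omega]
    rfl
  constructor
  · intro hT
    have hf := (isLRSWord_flags_iff h hj).mp hT.lrs_word.2
    refine ⟨?_, hf, (hlat hf).mp hT.lrs_word.1⟩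
    obtain ⟨rho, hrho⟩ := hT.weight_strict
    exact ⟨rho, fun k => by rw [← hrho, weight_eq h hj (Nat.succ_pos k)]⟩
  · rintro ⟨⟨rho, hrho⟩, hf, hh⟩
    refine ⟨⟨h.isSYT hj hmu hlam, fun i x hx => ?_⟩, ⟨rho, fun k => ?_⟩, (hlat hf).mpr hh,
      (isLRSWord_flags_iff h hj).mpr hf⟩
    · obtain ⟨k, h1, h2, h3, h4⟩ := (h.entry _ x).mp hx
      obtain ⟨q, hq⟩ := h.peak x.val (by omega)
      -- Semistandardness is automatic: a letter on the diagonal is the peak, whose prime is absent.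
      have h5 := G.eq_peak_of_diag h1 h2 (h.st_le _) hj hq (by rw [← h3])
      subst h5
      rw [h4, hq.bit_eq]
      exact hf _ x.pos (by omega)
    · rw [weight_eq h hj (Nat.succ_pos k), hrho]

end listing

/-- The Littlewood–Richardson–Stembridge property is preserved when the letters of a listed tableau
pass those of another one. -/
theorem IsLRS.of_listing {st : ℕ → ℕ} {f : ℕ → Bool} {m n j j' : ℕ} {G : Grid m n}
    {T T' : Filling Letter} (h : IsListing st f m (fun i => G.c i j) T) (hj : j ≤ n)
    (h' : IsListing st f m (fun i => G.c i j') T') (hj' : j' ≤ n) {lam mu lam' mu' : StrictPartition}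
    (hmu : (mu.diagram : Set (ℕ × ℕ)) = G.K 0 j) (hlam : (lam.diagram : Set (ℕ × ℕ)) = G.K m j)
    (hmu' : (mu'.diagram : Set (ℕ × ℕ)) = G.K 0 j') (hlam' : (lam'.diagram : Set (ℕ × ℕ)) = G.K m j')
    (hT : IsLRS lam mu T) : IsLRS lam' mu' T' := by
  obtain ⟨h1, h2, h3⟩ := (isLRS_iff h hj hmu hlam).mp hT
  refine (isLRS_iff h' hj' hmu' hlam').mpr ⟨h1, h2, fun v hv N hN => h3 v hv N ?_⟩
  have h4 : st v ≤ st (v + 1 + 1) := h.mono (by omega)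
  -- Only the hook condition refers to the level, and hooks are the same at all levels.
  rw [G.hook_rows hj' h4 (h.st_le _)] at hN
  rwa [G.hook_rows hj h4 (h.st_le _)]

end ShiftedSwitching

/-! ### The theorem -/

theorem mainTheorem1 (lam mu nu : StrictPartition) (S T : Filling Letter)
    (hS : IsSYT mu nu S) (hT : IsSYT lam mu T) :
    tableauSwitching (tableauSwitching (S, T)) = (S, T) ∧
      ∃ kappa : StrictPartition,
        IsSYT kappa nu (tableauSwitching (S, T)).1 ∧
        IsSYT lam kappa (tableauSwitching (S, T)).2 ∧
        (IsLRS lam mu T → IsLRS kappa nu (tableauSwitching (S, T)).1) ∧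
        (IsLRS mu nu S → IsLRS lam kappa (tableauSwitching (S, T)).2) := by
  obtain ⟨s, f, M, c, hsL, hc, hcK⟩ := hS.exists_listing
  obtain ⟨t, g, N, d, htL, hd, hdK⟩ := hT.exists_listing
  obtain ⟨G, hG0, hGc, hGd⟩ := exists_grid M N _ c d nu.isLower_diagram hc (by rwa [hcK])
  have hsL' : IsListing s f M (fun i => G.c i 0) S := hsL.congr fun i hi => hGc i hi
  have htL' : IsListing t g N (fun j => G.d M j) T := htL.congr fun j hj => hGd j hj
  have hGM : (mu.diagram : Set (ℕ × ℕ)) = G.K M 0 := by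
    rw [← hcK, G.K_eq_grow_c le_rfl (Nat.zero_le _), hG0]
    exact grow_congr _ fun i hi => (hGc i hi).symm
  have hGMN : (lam.diagram : Set (ℕ × ℕ)) = G.K M N := by
    rw [← hdK, G.K_eq_grow_d le_rfl le_rfl, hGM]
    exact grow_congr _ fun i hi => (hGd i hi).symm
  -- The shape `kappa` is the corner of the grid reached from `nu` by adding the final boxes of `T`.
  obtain ⟨kappa, hkappa⟩ := exists_diagram_eq (G.lower 0 N (Nat.zero_le _) le_rfl) (lam := lam)
    (by rw [hGMN]; exact G.K_mono (Nat.zero_le _) le_rfl le_rfl le_rfl)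
  obtain ⟨h1, h2⟩ := isListing_tableauSwitching hsL' htL'
  -- In the transposed grid the letters of `T` form the first chain, so that the results on the
  -- first chain apply to `T` as well.
  have h1' : IsListing t g N (fun j => G.transpose.c j 0) (tableauSwitching (S, T)).1 := h1
  refine ⟨tableauSwitching_tableauSwitching hsL' htL', kappa, ?_, ?_, ?_, ?_⟩
  · exact h1'.isSYT (Nat.zero_le _) hG0.symm hkappa
  · exact h2.isSYT le_rfl hkappa hGMN
  · exact IsLRS.of_listing (G := G.transpose) htL' le_rfl h1' (Nat.zero_le _) hGM hGMN hG0.symm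
      hkappa
  · exact IsLRS.of_listing hsL' (Nat.zero_le _) h2 le_rfl hG0.symm hGM hkappa hGMN
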